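/- Let $(M,\omega)$ be a symplectic manifold of dimension $2n$ with integral symplectic form, and let $(L,\nabla)$ be prequantization data for it: a smooth complex line bundle $L$ on $M$ with a Hermitian metric and a smooth Hermitian connection $\nabla$ of curvature $2\pi i\,\omega$. (Such data exist exactly when $[\omega]$ is integral.) Let $\pi\colon M\to B$ be a smooth map to an $n$-dimensional manifold $B$, with image $\Delta=\pi(M)$, which is a Lagrangian fibration over $\Delta$ with compact fibres, possibly with singular ones: all fibres are compact, and $\omega$ vanishes on $\ker d\pi_x$ at each point $x$ at which $d\pi_x$ is surjective. A fibre $\pi^{-1}(b)$, $b\in\Delta$, is called smooth if $d\pi_x$ is surjective at all of its points $x$ (it is then a compact Lagrangian submanifold), and a smooth fibre $S$ is called Bohr–Sommerfeld if the restriction $(L,\nabla)|_S$ admits a nowhere vanishing covariantly constant section. Then the set of smooth Bohr–Sommerfeld fibres is discrete: every $b_0\in\Delta$ whose fibre is smooth and Bohr–Sommerfeld has a neighbourhood in $\Delta$ which contains no other such point. Suppose moreover that $M$ is compact and that $\pi$ degenerates regularly, that is, each critical point $x$ of $\pi$ (if there are any) has a neighbourhood with Darboux coordinates $q_i,p_i$,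 $\omega=\sum_i dp_i\wedge dq_i$, such that in a smooth chart of $B$ the components of $\pi$ are $p_i$ for $i\notin K$ and $\tfrac12(q_i^2+p_i^2)$ for $i\in K$, where $K\subset\{1,\dots,n\}$ and $q_i(x)=p_i(x)=0$ for $i\in K$. Then the set of smooth Bohr–Sommerfeld fibres is finite. -/

import Mathlib

open Bundle
open scoped Manifold ContDiff

noncomputable section

/-- The tangent space at `x` of an `m`-dimensional manifold (without boundary). -/
abbrev TSpace (m : ℕ) {X : Type*} [TopologicalSpace X]
    [ChartedSpace (EuclideanSpace ℝ (Fin m)) X] (x : X) : Type :=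
  TangentSpace (𝓡 m) x

/-- `V` is a smooth (`C^∞`) vector field. -/
def IsSmoothVectorField {m : ℕ} {X : Type*} [TopologicalSpace X]
    [ChartedSpace (EuclideanSpace ℝ (Fin m)) X] [IsManifold (𝓡 m) ∞ X]
    (V : Π x : X, TSpace m x) : Prop :=
  ContMDiff (𝓡 m) ((𝓡 m).prod 𝓘(ℝ, EuclideanSpace ℝ (Fin m))) ∞
    (fun x ↦ TotalSpace.mk' (EuclideanSpace ℝ (Fin m)) (E := TSpace m (X := X)) x (V x))

/-- `Ω` is a symplectic form: a smooth, alternating, nondegenerate, closed 2-form.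
Closedness is expressed by the invariant formula for `dΩ(X, Y, Z)`. -/
structure IsSymplecticForm {m : ℕ} {M : Type*} [TopologicalSpace M]
    [ChartedSpace (EuclideanSpace ℝ (Fin m)) M] [IsManifold (𝓡 m) ∞ M]
    (Ω : Π x : M, TSpace m x →L[ℝ] TSpace m x →L[ℝ] ℝ) : Prop where
  smooth : ContMDiff (𝓡 m) ((𝓡 m).prod
      𝓘(ℝ, EuclideanSpace ℝ (Fin m) →L[ℝ] EuclideanSpace ℝ (Fin m) →L[ℝ] ℝ)) ∞
    (fun x ↦ TotalSpace.mk'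
      (EuclideanSpace ℝ (Fin m) →L[ℝ] EuclideanSpace ℝ (Fin m) →L[ℝ] ℝ)
      (E := fun x : M ↦ TSpace m x →L[ℝ] TSpace m x →L[ℝ] ℝ) x (Ω x))
  alternating : ∀ (x : M) (v : TSpace m x), Ω x v v = 0
  nondegenerate : ∀ (x : M) (v : TSpace m x), (∀ w : TSpace m x, Ω x v w = 0) → v = 0
  closed : ∀ X Y Z : Π x : M, TSpace m x,
    IsSmoothVectorField X → IsSmoothVectorField Y → IsSmoothVectorField Z → ∀ x : M,
      mvfderiv (𝓡 m) (fun y ↦ Ω y (Y y) (Z y)) x (X x)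
        - mvfderiv (𝓡 m) (fun y ↦ Ω y (X y) (Z y)) x (Y x)
        + mvfderiv (𝓡 m) (fun y ↦ Ω y (X y) (Y y)) x (Z x)
        - Ω x (VectorField.mlieBracket (𝓡 m) X Y x) (Z x)
        + Ω x (VectorField.mlieBracket (𝓡 m) X Z x) (Y x)
        - Ω x (VectorField.mlieBracket (𝓡 m) Y Z x) (X x) = 0

/-- `σ` is a smooth section of the complex line bundle `L`. -/
def IsSmoothSection {m : ℕ} {M : Type*} [TopologicalSpace M]
    [ChartedSpace (EuclideanSpace ℝ (Fin m)) M]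
    {L : M → Type*} [TopologicalSpace (TotalSpace ℂ L)]
    [∀ x, NormedAddCommGroup (L x)] [∀ x, InnerProductSpace ℂ (L x)]
    [FiberBundle ℂ L]
    (σ : Π x : M, L x) : Prop :=
  ContMDiff (𝓡 m) ((𝓡 m).prod 𝓘(ℝ, ℂ)) ∞ (fun x ↦ TotalSpace.mk' ℂ (E := L) x (σ x))

/-- `(L, ∇)` is prequantization data for the symplectic form `Ω`. Here `L` is a smooth complex line
bundle (its trivializations are complex linear, and smooth over the reals) with a Hermitian metric,
given by the complex inner products on its fibres, which is smooth, and `∇` is a smooth connection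
which is complex linear, preserves the Hermitian metric and has curvature `2πi * Ω`.
Note that `∇ σ x v` is the covariant derivative of `σ` at `x` in the direction `v`. -/
structure IsPrequantization {m : ℕ} {M : Type*} [TopologicalSpace M]
    [ChartedSpace (EuclideanSpace ℝ (Fin m)) M] [IsManifold (𝓡 m) ∞ M]
    {L : M → Type*} [TopologicalSpace (TotalSpace ℂ L)]
    [∀ x, NormedAddCommGroup (L x)] [∀ x, InnerProductSpace ℂ (L x)]
    [FiberBundle ℂ L] [VectorBundle ℂ ℂ L]
    [VectorBundle ℝ ℂ L] [ContMDiffVectorBundle ∞ ℂ L (𝓡 m)]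
    (Ω : Π x : M, TSpace m x →L[ℝ] TSpace m x →L[ℝ] ℝ)
    (nabla : CovariantDerivative (𝓡 m) ℂ L) : Prop where
  smooth : CovariantDerivative.ContMDiffCovariantDerivative nabla ∞
  complex_linear : ∀ σ : Π x : M, L x, IsSmoothSection (m := m) σ → ∀ (x : M) (v : TSpace m x),
    nabla (fun y ↦ Complex.I • σ y) x v = Complex.I • nabla σ x v
  metric_smooth : ∀ σ τ : Π x : M, L x, IsSmoothSection (m := m) σ → IsSmoothSection (m := m) τ →
    ContMDiff (𝓡 m) 𝓘(ℝ, ℂ) ∞ (fun x ↦ inner ℂ (σ x) (τ x))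
  metric_parallel : ∀ σ τ : Π x : M, L x,
    IsSmoothSection (m := m) σ → IsSmoothSection (m := m) τ → ∀ (x : M) (v : TSpace m x),
      mvfderiv (𝓡 m) (fun y ↦ inner ℂ (σ y) (τ y)) x v
        = inner ℂ (nabla σ x v) (τ x) + inner ℂ (σ x) (nabla τ x v)
  curvature : ∀ (X Y : Π x : M, TSpace m x) (σ : Π x : M, L x),
    IsSmoothVectorField X → IsSmoothVectorField Y → IsSmoothSection (m := m) σ → ∀ x : M,
      nabla (fun y ↦ nabla σ y (Y y)) x (X x) - nabla (fun y ↦ nabla σ y (X y)) x (Y x)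
        - nabla σ x (VectorField.mlieBracket (𝓡 m) X Y x)
      = (2 * Real.pi * Complex.I * (Ω x (X x) (Y x) : ℂ)) • σ x

/-- `x` is a regular point of `pr`: the differential of `pr` at `x` is surjective. -/
def IsRegularPt {m n : ℕ} {M : Type*} [TopologicalSpace M]
    [ChartedSpace (EuclideanSpace ℝ (Fin m)) M]
    {B : Type*} [TopologicalSpace B] [ChartedSpace (EuclideanSpace ℝ (Fin n)) B]
    (pr : M → B) (x : M) : Prop :=
  Function.Surjective (mfderiv (𝓡 m) (𝓡 n) pr x)

/-- `pr : M → B`, from a symplectic manifold of dimension `2n` to a manifold of dimension `n`, is a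
Lagrangian fibration (over its image, possibly with singular fibres) with compact fibres:
it is smooth, its fibres are compact, and `Ω` vanishes on the tangent space
`ker dpr_x` of the fibre (which has dimension `n`) at every regular point `x`. -/
structure IsLagrangianFibration {n : ℕ} {M : Type*} [TopologicalSpace M]
    [ChartedSpace (EuclideanSpace ℝ (Fin (2 * n))) M]
    {B : Type*} [TopologicalSpace B] [ChartedSpace (EuclideanSpace ℝ (Fin n)) B]
    (Ω : Π x : M, TSpace (2 * n) x →L[ℝ] TSpace (2 * n) x →L[ℝ] ℝ) (pr : M → B) : Prop where
  smooth : ContMDiff (𝓡 (2 * n)) (𝓡 n) ∞ pr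
  compact_fibre : ∀ b : B, IsCompact (pr ⁻¹' {b})
  lagrangian : ∀ x : M, IsRegularPt (m := 2 * n) (n := n) pr x → ∀ v w : TSpace (2 * n) x,
    mfderiv (𝓡 (2 * n)) (𝓡 n) pr x v = 0 → mfderiv (𝓡 (2 * n)) (𝓡 n) pr x w = 0 → Ω x v w = 0

/-- The fibration `pr` degenerates regularly (in the toric, or elliptic, way) at `x`: on a
neighbourhood `U` of `x` there are Darboux coordinates `q_i, p_i`, so `Ω = ∑ dp_i ∧ dq_i`,
and there is a smooth chart `ψ` of the base in which
`pr` is given by `p_i` for `i ∉ K` and by `(q_i² + p_i²) / 2` for `i ∈ K`, where `q_i` and `p_i`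
vanish at `x` for `i ∈ K`. So a small neighbourhood of `x` is mapped onto a corner of codimension `#K`,
and near `x` the fibre through `x` is an isotropic submanifold of dimension `n - #K`. -/
def IsToricAt {n : ℕ} {M : Type*} [TopologicalSpace M]
    [ChartedSpace (EuclideanSpace ℝ (Fin (2 * n))) M]
    {B : Type*} [TopologicalSpace B] [ChartedSpace (EuclideanSpace ℝ (Fin n)) B]
    (Ω : Π x : M, TSpace (2 * n) x →L[ℝ] TSpace (2 * n) x →L[ℝ] ℝ) (pr : M → B) (x : M) : Prop :=
  ∃ (U : Set M) (q p : Fin n → M → ℝ) (K : Finset (Fin n))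
    (ψ : OpenPartialHomeomorph B (EuclideanSpace ℝ (Fin n))),
    IsOpen U ∧ x ∈ U ∧
    (∀ i, ContMDiffOn (𝓡 (2 * n)) 𝓘(ℝ, ℝ) ∞ (q i) U) ∧
    (∀ i, ContMDiffOn (𝓡 (2 * n)) 𝓘(ℝ, ℝ) ∞ (p i) U) ∧
    (∀ y ∈ U, ∀ v w : TSpace (2 * n) y, Ω y v w =
      ∑ i, (mvfderiv (𝓡 (2 * n)) (p i) y v * mvfderiv (𝓡 (2 * n)) (q i) y w
        - mvfderiv (𝓡 (2 * n)) (p i) y w * mvfderiv (𝓡 (2 * n)) (q i) y v)) ∧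
    ψ ∈ IsManifold.maximalAtlas (𝓡 n) ∞ B ∧
    (∀ y ∈ U, pr y ∈ ψ.source) ∧
    (∀ y ∈ U, ∀ i ∉ K, ψ (pr y) i = p i y) ∧
    (∀ y ∈ U, ∀ i ∈ K, ψ (pr y) i = (q i y ^ 2 + p i y ^ 2) / 2) ∧
    (∀ i ∈ K, q i x = 0 ∧ p i x = 0)

/-- The fibre of `pr` over `b` is a Bohr-Sommerfeld fibre of the prequantization data `(L, ∇)`: the
restriction of `(L, ∇)` to the fibre has a nowhere vanishing covariantly constant section.
A smooth section over a closed submanifold extends to the ambient manifold, and its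
derivative along the submanifold does not depend on the extension; so the section is given
here as the restriction of a section `σ` of `L`. -/
def IsBohrSommerfeldFibre {m n : ℕ} {M : Type*} [TopologicalSpace M]
    [ChartedSpace (EuclideanSpace ℝ (Fin m)) M]
    {L : M → Type*} [TopologicalSpace (TotalSpace ℂ L)]
    [∀ x, NormedAddCommGroup (L x)] [∀ x, InnerProductSpace ℂ (L x)]
    [FiberBundle ℂ L]
    {B : Type*} [TopologicalSpace B] [ChartedSpace (EuclideanSpace ℝ (Fin n)) B]
    (nabla : CovariantDerivative (𝓡 m) ℂ L) (pr : M → B) (b : B) : Prop :=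
  ∃ σ : Π x : M, L x, IsSmoothSection (m := m) σ ∧ ∀ x : M, pr x = b →
    σ x ≠ 0 ∧ ∀ v : TSpace m x, mfderiv (𝓡 m) (𝓡 n) pr x v = 0 → nabla σ x v = 0

/-- The set of smooth Bohr-Sommerfeld fibres, as a subset of the base: the points `b` in the image
of `pr` such that all points of the fibre over `b` are regular, and the
fibre is Bohr-Sommerfeld. -/
def smoothBohrSommerfeld {m n : ℕ} {M : Type*} [TopologicalSpace M]
    [ChartedSpace (EuclideanSpace ℝ (Fin m)) M]
    {L : M → Type*} [TopologicalSpace (TotalSpace ℂ L)]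
    [∀ x, NormedAddCommGroup (L x)] [∀ x, InnerProductSpace ℂ (L x)]
    [FiberBundle ℂ L]
    {B : Type*} [TopologicalSpace B] [ChartedSpace (EuclideanSpace ℝ (Fin n)) B]
    (nabla : CovariantDerivative (𝓡 m) ℂ L) (pr : M → B) : Set B :=
  {b | b ∈ Set.range pr ∧ (∀ x : M, pr x = b → IsRegularPt (m := m) (n := n) pr x) ∧
    IsBohrSommerfeldFibre (n := n) nabla pr b}

end

/-! The proof uses neither action-angle coordinates nor connectedness of the fibres. For a
nonvanishing section `s`, write `∇(s/|s|) = i α (s/|s|)` (`phaseForm`). The curvature condition says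
`dα = 2π Ω` (`fderiv_coordPhaseForm`). For two sections, the circle-valued function `G = phase ⟨s,
τ⟩` satisfies `dG = i (α_τ - α_s) G`. So if `τ` is flat along a fibre, then there `dG = -i J G`,
where `J` is the restriction of `α_s` to the fibre.

Discreteness. A flat section over the fibre at `b` can be altered off the fibre so that its form
vanishes at the points of the fibre in all directions (`exists_phaseForm_eq_zero`). The transverse
derivative of `J` is then `2π Ω` paired between transverse and fibre directions, which is injective
because the fibre is Lagrangian. Hence on nearby fibres `J` is small but nowhere zero
(`eventually_fibrePhaseForm_ne_zero`). If such a fibre had a flat section, `G` would have no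
critical points on a compact fibre and so would be onto the circle
(`exists_eq_of_im_eq_zero_of_isMaxOn`). But a fixed finite number of open sets covers the fibre, and
on each of them `G` is nearly constant, so the pigeonhole principle gives a contradiction
(`eventually_not_isPhaseFlatOn`). The argument is local enough to apply to a compact, relatively
open part `C` of a fibre.

Finiteness. If the set is infinite, it accumulates at some `b`, whose fibre may be singular. Near an
elliptic critical point a regular fibre contains a small circle, the orbit of a rotation in Darboux
coordinates. Its holonomy is determined by the enclosed area and is nontrivial when the circle is
small, so no flat section exists on such a fibre (`exists_nhds_of_isToricAt`). Moreover the regular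
points of the fibre over `b` form a closed set `C`. If `C` is empty, points of the Bohr–Sommerfeld
fibres accumulate at a critical point, which is impossible. Otherwise the flat sections over the
accumulating fibres have a limit along an ultrafilter, which is a flat section over `C`
(`exists_isPhaseFlatOn_of_ultrafilter`), and this contradicts the discreteness argument applied to
`C`. -/

open Filter Set Topology

/-! ### Phases of complex numbers -/

/-- The phase `w / |w|` of a complex number. -/
noncomputable def phase (w : ℂ) : ℂ := w / (‖w‖ : ℂ)

lemma norm_phase {w : ℂ} (hw : w ≠ 0) : ‖phase w‖ = 1 := by
  simp [phase, hw]

lemma phase_real_mul {c : ℝ} (hc : 0 < c) (w : ℂ) : phase ((c : ℂ) * w) = phase w := by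
  have : (c : ℂ) ≠ 0 := by exact_mod_cast hc.ne'
  simp only [phase, norm_mul, Complex.norm_real, Real.norm_of_nonneg hc.le, Complex.ofReal_mul]
  exact mul_div_mul_left _ _ this

lemma phase_mul (v w : ℂ) : phase (v * w) = phase v * phase w := by
  simp only [phase, norm_mul, Complex.ofReal_mul]
  exact mul_div_mul_comm _ _ _ _

lemma phase_eq_exp {w : ℂ} (hw : w ≠ 0) :
    phase w = Complex.exp (((Complex.log w).im : ℂ) * Complex.I) := by
  rw [Complex.log_im, phase, div_eq_iff (by exact_mod_cast norm_ne_zero_iff.2 hw), mul_comm]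
  exact (Complex.norm_mul_exp_arg_mul_I w).symm

lemma continuousAt_phase {w : ℂ} (hw : w ≠ 0) : ContinuousAt phase w :=
  continuousAt_id.div (Complex.continuous_ofReal.continuousAt.comp continuous_norm.continuousAt)
    (by exact_mod_cast norm_ne_zero_iff.2 hw)

/-! ### Calculus and linear algebra in normed spaces: phases, isotropic pairings, the equation `dg =
-i J g` -/

section
variable {V : Type*} [NormedAddCommGroup V] [NormedSpace ℝ V]

/-- Up to the factor `i`, the derivative of the phase is the imaginary part of the logarithmic
derivative. -/
lemma HasFDerivAt.phase {F : V → ℂ} {F' : V →L[ℝ] ℂ} {z : V} (hF : HasFDerivAt F F' z)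
    (hz : F z ≠ 0) {θ : V →L[ℝ] ℝ} (hθ : ∀ w, θ w = (F' w / F z).im) :
    HasFDerivAt (fun z ↦ _root_.phase (F z))
      (θ.smulRight (Complex.I * _root_.phase (F z))) z := by
  -- Dividing by `F z` moves the value at `z` to `1`, away from the branch cut of the logarithm.
  have h1 : HasFDerivAt (fun y ↦ Complex.log ((F z)⁻¹ * F y)) ((F z)⁻¹ • F') z := by
    have hs : (F z)⁻¹ * F z ∈ Complex.slitPlane := by simp [hz]
    have h := ((Complex.hasDerivAt_log hs).hasFDerivAt.restrictScalars ℝ).comp z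
      (hF.const_mul (F z)⁻¹)
    refine h.congr_fderiv ?_
    ext w
    simp [hz]
  have h2 : HasFDerivAt (fun y ↦ (((Complex.log ((F z)⁻¹ * F y)).im : ℝ) : ℂ) * Complex.I)
      (θ.smulRight Complex.I) z := by
    have := ((Complex.ofRealCLM.comp Complex.imCLM).hasFDerivAt.comp z h1).mul_const Complex.I
    convert! this using 1
    ext w
    simp only [ContinuousLinearMap.smulRight_apply, hθ, smul_apply,
      ContinuousLinearMap.comp_apply, Complex.ofRealCLM_apply, Complex.imCLM_apply, smul_eq_mul,
      Complex.real_smul, div_eq_inv_mul]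
    rw [mul_comm]
  have h3 := (h2.cexp).const_mul (_root_.phase (F z))
  have hne : ∀ᶠ y in 𝓝 z, F y ≠ 0 := hF.continuousAt.eventually_ne hz
  refine HasFDerivAt.congr_fderiv (h3.congr_of_eventuallyEq ?_) ?_
  · filter_upwards [hne] with y hy
    rw [← phase_eq_exp (by simp [hz, hy]), ← phase_mul]
    field_simp
  · ext w
    simp [hz]
    ring

/-- Two vectors of a half-dimensional isotropic factor are separated by the form: if `Φ` is
nondegenerate on `F × F` and vanishes on `0 × F`, then it pairs `F × 0` and `0 × F` perfectly. -/
lemma eq_zero_of_isotropic_pairing [FiniteDimensional ℝ V]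
    (Φ : (V × V) →L[ℝ] (V × V) →L[ℝ] ℝ) (halt : ∀ v, Φ v v = 0)
    (hnd : ∀ v, (∀ w, Φ v w = 0) → v = 0) (hiso : ∀ η η' : V, Φ (0, η) (0, η') = 0)
    {w : V} (hw : ∀ η : V, Φ (w, 0) (0, η) = 0) : w = 0 := by
  have hskew : ∀ v w, Φ v w = - Φ w v := by
    intro v w
    have := halt (v + w)
    simp only [map_add, add_apply, halt] at this
    linarith
  let T : V →ₗ[ℝ] Module.Dual ℝ V :=
    LinearMap.mk₂ ℝ (fun η v ↦ Φ (0, η) (v, 0))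
      (fun a b c ↦ by
        rw [← add_apply, ← map_add]; simp)
      (fun a b c ↦ by
        rw [← smul_apply, ← map_smul]; simp)
      (fun a b c ↦ by rw [← map_add]; simp)
      (fun a b c ↦ by rw [← map_smul]; simp)
  have hT : ∀ η v, T η v = Φ (0, η) (v, 0) := fun _ _ ↦ rfl
  -- If `T η = 0`, then `(0, η)` pairs to zero with both factors, with the second one by isotropy.
  -- Injectivity and equality of dimensions then show that every functional on `V` is a pairing with
  -- some `(0, η)`.
  have hinj : Function.Injective T := by
    rw [← LinearMap.ker_eq_bot, LinearMap.ker_eq_bot']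
    intro η hη
    have : ((0 : V), η) = 0 := by
      refine hnd _ fun v ↦ ?_
      have h1 : v = (v.1, 0) + (0, v.2) := by simp
      rw [h1, map_add, hiso, ← hT, hη]
      simp
    exact (Prod.ext_iff.1 this).2
  have hsurj : Function.Surjective T :=
    (LinearMap.injective_iff_surjective_of_finrank_eq_finrank
      (Subspace.dual_finrank_eq (K := ℝ) (V := V)).symm).1 hinj
  have : ∀ φ : Module.Dual ℝ V, φ w = 0 := by
    intro φ
    obtain ⟨η, rfl⟩ := hsurj φ
    rw [hT, hskew, hw, neg_zero]
  exact (Module.forall_dual_apply_eq_zero_iff ℝ w).1 this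

/-- If `J` vanishes on the slice through `(b₀, y₀)` and its derivative is injective in the transverse
direction, then near that point `J` vanishes only on the slice. -/
lemma eventually_fst_eq_of_eq_zero {W : Type*} [NormedAddCommGroup W] [NormedSpace ℝ W]
    [FiniteDimensional ℝ V] {J : V × V → W} {J' : V × V →L[ℝ] W} {b₀ y₀ : V}
    (hJ : HasStrictFDerivAt J J' (b₀, y₀)) (h0 : ∀ᶠ y in 𝓝 y₀, J (b₀, y) = 0)
    (hinj : ∀ w, J' (w, 0) = 0 → w = 0) :
    ∀ᶠ z in 𝓝 (b₀, y₀), J z = 0 → z.1 = b₀ := by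
  let T : V →ₗ[ℝ] W := (J'.comp (ContinuousLinearMap.inl ℝ V V)).toLinearMap
  obtain ⟨K, hK, hT⟩ := T.exists_antilipschitzWith
    (LinearMap.ker_eq_bot'.2 fun w hw ↦ hinj w (by simpa [T] using hw))
  have hKr : (0 : ℝ) < K := by exact_mod_cast hK
  have hT' : ∀ w, ‖w‖ ≤ K * ‖J' (w, 0)‖ := by
    intro w
    have := hT.le_mul_dist w 0
    simpa [T, Prod.mk_zero_zero] using this
  -- Strict differentiability compares `z` with the moving point `(b₀, z.2)` of the slice. With the
  -- constant `1 / (2 * K)` the error is at most half of what the lower bound on `J'` allows, so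
  -- `‖z.1 - b₀‖` is bounded by half of itself.
  have ho := hJ.isLittleO.def (c := 1 / (2 * K)) (by positivity)
  have htend : Tendsto (fun z : V × V ↦ (z, (b₀, z.2))) (𝓝 (b₀, y₀))
      (𝓝 ((b₀, y₀), (b₀, y₀))) := by
    apply Continuous.tendsto' (by fun_prop) _ _ rfl
  have hsnd : Tendsto (fun z : V × V ↦ z.2) (𝓝 (b₀, y₀)) (𝓝 y₀) :=
    Continuous.tendsto' continuous_snd _ _ rfl
  filter_upwards [htend.eventually ho, hsnd.eventually h0] with z hz hz0 hJz
  have h1 : z - (b₀, z.2) = (z.1 - b₀, 0) := by ext <;> simp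
  simp only [hJz, hz0, h1, sub_zero, zero_sub, norm_neg] at hz
  have h2 : ‖((z.1 - b₀, 0) : V × V)‖ = ‖z.1 - b₀‖ := by simp [Prod.norm_def]
  rw [h2] at hz
  have h3 := hT' (z.1 - b₀)
  have h4 : ‖z.1 - b₀‖ ≤ 1 / 2 * ‖z.1 - b₀‖ := by
    refine h3.trans ((mul_le_mul_of_nonneg_left hz hKr.le).trans (le_of_eq ?_))
    field_simp
  have h5 : ‖z.1 - b₀‖ = 0 := by linarith [norm_nonneg (z.1 - b₀)]
  exact sub_eq_zero.1 (norm_eq_zero.1 h5)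

/-- Pointwise limits of solutions of `dg = -i J g` solve the limit equation. -/
lemma hasFDerivAt_of_tendsto_solutions {ι : Type*} {l : Filter ι} [l.NeBot] {g : ι → V → ℂ}
    {J : ι → V → V →L[ℝ] ℝ} {G : V → ℂ} {J₀ : V → V →L[ℝ] ℝ} {s : Set V} (hs : IsOpen s)
    (hconv : Convex ℝ s) {K : ℝ}
    (hg : ∀ᶠ i in l, ∀ y ∈ s, HasFDerivAt (g i) ((J i y).smulRight (-Complex.I * g i y)) y ∧
      ‖g i y‖ ≤ 1 ∧ ‖J i y‖ ≤ K)
    (hJ : ∀ᶠ i in l, ∀ y ∈ s, ∀ y' ∈ s, ‖J i y - J i y'‖ ≤ K * ‖y - y'‖)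
    (hG : ∀ y ∈ s, Tendsto (fun i ↦ g i y) l (𝓝 (G y)))
    (hJ₀ : ∀ y ∈ s, Tendsto (fun i ↦ J i y) l (𝓝 (J₀ y))) {y : V} (hy : y ∈ s) :
    HasFDerivAt G ((J₀ y).smulRight (-Complex.I * G y)) y := by
  obtain ⟨i₀, hi₀⟩ := hg.exists
  have hK : 0 ≤ K := (norm_nonneg _).trans (hi₀ y hy).2.2
  -- The first-order Taylor remainder of `g i` has a quadratic bound that is uniform in `i`, so the
  -- bound survives pointwise limits.
  have key : ∀ y' ∈ s, ‖G y' - G y - ((J₀ y).smulRight (-Complex.I * G y)) (y' - y)‖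
      ≤ (K + K * K) * ‖y' - y‖ * ‖y' - y‖ := by
    intro y' hy'
    have hlim : Tendsto (fun i ↦ ‖g i y' - g i y
        - ((J i y).smulRight (-Complex.I * g i y)) (y' - y)‖) l
        (𝓝 ‖G y' - G y - ((J₀ y).smulRight (-Complex.I * G y)) (y' - y)‖) := by
      refine (((hG y' hy').sub (hG y hy)).sub ?_).norm
      simp only [ContinuousLinearMap.smulRight_apply]
      refine Tendsto.smul ?_ ((hG y hy).const_mul _)
      exact ((ContinuousLinearMap.apply ℝ ℝ (y' - y)).continuous.tendsto _).comp (hJ₀ y hy)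
    refine le_of_tendsto hlim ?_
    filter_upwards [hg, hJ] with i hi hi'
    have hseg : segment ℝ y y' ⊆ s := hconv.segment_subset hy hy'
    refine (convex_segment y y').norm_image_sub_le_of_norm_hasFDerivWithin_le'
      (fun η hη ↦ (hi η (hseg hη)).1.hasFDerivWithinAt) ?_ (left_mem_segment ℝ y y')
      (right_mem_segment ℝ y y')
    intro η hη
    have hηy : ‖η - y‖ ≤ ‖y' - y‖ := by
      have h := segment_subset_closedBall_left y y' hη
      rw [mem_closedBall_iff_norm, dist_comm, dist_eq_norm] at h
      exact h
    have h1 : ‖g i η - g i y‖ ≤ K * ‖y' - y‖ := by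
      have h2 : ‖g i η - g i y‖ ≤ K * ‖η - y‖ := by
        refine hconv.norm_image_sub_le_of_norm_hasFDerivWithin_le
          (fun η hη ↦ (hi η hη).1.hasFDerivWithinAt) ?_ hy (hseg hη)
        intro x hx
        rw [ContinuousLinearMap.norm_smulRight_apply, norm_mul, norm_neg, Complex.norm_I, one_mul]
        calc ‖J i x‖ * ‖g i x‖ ≤ K * 1 := by
              gcongr
              exacts [(hi x hx).2.2, (hi x hx).2.1]
          _ = K := mul_one K
      exact h2.trans (by gcongr)
    have h3 : (J i η).smulRight (-Complex.I * g i η) - (J i y).smulRight (-Complex.I * g i y)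
        = (J i η - J i y).smulRight (-Complex.I * g i η)
          + (J i y).smulRight (-Complex.I * (g i η - g i y)) := by
      ext v
      simp
      ring
    rw [h3]
    refine (norm_add_le _ _).trans ?_
    simp only [ContinuousLinearMap.norm_smulRight_apply, norm_mul, norm_neg, Complex.norm_I,
      one_mul]
    calc ‖J i η - J i y‖ * ‖g i η‖ + ‖J i y‖ * ‖g i η - g i y‖
        ≤ (K * ‖y' - y‖) * 1 + K * (K * ‖y' - y‖) := by
          gcongr
          · exact (hi' η (hseg hη) y hy).trans (by gcongr)
          · exact (hi η (hseg hη)).2.1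
          · exact (hi y hy).2.2
      _ = (K + K * K) * ‖y' - y‖ := by ring
  rw [hasFDerivAt_iff_isLittleO]
  refine Asymptotics.IsBigO.trans_isLittleO (g := fun y' ↦ ‖y' - y‖ * ‖y' - y‖) ?_ ?_
  · refine Asymptotics.IsBigO.of_bound (K + K * K) ?_
    filter_upwards [hs.mem_nhds hy] with y' hy'
    refine (key y' hy').trans (le_of_eq ?_)
    simp [mul_assoc]
  · have h1 : (fun y' ↦ ‖y' - y‖) =o[𝓝 y] (fun _ ↦ (1 : ℝ)) := by
      rw [Asymptotics.isLittleO_one_iff]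
      exact Continuous.tendsto' (by fun_prop) _ _ (by simp)
    have h2 := h1.mul_isBigO (Asymptotics.isBigO_refl (fun y' ↦ ‖y' - y‖) (𝓝 y))
    simpa using h2.norm_right

/-- Solutions of `dg = -i J g` are as smooth as `J`. -/
lemma contDiffOn_of_hasFDerivAt_smulRight {G : V → ℂ} {J : V → V →L[ℝ] ℝ} {s : Set V}
    (hs : IsOpen s) (hJ : ContDiffOn ℝ ∞ J s)
    (hG : ∀ y ∈ s, HasFDerivAt G ((J y).smulRight (-Complex.I * G y)) y) : ContDiffOn ℝ ∞ G s := by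
  rw [contDiffOn_infty]
  intro k
  -- Bootstrapping: if `G` is `C^k`, then its derivative, a product of `J` and `G`, is `C^k`.
  induction k with
  | zero =>
    rw [Nat.cast_zero, contDiffOn_zero]
    exact fun y hy ↦ (hG y hy).continuousAt.continuousWithinAt
  | succ k ih =>
    rw [Nat.cast_succ, contDiffOn_succ_iff_fderiv_of_isOpen hs]
    refine ⟨fun y hy ↦ (hG y hy).differentiableAt.differentiableWithinAt, by simp, ?_⟩
    have h1 : ContDiffOn ℝ k (fun y ↦ (J y).smulRight (-Complex.I * G y)) s := by
      exact (hJ.of_le (by exact_mod_cast le_top)).smulRight (contDiffOn_const.mul ih)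
    exact h1.congr fun y hy ↦ (hG y hy).fderiv

end

/-! ### Smooth coordinates with values in a normed space -/

section
variable {V : Type*} [NormedAddCommGroup V] [NormedSpace ℝ V]

section
variable (m : ℕ) {M : Type*} [TopologicalSpace M] [ChartedSpace (EuclideanSpace ℝ (Fin m)) M]

/-- Smooth local coordinates on `M` with values in a normed space. -/
structure IsSmoothCoord (e : OpenPartialHomeomorph M V) : Prop where
  contMDiffOn : ContMDiffOn (𝓡 m) 𝓘(ℝ, V) ∞ e e.source
  contMDiffOn_symm : ContMDiffOn 𝓘(ℝ, V) (𝓡 m) ∞ e.symm e.target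

/-- The coordinate frame at the point with coordinates `z`: the differential of the
parametrization. -/
noncomputable def coordFrame (e : OpenPartialHomeomorph M V) (z : V) :
    V →L[ℝ] TSpace m (e.symm z) :=
  mfderiv 𝓘(ℝ, V) (𝓡 m) e.symm z

lemma isSmoothCoord_chartAt [IsManifold (𝓡 m) ∞ M] (x : M) :
    IsSmoothCoord m (chartAt (EuclideanSpace ℝ (Fin m)) x) :=
  ⟨contMDiffOn_chart, contMDiffOn_chart_symm⟩

end

variable {m : ℕ} {M : Type*} [TopologicalSpace M] [ChartedSpace (EuclideanSpace ℝ (Fin m)) M]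

namespace IsSmoothCoord

variable {e : OpenPartialHomeomorph M V}

lemma contMDiffAt (he : IsSmoothCoord m e) {x : M} (hx : x ∈ e.source) :
    ContMDiffAt (𝓡 m) 𝓘(ℝ, V) ∞ e x :=
  he.contMDiffOn.contMDiffAt (e.open_source.mem_nhds hx)

lemma contMDiffAt_symm (he : IsSmoothCoord m e) {z : V} (hz : z ∈ e.target) :
    ContMDiffAt 𝓘(ℝ, V) (𝓡 m) ∞ e.symm z :=
  he.contMDiffOn_symm.contMDiffAt (e.open_target.mem_nhds hz)

lemma mdifferentiableAt (he : IsSmoothCoord m e) {x : M} (hx : x ∈ e.source) :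
    MDifferentiableAt (𝓡 m) 𝓘(ℝ, V) e x :=
  (he.contMDiffAt hx).mdifferentiableAt (by simp)

lemma mdifferentiableAt_symm (he : IsSmoothCoord m e) {z : V} (hz : z ∈ e.target) :
    MDifferentiableAt 𝓘(ℝ, V) (𝓡 m) e.symm z :=
  (he.contMDiffAt_symm hz).mdifferentiableAt (by simp)

lemma coordFrame_mfderiv (he : IsSmoothCoord m e) {x : M} (hx : x ∈ e.source) (v : TSpace m x) :
    mfderiv 𝓘(ℝ, V) (𝓡 m) e.symm (e x) (mfderiv (𝓡 m) 𝓘(ℝ, V) e x v) = v := by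
  have h1 := mfderiv_comp x (he.mdifferentiableAt_symm (e.map_source hx)) (he.mdifferentiableAt hx)
  have h2 : e.symm ∘ e =ᶠ[𝓝 x] id := by
    filter_upwards [e.open_source.mem_nhds hx] with y hy using e.left_inv hy
  rw [h2.mfderiv_eq, mfderiv_id] at h1
  exact (congrArg (fun T ↦ T v) h1).symm

lemma mfderiv_coordFrame (he : IsSmoothCoord m e) {z : V} (hz : z ∈ e.target) (w : V) :
    mfderiv (𝓡 m) 𝓘(ℝ, V) e (e.symm z) (coordFrame m e z w) = w := by
  have h1 := mfderiv_comp z (he.mdifferentiableAt (e.map_target hz)) (he.mdifferentiableAt_symm hz)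
  have h2 : e ∘ e.symm =ᶠ[𝓝 z] id := by
    filter_upwards [e.open_target.mem_nhds hz] with y hy using e.right_inv hy
  rw [h2.mfderiv_eq, mfderiv_id] at h1
  exact (congrArg (fun T ↦ T w) h1).symm

lemma coordFrame_injective (he : IsSmoothCoord m e) {z : V} (hz : z ∈ e.target) :
    Function.Injective (coordFrame m e z) := by
  intro w w' h
  rw [← he.mfderiv_coordFrame hz w, h, he.mfderiv_coordFrame hz w']

lemma coordFrame_surjective (he : IsSmoothCoord m e) {z : V} (hz : z ∈ e.target) :
    Function.Surjective (coordFrame m e z) := by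
  intro v
  have h := he.coordFrame_mfderiv (e.map_target hz) v
  rw [e.right_inv hz] at h
  exact ⟨_, h⟩

/-- The derivative of a function in coordinates. -/
lemma hasFDerivAt_comp_symm (he : IsSmoothCoord m e) {W : Type*} [NormedAddCommGroup W]
    [NormedSpace ℝ W] {f : M → W} {z : V} (hz : z ∈ e.target)
    (hf : MDifferentiableAt (𝓡 m) 𝓘(ℝ, W) f (e.symm z)) :
    HasFDerivAt (fun z ↦ f (e.symm z)) ((mvfderiv (𝓡 m) f (e.symm z)).comp (coordFrame m e z)) z :=
  (hf.hasMFDerivAt.comp z (he.mdifferentiableAt_symm hz).hasMFDerivAt).hasFDerivAt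

lemma contDiffOn_comp_symm (he : IsSmoothCoord m e) {W : Type*} [NormedAddCommGroup W]
    [NormedSpace ℝ W] {f : M → W} {s : Set M} (hf : ContMDiffOn (𝓡 m) 𝓘(ℝ, W) ∞ f s) :
    ContDiffOn ℝ ∞ (fun z ↦ f (e.symm z)) (e.target ∩ e.symm ⁻¹' s) :=
  (hf.comp (he.contMDiffOn_symm.mono inter_subset_left) fun _ hz ↦ hz.2).contDiffOn

/-- Composition of smooth coordinates with a local diffeomorphism of normed spaces. -/
lemma trans (he : IsSmoothCoord m e) {W : Type*} [NormedAddCommGroup W]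
    [NormedSpace ℝ W] {h : OpenPartialHomeomorph V W} (h1 : ContDiffOn ℝ ∞ h h.source)
    (h2 : ContDiffOn ℝ ∞ h.symm h.target) : IsSmoothCoord m (e.trans h) := by
  constructor
  · rw [OpenPartialHomeomorph.coe_trans, e.trans_source]
    exact h1.contMDiffOn.comp (he.contMDiffOn.mono inter_subset_left) fun x hx ↦ hx.2
  · rw [OpenPartialHomeomorph.coe_trans_symm, e.trans_target]
    exact he.contMDiffOn_symm.comp (h2.contMDiffOn.mono inter_subset_left) fun x hx ↦ hx.2

end IsSmoothCoord

/-- The inverse function theorem with smoothness of the local inverse. -/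
lemma exists_openPartialHomeomorph_of_contDiffOn {E : Type*} [NormedAddCommGroup E]
    [NormedSpace ℝ E] [CompleteSpace E] {g : E → V} {U : Set E} (hU : IsOpen U)
    (hg : ContDiffOn ℝ ∞ g U) {z : E} (hz : z ∈ U) {g' : E ≃L[ℝ] V}
    (hg' : HasFDerivAt g (g' : E →L[ℝ] V) z) :
    ∃ h : OpenPartialHomeomorph E V, z ∈ h.source ∧ h.source ⊆ U ∧ (∀ y ∈ h.source, h y = g y) ∧
      ContDiffOn ℝ ∞ h h.source ∧ ContDiffOn ℝ ∞ h.symm h.target := by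
  have hgz : ContDiffAt ℝ ∞ g z := hg.contDiffAt (hU.mem_nhds hz)
  let h₀ := hgz.toOpenPartialHomeomorph g hg' (by simp)
  have hcont : ContinuousOn (fderiv ℝ g) U :=
    hg.continuousOn_fderiv_of_isOpen hU (by simp)
  -- The local inverse is smooth wherever the derivative is invertible. Restricting to this open set
  -- makes it smooth on its whole domain.
  have hinv : IsOpen (U ∩ fderiv ℝ g ⁻¹' (range ((↑) : (E ≃L[ℝ] V) → E →L[ℝ] V))) :=
    hcont.isOpen_inter_preimage hU (ContinuousLinearEquiv.isOpen (𝕜 := ℝ) (E := E) (F := V))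
  set T := U ∩ fderiv ℝ g ⁻¹' (range ((↑) : (E ≃L[ℝ] V) → E →L[ℝ] V)) with hT
  let h := h₀.restrOpen T hinv
  have hsrc : h.source = h₀.source ∩ T := h₀.restrOpen_source T hinv
  have hh : ∀ y, h y = g y := fun _ ↦ rfl
  refine ⟨h, ?_, ?_, fun y _ ↦ hh y, ?_, ?_⟩
  · rw [hsrc]
    exact ⟨hgz.mem_toOpenPartialHomeomorph_source hg' (by simp), hz,
      by rw [mem_preimage, hg'.fderiv]; exact ⟨g', rfl⟩⟩
  · rw [hsrc]
    exact fun y hy ↦ hy.2.1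
  · refine (hg.mono ?_).congr fun y _ ↦ hh y
    rw [hsrc]
    exact fun y hy ↦ hy.2.1
  · intro w hw
    have hy : h.symm w ∈ h.source := h.map_target hw
    rw [hsrc] at hy
    obtain ⟨A, hA⟩ := hy.2.2
    have hgy : ContDiffAt ℝ ∞ g (h.symm w) := hg.contDiffAt (hU.mem_nhds hy.2.1)
    have hd : HasFDerivAt h (A : E →L[ℝ] V) (h.symm w) := by
      rw [hA]
      exact (hgy.differentiableAt (by simp)).hasFDerivAt
    exact (h.contDiffAt_symm hw hd hgy).contDiffWithinAt

/-- The inverse function theorem on a manifold: functions whose differentials form a basis of the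
cotangent space at `x` are smooth coordinates near `x`. -/
lemma exists_isSmoothCoord [IsManifold (𝓡 m) ∞ M] [FiniteDimensional ℝ V]
    (hV : Module.finrank ℝ V = m) {g : M → V} {U : Set M}
    (hU : IsOpen U) (hg : ContMDiffOn (𝓡 m) 𝓘(ℝ, V) ∞ g U) {x : M} (hx : x ∈ U)
    (hinj : ∀ v : TSpace m x, mvfderiv (𝓡 m) g x v = 0 → v = 0) :
    ∃ e : OpenPartialHomeomorph M V, IsSmoothCoord m e ∧ x ∈ e.source ∧ e.source ⊆ U ∧
      ∀ y ∈ e.source, e y = g y := by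
  have hc := isSmoothCoord_chartAt m x
  set c := chartAt (EuclideanSpace ℝ (Fin m)) x with hcdef
  have hxc : x ∈ c.source := mem_chart_source _ x
  have hz : c x ∈ c.target := c.map_source hxc
  have hcx : c.symm (c x) = x := c.left_inv hxc
  have hgc := hc.contDiffOn_comp_symm hg
  have hopen : IsOpen (c.target ∩ c.symm ⁻¹' U) := c.isOpen_inter_preimage_symm hU
  have hzU : c x ∈ c.target ∩ c.symm ⁻¹' U := ⟨hz, by rw [mem_preimage, hcx]; exact hx⟩
  have hgd : MDifferentiableAt (𝓡 m) 𝓘(ℝ, V) g (c.symm (c x)) := by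
    rw [hcx]
    exact (hg.contMDiffAt (hU.mem_nhds hx)).mdifferentiableAt (by simp)
  have hd := hc.hasFDerivAt_comp_symm hz hgd
  have hker : LinearMap.ker ((mvfderiv (𝓡 m) g (c.symm (c x))).comp
      (coordFrame m c (c x))).toLinearMap = ⊥ := by
    rw [LinearMap.ker_eq_bot']
    intro w hw
    have h0 : coordFrame m c (c x) w = 0 := by
      -- The points `c.symm (c x)` and `x` agree only propositionally, so the hypothesis is
      -- transported through a variable base point.
      have : ∀ y, y = x → ∀ v : TSpace m y, mvfderiv (𝓡 m) g y v = 0 → v = 0 := by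
        rintro y rfl
        exact hinj
      exact this _ hcx _ hw
    exact hc.coordFrame_injective hz (h0.trans (map_zero _).symm)
  let A₀ : EuclideanSpace ℝ (Fin m) ≃ₗ[ℝ] V :=
    LinearEquiv.ofInjectiveOfFinrankEq _ (LinearMap.ker_eq_bot.1 hker) (by simp [hV])
  let A : EuclideanSpace ℝ (Fin m) ≃L[ℝ] V := A₀.toContinuousLinearEquiv
  have hA : HasFDerivAt (fun z ↦ g (c.symm z)) (A : EuclideanSpace ℝ (Fin m) →L[ℝ] V) (c x) := by
    refine hd.congr_fderiv ?_
    ext w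
    rfl
  obtain ⟨h, h1, h2, h3, h4, h5⟩ := exists_openPartialHomeomorph_of_contDiffOn hopen hgc hzU hA
  refine ⟨c.trans h, hc.trans h4 h5, ?_, ?_, ?_⟩
  · rw [c.trans_source]
    exact ⟨hxc, h1⟩
  · rw [c.trans_source]
    intro y hy
    have := (h2 hy.2).2
    rwa [mem_preimage, c.left_inv hy.1] at this
  · intro y hy
    rw [c.trans_source] at hy
    rw [OpenPartialHomeomorph.coe_trans, Function.comp_apply, h3 _ hy.2, c.left_inv hy.1]

end

/-! ### Coordinate vector fields -/

section
variable {V : Type*} [NormedAddCommGroup V] [NormedSpace ℝ V]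

/-- A constant vector field on a normed space. -/
def constField (w : V) (z : V) : TangentSpace 𝓘(ℝ, V) z := w

lemma contMDiff_constField (w : V) : ContMDiff 𝓘(ℝ, V) 𝓘(ℝ, V).tangent ∞
    (fun z : V ↦ (⟨z, constField w z⟩ : TangentBundle 𝓘(ℝ, V) V)) := by
  intro z
  rw [contMDiffAt_vectorSpace_iff_contDiffAt]
  exact contDiffAt_const

lemma mlieBracket_constField (v w z : V) :
    VectorField.mlieBracket 𝓘(ℝ, V) (constField v) (constField w) z = 0 := by
  rw [← VectorField.mlieBracketWithin_univ, VectorField.mlieBracketWithin_eq_lieBracketWithin]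
  have h : VectorField.lieBracketWithin ℝ (fun _ : V ↦ v) (fun _ : V ↦ w) univ z = 0 := by
    simp [VectorField.lieBracketWithin]
  exact h

variable {m : ℕ} {M : Type*} [TopologicalSpace M] [ChartedSpace (EuclideanSpace ℝ (Fin m)) M]
  {e : OpenPartialHomeomorph M V}

lemma mvfderiv_clm_comp {W : Type*} [NormedAddCommGroup W] [NormedSpace ℝ W] (T : V →L[ℝ] W)
    {f : M → V} {x : M} (hf : MDifferentiableAt (𝓡 m) 𝓘(ℝ, V) f x) (v : TSpace m x) :
    mvfderiv (𝓡 m) (fun y ↦ T (f y)) x v = T (mvfderiv (𝓡 m) f x v) :=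
  congrArg (fun A ↦ A v) (T.hasMFDerivAt.comp x hf.hasMFDerivAt).mfderiv

lemma IsSmoothCoord.mfderiv_mfderiv_symm (he : IsSmoothCoord m e) {x : M} (hx : x ∈ e.source)
    (w : V) : mfderiv (𝓡 m) 𝓘(ℝ, V) e x (mfderiv 𝓘(ℝ, V) (𝓡 m) e.symm (e x) w) = w := by
  have := he.mfderiv_coordFrame (e.map_source hx) w
  have key : ∀ y, y = x → mfderiv (𝓡 m) 𝓘(ℝ, V) e y (mfderiv 𝓘(ℝ, V) (𝓡 m) e.symm (e x) w) = w →
    mfderiv (𝓡 m) 𝓘(ℝ, V) e x (mfderiv 𝓘(ℝ, V) (𝓡 m) e.symm (e x) w) = w := by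
    rintro y rfl h
    exact h
  exact key _ (e.left_inv hx) this

/-- The coordinate fields are pullbacks of constant fields. In this form the naturality of
smoothness and of the Lie bracket under pullback applies to them. -/
lemma IsSmoothCoord.mpullback_const (he : IsSmoothCoord m e) {x : M} (hx : x ∈ e.source) (w : V) :
    (mfderiv (𝓡 m) 𝓘(ℝ, V) e x).IsInvertible ∧
    VectorField.mpullback (𝓡 m) 𝓘(ℝ, V) e (constField w) x
      = mfderiv 𝓘(ℝ, V) (𝓡 m) e.symm (e x) w := by
  let A : TSpace m x ≃L[ℝ] V := ContinuousLinearEquiv.equivOfInverse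
    (mfderiv (𝓡 m) 𝓘(ℝ, V) e x) (mfderiv 𝓘(ℝ, V) (𝓡 m) e.symm (e x))
    (fun v ↦ he.coordFrame_mfderiv hx v) (fun w ↦ he.mfderiv_mfderiv_symm hx w)
  have hA : (A : TSpace m x →L[ℝ] V) = mfderiv (𝓡 m) 𝓘(ℝ, V) e x := rfl
  refine ⟨⟨A, hA⟩, ?_⟩
  rw [VectorField.mpullback_apply]
  have h2 : (A : TSpace m x →L[ℝ] V).inverse w = A.symm w := by
    rw [ContinuousLinearMap.inverse_equiv]
    rfl
  exact h2

/-- Pullback commutes with the bracket, and constant fields commute. This removes the bracket term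
from the curvature identity. -/
lemma IsSmoothCoord.mlieBracket_mpullback_const [IsManifold (𝓡 m) ∞ M] [CompleteSpace V]
    (he : IsSmoothCoord m e) {x : M}
    (hx : x ∈ e.source) (v w : V) :
    VectorField.mlieBracket (𝓡 m) (VectorField.mpullback (𝓡 m) 𝓘(ℝ, V) e (constField v))
      (VectorField.mpullback (𝓡 m) 𝓘(ℝ, V) e (constField w)) x = 0 := by
  have hc : ∀ w : V, MDifferentiableAt 𝓘(ℝ, V) 𝓘(ℝ, V).tangent
      (fun z : V ↦ (⟨z, constField w z⟩ : TangentBundle 𝓘(ℝ, V) V)) (e x) :=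
    fun w ↦ (contMDiff_constField w (e x)).mdifferentiableAt (by simp)
  have : IsManifold (𝓡 m) (minSmoothness ℝ 3) M :=
    IsManifold.of_le (n := ∞) (by simpa using WithTop.coe_le_coe.2 (le_top : (3 : ℕ∞) ≤ ⊤))
  rw [← VectorField.mpullback_mlieBracket (hc v) (hc w) (he.contMDiffAt hx)
    (by simpa using WithTop.coe_le_coe.2 (le_top : (2 : ℕ∞) ≤ ⊤)), VectorField.mpullback_apply,
    mlieBracket_constField, map_zero]

end

/-! ### Globalizing local sections and vector fields by bump functions -/

section
variable {m : ℕ} {M : Type*} [TopologicalSpace M] [T2Space M]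
  [ChartedSpace (EuclideanSpace ℝ (Fin m)) M] [IsManifold (𝓡 m) ∞ M]

/-- A smooth local section of a vector bundle agrees near a given point with a global one. -/
lemma exists_contMDiff_section_eventuallyEq {F : Type*} [NormedAddCommGroup F] [NormedSpace ℝ F]
    {E : M → Type*} [TopologicalSpace (TotalSpace F E)] [∀ x, TopologicalSpace (E x)]
    [∀ x, AddCommGroup (E x)] [∀ x, Module ℝ (E x)] [FiberBundle F E] [VectorBundle ℝ F E]
    {s : Π x : M, E x} {U : Set M} (hU : IsOpen U)
    (hs : ContMDiffOn (𝓡 m) ((𝓡 m).prod 𝓘(ℝ, F)) ∞ (fun x ↦ TotalSpace.mk' F x (s x)) U)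
    {x : M} (hx : x ∈ U) :
    ∃ s' : Π x : M, E x,
      ContMDiff (𝓡 m) ((𝓡 m).prod 𝓘(ℝ, F)) ∞ (fun x ↦ TotalSpace.mk' F x (s' x)) ∧
      ∀ᶠ y in 𝓝 x, s' y = s y := by
  obtain ⟨f, -, hf⟩ := (SmoothBumpFunction.nhds_basis_tsupport (I := 𝓡 m) x).mem_iff.1
    (hU.mem_nhds hx)
  refine ⟨(f : M → ℝ) • s, ContMDiffOn.smul_section_of_tsupport f.contMDiff.contMDiffOn hU hf hs, ?_⟩
  filter_upwards [f.eventuallyEq_one] with y hy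
  simp [hy]

variable {V : Type*} [NormedAddCommGroup V] [NormedSpace ℝ V]
  {e : OpenPartialHomeomorph M V}

/-- The coordinate vector fields of smooth coordinates, extended to global vector fields. -/
lemma IsSmoothCoord.exists_isSmoothVectorField [CompleteSpace V] (he : IsSmoothCoord m e) {x : M}
    (hx : x ∈ e.source) (w : V) :
    ∃ X : Π x : M, TSpace m x, IsSmoothVectorField X ∧
      ∀ᶠ y in 𝓝 x, X y = VectorField.mpullback (𝓡 m) 𝓘(ℝ, V) e (constField w) y := by
  refine exists_contMDiff_section_eventuallyEq (E := TSpace m (X := M)) e.open_source ?_ hx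
  intro y hy
  have hc := contMDiff_constField w (e y)
  exact (ContMDiffAt.mpullback_vectorField_preimage hc (he.contMDiffAt hy)
    (he.mpullback_const hy w).1 (by simp)).contMDiffWithinAt

end

/-! ### The connection form of the unit section -/

section
variable {m : ℕ} {M : Type*} [TopologicalSpace M]
  [ChartedSpace (EuclideanSpace ℝ (Fin m)) M]
  {L : M → Type*} [TopologicalSpace (TotalSpace ℂ L)]
  [∀ x, NormedAddCommGroup (L x)] [∀ x, InnerProductSpace ℂ (L x)]
  [FiberBundle ℂ L]

/-- The connection form of the unit section `σ / |σ|`, up to the factor `i`. -/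
noncomputable def phaseForm (nabla : CovariantDerivative (𝓡 m) ℂ L) (σ : Π x : M, L x) (x : M) :
    TSpace m x →L[ℝ] ℝ :=
  (‖σ x‖ ^ 2)⁻¹ • Complex.imCLM.comp (((innerSL ℂ (σ x)).restrictScalars ℝ).comp (nabla σ x))

lemma phaseForm_apply (nabla : CovariantDerivative (𝓡 m) ℂ L) (σ : Π x : M, L x) (x : M)
    (v : TSpace m x) : phaseForm nabla σ x v = (inner ℂ (σ x) (nabla σ x v)).im / ‖σ x‖ ^ 2 := by
  simp [phaseForm, div_eq_inv_mul]

/-- The phase form in coordinates. -/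
noncomputable def coordPhaseForm {V : Type*} [NormedAddCommGroup V] [NormedSpace ℝ V]
    (nabla : CovariantDerivative (𝓡 m) ℂ L) (σ : Π x : M, L x)
    (e : OpenPartialHomeomorph M V) (z : V) : V →L[ℝ] ℝ :=
  (phaseForm nabla σ (e.symm z)).comp (coordFrame m e z)

lemma IsSmoothSection.mdifferentiableAt {σ : Π x : M, L x} (hσ : IsSmoothSection (m := m) σ)
    (x : M) : MDifferentiableAt (𝓡 m) ((𝓡 m).prod 𝓘(ℝ, ℂ))
      (fun x ↦ TotalSpace.mk' ℂ (E := L) x (σ x)) x :=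
  (hσ x).mdifferentiableAt (by simp)

variable [VectorBundle ℂ ℂ L]

/-- The fibres are complex lines, so every vector is a multiple of `u`, and pairing with `u`
determines the coefficient. -/
lemma eq_smul_of_ne_zero {x : M} {u : L x} (hu : u ≠ 0) (w : L x) :
    w = (inner ℂ u w / (‖u‖ : ℂ) ^ 2) • u := by
  have h1 : Module.finrank ℂ (L x) = 1 := by
    rw [((trivializationAt ℂ L x).continuousLinearEquivAt ℂ x
      (mem_baseSet_trivializationAt ℂ L x)).toLinearEquiv.finrank_eq, Module.finrank_self]
  obtain ⟨c, rfl⟩ := (finrank_eq_one_iff_of_nonzero' u hu).1 h1 w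
  have hn : ((‖u‖ : ℂ)) ^ 2 ≠ 0 := pow_ne_zero 2 (by exact_mod_cast norm_ne_zero_iff.2 hu)
  rw [inner_smul_right, inner_self_eq_norm_sq_to_K]
  congr 1
  exact (mul_div_cancel_right₀ c hn).symm

lemma inner_ne_zero_of_ne_zero {x : M} {u w : L x} (hu : u ≠ 0) (hw : w ≠ 0) :
    inner ℂ u w ≠ 0 := by
  intro h
  apply hw
  rw [eq_smul_of_ne_zero hu w, h]
  simp

/-- Cocycle rule for inner products in a complex line. Up to a positive factor, relative phases
multiply, which permits a change of the reference section. -/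
lemma inner_mul_inner {x : M} (u v w : L x) :
    inner ℂ u v * inner ℂ v w = (‖v‖ : ℂ) ^ 2 * inner ℂ u w := by
  by_cases hv : v = 0
  · simp [hv]
  · have hn : ((‖v‖ : ℂ)) ^ 2 ≠ 0 := pow_ne_zero 2 (by exact_mod_cast norm_ne_zero_iff.2 hv)
    conv_rhs => rw [eq_smul_of_ne_zero hv w, inner_smul_right]
    rw [← mul_assoc, mul_div_cancel₀ _ hn, mul_comm]

/-- Complex multiples of smooth sections by smooth functions are smooth. -/
lemma IsSmoothSection.contMDiffOn_smul {σ : Π x : M, L x} (hσ : IsSmoothSection (m := m) σ)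
    {g : M → ℂ} {s : Set M} (hg : ContMDiffOn (𝓡 m) 𝓘(ℝ, ℂ) ∞ g s) :
    ContMDiffOn (𝓡 m) ((𝓡 m).prod 𝓘(ℝ, ℂ)) ∞
      (fun x ↦ TotalSpace.mk' ℂ (E := L) x (g x • σ x)) s := by
  intro x hx
  have h1 := (Bundle.contMDiffWithinAt_section (n := ∞) (s := σ) (a := s) (x₀ := x)
    (IB := 𝓡 m) (F := ℂ)).1 (hσ x).contMDiffWithinAt
  rw [Bundle.contMDiffWithinAt_section (s := fun x ↦ g x • σ x)]
  refine ((contDiff_mul (𝕜 := ℝ) (𝔸 := ℂ) (n := ∞)).contMDiff.contMDiffAt.comp_contMDiffWithinAt x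
    ((hg x hx).prodMk_space h1)).congr_of_eventuallyEq ?_ ?_
  · filter_upwards [mem_nhdsWithin_of_mem_nhds ((trivializationAt ℂ L x).open_baseSet.mem_nhds
      (mem_baseSet_trivializationAt ℂ L x))] with y hy
    exact ((trivializationAt ℂ L x).linear ℂ hy).map_smul (g y) (σ y)
  · exact ((trivializationAt ℂ L x).linear ℂ (mem_baseSet_trivializationAt ℂ L x)).map_smul
      (g x) (σ x)

lemma IsSmoothSection.smul {σ : Π x : M, L x} (hσ : IsSmoothSection (m := m) σ)
    {g : M → ℂ} (hg : ContMDiff (𝓡 m) 𝓘(ℝ, ℂ) ∞ g) :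
    IsSmoothSection (m := m) (fun x ↦ g x • σ x) :=
  contMDiffOn_univ.1 (hσ.contMDiffOn_smul hg.contMDiffOn)

/-- Changing the phase of a section changes its phase form by an exact form. -/
lemma phaseForm_add_smul_I [VectorBundle ℝ ℂ L] (nabla : CovariantDerivative (𝓡 m) ℂ L)
    {σ : Π x : M, L x} (hσ : IsSmoothSection (m := m) σ)
    {h : M → ℝ}
    {x : M} (hh : MDifferentiableAt (𝓡 m) 𝓘(ℝ, ℝ) h x) (hx : h x = 0) (hσx : σ x ≠ 0) :
    phaseForm nabla (fun x ↦ σ x + h x • (Complex.I • σ x)) x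
      = phaseForm nabla σ x + mvfderiv (𝓡 m) h x := by
  have hIσ : IsSmoothSection (m := m) (fun x ↦ Complex.I • σ x) := hσ.smul contMDiff_const
  have h1 := nabla.isCovariantDerivativeOnUniv.leibniz (hIσ.mdifferentiableAt x) hh
  have h2 := nabla.isCovariantDerivativeOnUniv.add (hσ.mdifferentiableAt x)
    (hh.smul_section (hIσ.mdifferentiableAt x))
  -- At a zero of `h` the Leibniz rule leaves only the term `dh ⊗ iσ`, and the section itself keeps
  -- its value.
  have h3 : nabla (fun x ↦ σ x + h x • (Complex.I • σ x)) x
      = nabla σ x + (mvfderiv (𝓡 m) h x).smulRight (Complex.I • σ x) := by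
    refine h2.trans ?_
    rw [h1, hx, zero_smul, zero_add]
  have hn : ‖σ x‖ ^ 2 ≠ 0 := pow_ne_zero 2 (norm_ne_zero_iff.2 hσx)
  ext v
  rw [phaseForm_apply, h3, add_apply, add_apply, phaseForm_apply]
  simp only [hx, zero_smul, add_zero, ContinuousLinearMap.smulRight_apply]
  have h4 : (inner ℂ (σ x) (mvfderiv (𝓡 m) h x v • (Complex.I • σ x))).im
      = mvfderiv (𝓡 m) h x v * ‖σ x‖ ^ 2 := by
    rw [← Complex.coe_smul, inner_smul_right, inner_smul_right,
      inner_self_eq_norm_sq_to_K]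
    change ((mvfderiv (𝓡 m) h x v : ℂ) * (Complex.I * ((‖σ x‖ : ℝ) : ℂ) ^ 2)).im = _
    rw [← Complex.ofReal_pow]
    simp [-Complex.ofReal_pow]
  rw [inner_add_right, Complex.add_im, h4, add_div, mul_div_cancel_right₀ _ hn]

variable [IsManifold (𝓡 m) ∞ M] [VectorBundle ℝ ℂ L] [ContMDiffVectorBundle ∞ ℂ L (𝓡 m)]
  {Ω : Π x : M, TSpace m x →L[ℝ] TSpace m x →L[ℝ] ℝ}
  {nabla : CovariantDerivative (𝓡 m) ℂ L}

lemma IsPrequantization.isSmoothSection_nabla (h : IsPrequantization Ω nabla)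
    {σ : Π x : M, L x} (hσ : IsSmoothSection (m := m) σ) {X : Π x : M, TSpace m x}
    (hX : IsSmoothVectorField X) : IsSmoothSection (m := m) (fun x ↦ nabla σ x (X x)) := by
  have h1 := h.smooth.contMDiff.contMDiff (σ := σ) (hσ.contMDiffOn)
  exact ContMDiff.clm_bundle_apply (contMDiffOn_univ.1 h1) hX

lemma IsPrequantization.mdifferentiableAt_inner (h : IsPrequantization Ω nabla)
    {σ τ : Π x : M, L x} (hσ : IsSmoothSection (m := m) σ) (hτ : IsSmoothSection (m := m) τ)
    (x : M) : MDifferentiableAt (𝓡 m) 𝓘(ℝ, ℂ) (fun x ↦ (inner ℂ (σ x) (τ x) : ℂ)) x :=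
  (h.metric_smooth σ τ hσ hτ x).mdifferentiableAt (by simp)

lemma IsPrequantization.contMDiff_norm_sq (h : IsPrequantization Ω nabla)
    {σ : Π x : M, L x} (hσ : IsSmoothSection (m := m) σ) :
    ContMDiff (𝓡 m) 𝓘(ℝ, ℝ) ∞ (fun x ↦ ‖σ x‖ ^ 2) := by
  have h1 := Complex.reCLM.contMDiff.comp (h.metric_smooth σ σ hσ hσ)
  convert h1 using 2 with x
  rw [Function.comp_apply, Complex.reCLM_apply]
  exact (inner_self_eq_norm_sq (𝕜 := ℂ) (σ x)).symm

/-- The phase of the ratio of two sections: the imaginary part of its logarithmic derivative is the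
difference of the phase forms. -/
lemma IsPrequantization.im_mvfderiv_inner_div (h : IsPrequantization Ω nabla)
    {σ τ : Π x : M, L x} (hσ : IsSmoothSection (m := m) σ) (hτ : IsSmoothSection (m := m) τ)
    {x : M} (hσx : σ x ≠ 0) (hτx : τ x ≠ 0) (v : TSpace m x) :
    (mvfderiv (𝓡 m) (fun y ↦ (inner ℂ (σ y) (τ y) : ℂ)) x v / inner ℂ (σ x) (τ x)).im
      = phaseForm nabla τ x v - phaseForm nabla σ x v := by
  have hi := inner_ne_zero_of_ne_zero hσx hτx
  have hn1 : ((‖σ x‖ : ℂ)) ^ 2 ≠ 0 := pow_ne_zero 2 (by exact_mod_cast norm_ne_zero_iff.2 hσx)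
  have hn2 : ((‖τ x‖ : ℂ)) ^ 2 ≠ 0 := pow_ne_zero 2 (by exact_mod_cast norm_ne_zero_iff.2 hτx)
  rw [h.metric_parallel σ τ hσ hτ, add_div, phaseForm_apply, phaseForm_apply]
  -- Each term of the metric compatibility rule, divided by `⟨σ, τ⟩`, involves only one of the two
  -- sections, by `inner_mul_inner`.
  have h1 : inner ℂ (nabla σ x v) (τ x) / inner ℂ (σ x) (τ x)
      = (starRingEnd ℂ) (inner ℂ (σ x) (nabla σ x v)) / (‖σ x‖ : ℂ) ^ 2 := by
    rw [div_eq_div_iff hi hn1, inner_conj_symm, inner_mul_inner, mul_comm]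
  have h2 : inner ℂ (σ x) (nabla τ x v) / inner ℂ (σ x) (τ x)
      = inner ℂ (τ x) (nabla τ x v) / (‖τ x‖ : ℂ) ^ 2 := by
    rw [div_eq_div_iff hi hn2, mul_comm (inner ℂ (τ x) (nabla τ x v)), inner_mul_inner, mul_comm]
  rw [h1, h2, ← Complex.ofReal_pow, ← Complex.ofReal_pow, Complex.add_im, Complex.div_ofReal_im,
    Complex.div_ofReal_im, Complex.conj_im]
  ring

end

/-! ### Smoothness and exterior derivative of the connection form -/

section
variable {m : ℕ} {M : Type*} [TopologicalSpace M]
  [ChartedSpace (EuclideanSpace ℝ (Fin m)) M]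
  {L : M → Type*} [TopologicalSpace (TotalSpace ℂ L)]
  [∀ x, NormedAddCommGroup (L x)] [∀ x, InnerProductSpace ℂ (L x)] [FiberBundle ℂ L]
  {nabla : CovariantDerivative (𝓡 m) ℂ L}

/-- This expresses a coefficient of the form through a globally defined field `X`, since the axioms
of the connection are stated for global fields and sections. -/
lemma coordPhaseForm_eventuallyEq {V : Type*} [NormedAddCommGroup V] [NormedSpace ℝ V]
    {e : OpenPartialHomeomorph M V} {σ : Π x : M, L x} {X : Π x : M, TSpace m x} {z w : V}
    (hX : ∀ᶠ y in 𝓝 z, X (e.symm y) = coordFrame m e y w) :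
    (fun y ↦ coordPhaseForm nabla σ e y w) =ᶠ[𝓝 z] fun y ↦
      (inner ℂ (σ (e.symm y)) (nabla σ (e.symm y) (X (e.symm y))) : ℂ).im / ‖σ (e.symm y)‖ ^ 2 := by
  filter_upwards [hX] with y hy
  rw [hy, ← phaseForm_apply]
  rfl

end

section
variable {m : ℕ} {M : Type*} [TopologicalSpace M] [T2Space M]
  [ChartedSpace (EuclideanSpace ℝ (Fin m)) M] [IsManifold (𝓡 m) ∞ M]
  {V : Type*} [NormedAddCommGroup V] [NormedSpace ℝ V] [FiniteDimensional ℝ V]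
  {e : OpenPartialHomeomorph M V}

lemma IsSmoothCoord.exists_isSmoothVectorField_eq_coordFrame (he : IsSmoothCoord m e) {z : V}
    (hz : z ∈ e.target) (w : V) :
    ∃ X : Π x : M, TSpace m x, IsSmoothVectorField X ∧
      (∀ᶠ y in 𝓝 (e.symm z), X y = VectorField.mpullback (𝓡 m) 𝓘(ℝ, V) e (constField w) y) ∧
      ∀ᶠ y in 𝓝 z, X (e.symm y) = coordFrame m e y w := by
  have := FiniteDimensional.complete ℝ V
  obtain ⟨X, hX, hXe⟩ := he.exists_isSmoothVectorField (e.map_target hz) w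
  refine ⟨X, hX, hXe, ?_⟩
  filter_upwards [(e.continuousAt_symm hz).eventually hXe, e.open_target.mem_nhds hz] with y hy hy'
  rw [hy, (he.mpullback_const (e.map_target hy') w).2]
  have key : ∀ y', y' = y → (mfderiv 𝓘(ℝ, V) (𝓡 m) e.symm y' w : EuclideanSpace ℝ (Fin m))
      = mfderiv 𝓘(ℝ, V) (𝓡 m) e.symm y w := by
    rintro y' rfl
    rfl
  exact key _ (e.right_inv hy')

variable {L : M → Type*} [TopologicalSpace (TotalSpace ℂ L)]
  [∀ x, NormedAddCommGroup (L x)] [∀ x, InnerProductSpace ℂ (L x)]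
  [FiberBundle ℂ L] [VectorBundle ℂ ℂ L] [VectorBundle ℝ ℂ L]
  [ContMDiffVectorBundle ∞ ℂ L (𝓡 m)]
  {Ω : Π x : M, TSpace m x →L[ℝ] TSpace m x →L[ℝ] ℝ}
  {nabla : CovariantDerivative (𝓡 m) ℂ L}

/-- The phase form of a smooth section is smooth where the section does not vanish. -/
lemma IsPrequantization.contDiffOn_coordPhaseForm (h : IsPrequantization Ω nabla)
    (he : IsSmoothCoord m e) {σ : Π x : M, L x} (hσ : IsSmoothSection (m := m) σ) :
    ContDiffOn ℝ ∞ (coordPhaseForm nabla σ e) (e.target ∩ e.symm ⁻¹' {x | σ x ≠ 0}) := by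
  rw [contDiffOn_clm_apply]
  rintro w z ⟨hz, hz'⟩
  obtain ⟨X, hX, -, hX'⟩ := he.exists_isSmoothVectorField_eq_coordFrame hz w
  refine ContDiffAt.contDiffWithinAt ?_
  refine ContDiffAt.congr_of_eventuallyEq ?_ (coordPhaseForm_eventuallyEq hX')
  have h1 := (h.metric_smooth σ _ hσ (h.isSmoothSection_nabla hσ hX) (e.symm z)).comp z
    (he.contMDiffAt_symm hz)
  have h2 := (h.contMDiff_norm_sq hσ (e.symm z)).comp z (he.contMDiffAt_symm hz)
  exact (Complex.imCLM.contDiff.contDiffAt.comp z h1.contDiffAt).div h2.contDiffAt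
    (pow_ne_zero 2 (norm_ne_zero_iff.2 hz'))

/-- The exterior derivative of the phase form is `2π Ω`. -/
lemma IsPrequantization.fderiv_coordPhaseForm (h : IsPrequantization Ω nabla)
    (he : IsSmoothCoord m e) {σ : Π x : M, L x} (hσ : IsSmoothSection (m := m) σ) {z : V}
    (hz : z ∈ e.target) (hσz : σ (e.symm z) ≠ 0) {a' : V →L[ℝ] V →L[ℝ] ℝ}
    (ha' : HasFDerivAt (coordPhaseForm nabla σ e) a' z) (v w : V) :
    a' v w - a' w v = 2 * Real.pi * Ω (e.symm z) (coordFrame m e z v) (coordFrame m e z w) := by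
  have := FiniteDimensional.complete ℝ V
  obtain ⟨X, hX, hXp, hXe⟩ := he.exists_isSmoothVectorField_eq_coordFrame hz v
  obtain ⟨Y, hY, hYp, hYe⟩ := he.exists_isSmoothVectorField_eq_coordFrame hz w
  have hXz := hXe.self_of_nhds
  have hYz := hYe.self_of_nhds
  set x := e.symm z with hxdef
  set N : ℝ := ‖σ x‖ ^ 2 with hN
  have hN0 : N ≠ 0 := pow_ne_zero 2 (norm_ne_zero_iff.2 hσz)
  have hbr : VectorField.mlieBracket (𝓡 m) X Y x = 0 := by
    rw [Filter.EventuallyEq.mlieBracket_vectorField_eq hXp hYp,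
      he.mlieBracket_mpullback_const (e.map_target hz)]
  have hcurv := h.curvature X Y σ hX hY hσ x
  rw [hbr, map_zero, sub_zero] at hcurv
  -- The coefficient of the form is `Im ⟨σ, ∇_Y σ⟩ / N`. The key formula differentiates it by metric
  -- compatibility, working with its product by `‖σ‖ ^ 2` to avoid the quotient rule.
  have key : ∀ (Y : Π x : M, TSpace m x) (w : V), IsSmoothVectorField Y →
      (∀ᶠ y in 𝓝 z, Y (e.symm y) = coordFrame m e y w) → ∀ v : V,
      a' v w = ((inner ℂ (nabla σ x (coordFrame m e z v)) (nabla σ x (Y x)) : ℂ).im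
        + (inner ℂ (σ x) (nabla (fun y ↦ nabla σ y (Y y)) x (coordFrame m e z v)) : ℂ).im) / N
        - (inner ℂ (σ x) (nabla σ x (Y x)) : ℂ).im
          * (2 * (inner ℂ (σ x) (nabla σ x (coordFrame m e z v)) : ℂ).re) / N ^ 2 := by
    intro Y w hY hYe v
    have hs := h.isSmoothSection_nabla hσ hY
    have h1 := he.hasFDerivAt_comp_symm hz (h.mdifferentiableAt_inner hσ hs (e.symm z))
    have h2 := he.hasFDerivAt_comp_symm hz
      ((h.contMDiff_norm_sq hσ (e.symm z)).mdifferentiableAt (by simp))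
    have h3 := Complex.imCLM.hasFDerivAt.comp z h1
    have h4 := (ha'.clm_apply (hasFDerivAt_const w z)).mul h2
    have h40 : (fun y ↦ coordPhaseForm nabla σ e y w * ‖σ (e.symm y)‖ ^ 2) =ᶠ[𝓝 z] fun y ↦
        (inner ℂ (σ (e.symm y)) (nabla σ (e.symm y) (Y (e.symm y))) : ℂ).im := by
      filter_upwards [coordPhaseForm_eventuallyEq (nabla := nabla) (σ := σ) hYe] with y hy
      rw [hy]
      by_cases h0 : σ (e.symm y) = 0
      · simp [h0]
      · exact div_mul_cancel₀ _ (pow_ne_zero 2 (norm_ne_zero_iff.2 h0))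
    have h6 := congrArg (fun T ↦ T v) ((h4.congr_of_eventuallyEq h40.symm).unique h3)
    have h60 : (mvfderiv (𝓡 m) (fun y ↦ (inner ℂ (σ y) (nabla σ y (Y y)) : ℂ)) x
        (coordFrame m e z v)).im = coordPhaseForm nabla σ e z w *
          mvfderiv (𝓡 m) (fun y ↦ ‖σ y‖ ^ 2) x (coordFrame m e z v) + N * a' v w := by
      refine h6.symm.trans ?_
      simp [hN]
      rfl
    have h7 : mvfderiv (𝓡 m) (fun y ↦ ‖σ y‖ ^ 2) x (coordFrame m e z v)
        = 2 * (inner ℂ (σ x) (nabla σ x (coordFrame m e z v)) : ℂ).re := by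
      have h8 := h.metric_parallel σ σ hσ hσ x (coordFrame m e z v)
      have h9 : (fun y ↦ ‖σ y‖ ^ 2) = fun y ↦ Complex.reCLM (inner ℂ (σ y) (σ y)) := by
        ext y
        exact (inner_self_eq_norm_sq (𝕜 := ℂ) (σ y)).symm
      have h10 := (Complex.reCLM.hasFDerivAt.comp z
        (he.hasFDerivAt_comp_symm hz (h.mdifferentiableAt_inner hσ hσ (e.symm z))))
      have h11 := congrArg (fun T ↦ T v) (h2.unique (h10.congr_of_eventuallyEq
        (Eventually.of_forall fun y ↦ congrFun h9 (e.symm y))))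
      refine h11.trans ?_
      change (mvfderiv (𝓡 m) (fun y ↦ (inner ℂ (σ y) (σ y) : ℂ)) x (coordFrame m e z v)).re = _
      rw [h8, Complex.add_re, ← inner_conj_symm (nabla σ x (coordFrame m e z v)), Complex.conj_re]
      ring
    have h61 : coordPhaseForm nabla σ e z w = (inner ℂ (σ x) (nabla σ x (Y x)) : ℂ).im / N :=
      (coordPhaseForm_eventuallyEq hYe).self_of_nhds
    rw [h.metric_parallel σ _ hσ hs, h7, h61, Complex.add_im] at h60
    field_simp
    field_simp at h60
    linarith
  rw [key Y w hY hYe v, key X v hX hXe w, ← hXz, ← hYz]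
  -- After antisymmetrization the second-order terms are the curvature identity paired with `σ`.
  have h1 : (inner ℂ (σ x) (nabla (fun y ↦ nabla σ y (Y y)) x (X x)) : ℂ)
      - inner ℂ (σ x) (nabla (fun y ↦ nabla σ y (X y)) x (Y x))
      = ((2 * Real.pi * Ω x (X x) (Y x) * N : ℝ) : ℂ) * Complex.I := by
    rw [← inner_sub_right, hcurv, inner_smul_right, inner_self_eq_norm_sq_to_K, hN]
    push_cast
    change (_ : ℂ) * ((‖σ x‖ : ℝ) : ℂ) ^ 2 = _
    ring
  have h2 := congrArg Complex.im h1
  rw [Complex.sub_im, Complex.im_ofReal_mul, Complex.I_im, mul_one] at h2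
  -- The remaining terms are quadratic in `∇σ`. In a line, `Im ⟨u, w⟩` is determined by the
  -- components of `u` and `w` along `σ`, and this makes those terms cancel.
  have h3 : ∀ u w : L x, (inner ℂ u w : ℂ).im * N
      = (inner ℂ (σ x) u : ℂ).re * (inner ℂ (σ x) w : ℂ).im
        - (inner ℂ (σ x) u : ℂ).im * (inner ℂ (σ x) w : ℂ).re := by
    intro u w
    have := inner_mul_inner u (σ x) w
    rw [← inner_conj_symm u (σ x)] at this
    have h4 := congrArg Complex.im this
    rw [← Complex.ofReal_pow, Complex.im_ofReal_mul, Complex.mul_im, Complex.conj_re,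
      Complex.conj_im] at h4
    rw [hN]
    linarith
  have h4 := h3 (nabla σ x (X x)) (nabla σ x (Y x))
  have h5 := h3 (nabla σ x (Y x)) (nabla σ x (X x))
  field_simp
  linear_combination h4 - h5 + N * h2

end

/-! ### Nonvanishing sections near a point -/

section
variable {m : ℕ} {M : Type*} [TopologicalSpace M] [T2Space M]
  [ChartedSpace (EuclideanSpace ℝ (Fin m)) M] [IsManifold (𝓡 m) ∞ M]
  {L : M → Type*} [TopologicalSpace (TotalSpace ℂ L)]
  [∀ x, NormedAddCommGroup (L x)] [∀ x, InnerProductSpace ℂ (L x)]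
  [FiberBundle ℂ L] [VectorBundle ℝ ℂ L] [ContMDiffVectorBundle ∞ ℂ L (𝓡 m)]

lemma exists_isSmoothSection_ne_zero (x : M) :
    ∃ σ : Π x : M, L x, IsSmoothSection (m := m) σ ∧ σ x ≠ 0 := by
  set T := trivializationAt ℂ L x
  have hx := mem_baseSet_trivializationAt ℂ L x
  have hT : ∀ y ∈ T.baseSet, T ⟨y, T.symm y 1⟩ = (y, 1) := fun y hy ↦ T.apply_mk_symm hy 1
  have hs : ContMDiffOn (𝓡 m) ((𝓡 m).prod 𝓘(ℝ, ℂ)) ∞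
      (fun y ↦ TotalSpace.mk' ℂ (E := L) y (T.symm y 1)) T.baseSet := by
    refine (T.contMDiffOn_section_baseSet_iff (IB := 𝓡 m) (n := ∞)).2 ?_
    exact contMDiffOn_const.congr fun y hy ↦ by rw [hT y hy]
  obtain ⟨σ, hσ, hσx⟩ := exists_contMDiff_section_eventuallyEq T.open_baseSet hs hx
  refine ⟨σ, hσ, fun h0 ↦ ?_⟩
  have h1 := hT x hx
  rw [← hσx.self_of_nhds, h0] at h1
  have h2 := T.zeroSection ℝ hx
  have h3 := congrArg Prod.snd (h2.symm.trans h1)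
  exact zero_ne_one h3

end

/-! ### Coordinates adapted to the fibration -/

section
variable {n : ℕ} {M : Type*} [TopologicalSpace M]
  [ChartedSpace (EuclideanSpace ℝ (Fin (2 * n))) M] [IsManifold (𝓡 (2 * n)) ∞ M]
  {B : Type*} [TopologicalSpace B] [ChartedSpace (EuclideanSpace ℝ (Fin n)) B]
  [IsManifold (𝓡 n) ∞ B]

/-- `e` are coordinates in which `pr` is the projection to the first factor, in the chart of the
base at `b`. -/
structure IsFibredCoord (pr : M → B) (b : B)
    (e : OpenPartialHomeomorph M (EuclideanSpace ℝ (Fin n) × EuclideanSpace ℝ (Fin n))) :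
    Prop where
  coord : IsSmoothCoord (2 * n) e
  mem_source : ∀ x ∈ e.source, pr x ∈ (chartAt (EuclideanSpace ℝ (Fin n)) b).source
  fst_eq : ∀ x ∈ e.source, (e x).1 = chartAt (EuclideanSpace ℝ (Fin n)) b (pr x)

/-- Near a regular point there are coordinates adapted to the fibration. -/
lemma exists_isFibredCoord {pr : M → B} (hpr : ContMDiff (𝓡 (2 * n)) (𝓡 n) ∞ pr) {x : M} {b : B}
    (hxb : pr x = b) (hx : IsRegularPt (m := 2 * n) (n := n) pr x) {U : Set M} (hU : IsOpen U)
    (hxU : x ∈ U) :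
    ∃ e : OpenPartialHomeomorph M (EuclideanSpace ℝ (Fin n) × EuclideanSpace ℝ (Fin n)),
      IsFibredCoord pr b e ∧ x ∈ e.source ∧ e.source ⊆ U := by
  have hc := isSmoothCoord_chartAt n b
  have hcM := isSmoothCoord_chartAt (2 * n) x
  set c := chartAt (EuclideanSpace ℝ (Fin n)) b with hcdef
  set φ := chartAt (EuclideanSpace ℝ (Fin (2 * n))) x with hφdef
  have hxφ : x ∈ φ.source := mem_chart_source _ x
  have hbc : pr x ∈ c.source := by rw [hxb]; exact mem_chart_source _ b
  let W : Set M := U ∩ φ.source ∩ pr ⁻¹' c.source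
  have hW : IsOpen W := (hU.inter φ.open_source).inter (c.open_source.preimage hpr.continuous)
  have hgs : ContMDiffOn (𝓡 (2 * n)) 𝓘(ℝ, EuclideanSpace ℝ (Fin n)) ∞ (fun y ↦ c (pr y)) W :=
    hc.contMDiffOn.comp hpr.contMDiffOn fun y hy ↦ hy.2
  have hcd := hc.mdifferentiableAt hbc
  have hprd : MDifferentiableAt (𝓡 (2 * n)) (𝓡 n) pr x := (hpr x).mdifferentiableAt (by simp)
  have hgd : MDifferentiableAt (𝓡 (2 * n)) 𝓘(ℝ, EuclideanSpace ℝ (Fin n)) (fun y ↦ c (pr y)) x :=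
    hcd.comp x hprd
  let A : EuclideanSpace ℝ (Fin (2 * n)) →L[ℝ] EuclideanSpace ℝ (Fin n) :=
    (mvfderiv (𝓡 (2 * n)) (fun y ↦ c (pr y)) x).comp
      (mfderiv 𝓘(ℝ, EuclideanSpace ℝ (Fin (2 * n))) (𝓡 (2 * n)) φ.symm (φ x))
  have hAv : ∀ v : TSpace (2 * n) x,
      A (mfderiv (𝓡 (2 * n)) 𝓘(ℝ, EuclideanSpace ℝ (Fin (2 * n))) φ x v)
        = mvfderiv (𝓡 (2 * n)) (fun y ↦ c (pr y)) x v :=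
    fun v ↦ congrArg (mvfderiv (𝓡 (2 * n)) (fun y ↦ c (pr y)) x) (hcM.coordFrame_mfderiv hxφ v)
  have hA : Function.Surjective A := by
    intro w
    obtain ⟨v, hv⟩ := hx (mfderiv 𝓘(ℝ, EuclideanSpace ℝ (Fin n)) (𝓡 n) c.symm (c (pr x)) w)
    refine ⟨_, (hAv v).trans ?_⟩
    have h1 : mvfderiv (𝓡 (2 * n)) (fun y ↦ c (pr y)) x v
        = mfderiv (𝓡 n) 𝓘(ℝ, EuclideanSpace ℝ (Fin n)) c (pr x)
          (mfderiv (𝓡 (2 * n)) (𝓡 n) pr x v) :=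
      congrArg (fun T ↦ T v) (mfderiv_comp x hcd hprd)
    rw [h1, hv]
    exact hc.mfderiv_mfderiv_symm hbc w
  obtain ⟨q, hq⟩ := A.toLinearMap.ker.exists_isCompl
  have hfr : Module.finrank ℝ (LinearMap.ker A.toLinearMap)
      = Module.finrank ℝ (EuclideanSpace ℝ (Fin n)) := by
    have h1 := LinearMap.finrank_range_add_finrank_ker A.toLinearMap
    rw [LinearMap.range_eq_top.2 hA, finrank_top] at h1
    simp only [finrank_euclideanSpace, Fintype.card_fin] at h1 ⊢
    omega
  -- `P` projects onto the kernel of `A`, the differential of `c ∘ pr` in the chart `φ`, identified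
  -- with the model space by a dimension count. So `(A, P)` is injective, and `c ∘ pr` together with
  -- `P ∘ φ` are coordinates.
  let P : EuclideanSpace ℝ (Fin (2 * n)) →L[ℝ] EuclideanSpace ℝ (Fin n) :=
    ((LinearEquiv.ofFinrankEq _ _ hfr).toLinearMap.comp
      (Submodule.projectionOnto _ q hq)).toContinuousLinearMap
  have hP : ∀ v, A v = 0 → P v = 0 → v = 0 := by
    intro v hv hPv
    have h1 : Submodule.projectionOnto _ q hq v = 0 :=
      (LinearEquiv.ofFinrankEq _ _ hfr).map_eq_zero_iff.1 hPv
    have h2 := Submodule.projectionOnto_apply_left hq (⟨v, hv⟩ : LinearMap.ker A.toLinearMap)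
    rw [h1] at h2
    exact (congrArg Subtype.val h2).symm
  have hPφ : ContMDiffOn (𝓡 (2 * n)) 𝓘(ℝ, EuclideanSpace ℝ (Fin n)) ∞
      (fun y ↦ P (φ y)) φ.source :=
    P.contMDiff.comp_contMDiffOn hcM.contMDiffOn
  have hg := hgs.prodMk_space (hPφ.mono fun y (hy : y ∈ W) ↦ hy.1.2)
  have hxW : x ∈ W := ⟨⟨hxU, hxφ⟩, hbc⟩
  obtain ⟨e, he, hxe, heW, heq⟩ := exists_isSmoothCoord (m := 2 * n) (x := x)
    (by simp [two_mul]) hW hg hxW (by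
      intro v hv
      have h0 := (hg.contMDiffAt (hW.mem_nhds hxW)).mdifferentiableAt (by simp)
      have h1 := mvfderiv_clm_comp (ContinuousLinearMap.fst ℝ _ _) h0 v
      have h2 := mvfderiv_clm_comp (ContinuousLinearMap.snd ℝ _ _) h0 v
      have h3 := mvfderiv_clm_comp P (hcM.mdifferentiableAt hxφ) v
      rw [hv, map_zero] at h1 h2
      have h4 := hP _ ((hAv v).trans h1) (h3.symm.trans h2)
      rw [← hcM.coordFrame_mfderiv hxφ v, h4]
      exact map_zero (mfderiv 𝓘(ℝ, EuclideanSpace ℝ (Fin (2 * n))) (𝓡 (2 * n)) φ.symm (φ x)))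
  refine ⟨e, ⟨he, fun y hy ↦ (heW hy).2, fun y hy ↦ ?_⟩, hxe, fun y hy ↦ (heW hy).1.1⟩
  rw [heq y hy]

end

section
variable {n : ℕ} {M : Type*} [TopologicalSpace M]
  [ChartedSpace (EuclideanSpace ℝ (Fin (2 * n))) M]
  {B : Type*} [TopologicalSpace B] [ChartedSpace (EuclideanSpace ℝ (Fin n)) B]
  {pr : M → B} {b : B}
  {e : OpenPartialHomeomorph M (EuclideanSpace ℝ (Fin n) × EuclideanSpace ℝ (Fin n))}

namespace IsFibredCoord

lemma fst_eq_symm (he : IsFibredCoord pr b e) {z : EuclideanSpace ℝ (Fin n) × EuclideanSpace ℝ (Fin n)}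
    (hz : z ∈ e.target) : chartAt (EuclideanSpace ℝ (Fin n)) b (pr (e.symm z)) = z.1 := by
  rw [← he.fst_eq _ (e.map_target hz), e.right_inv hz]

lemma pr_symm (he : IsFibredCoord pr b e) {z : EuclideanSpace ℝ (Fin n) × EuclideanSpace ℝ (Fin n)}
    (hz : z ∈ e.target) :
    pr (e.symm z) = (chartAt (EuclideanSpace ℝ (Fin n)) b).symm z.1 := by
  rw [← he.fst_eq_symm hz, OpenPartialHomeomorph.left_inv _ (he.mem_source _ (e.map_target hz))]

/-- In these coordinates `pr` is a linear projection, hence open at regular points. So nearby fibres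
do pass close to `x`. -/
lemma map_nhds (he : IsFibredCoord pr b e) {x : M} (hx : x ∈ e.source) :
    map pr (𝓝 x) = 𝓝 (pr x) := by
  set c := chartAt (EuclideanSpace ℝ (Fin n)) b
  have h1 : pr =ᶠ[𝓝 x] c.symm ∘ Prod.fst ∘ e := by
    filter_upwards [e.open_source.mem_nhds hx] with y hy
    rw [Function.comp_apply, Function.comp_apply, he.fst_eq y hy,
      OpenPartialHomeomorph.left_inv _ (he.mem_source y hy)]
  have hc := OpenPartialHomeomorph.map_source _ (he.mem_source x hx)
  rw [map_congr h1, ← map_map, ← map_map, e.map_nhds_eq hx, map_fst_nhds, he.fst_eq x hx,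
    ← OpenPartialHomeomorph.symm_source] at *
  rw [OpenPartialHomeomorph.map_nhds_eq _ hc, OpenPartialHomeomorph.left_inv _ (he.mem_source x hx)]

variable [IsManifold (𝓡 n) ∞ B]

lemma mvfderiv_coordFrame (he : IsFibredCoord pr b e) (hpr : ContMDiff (𝓡 (2 * n)) (𝓡 n) ∞ pr)
    {z : EuclideanSpace ℝ (Fin n) × EuclideanSpace ℝ (Fin n)} (hz : z ∈ e.target)
    (w : EuclideanSpace ℝ (Fin n) × EuclideanSpace ℝ (Fin n)) :
    mvfderiv (𝓡 (2 * n)) (fun y ↦ chartAt (EuclideanSpace ℝ (Fin n)) b (pr y)) (e.symm z)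
      (coordFrame (2 * n) e z w) = w.1 := by
  have hcd := (isSmoothCoord_chartAt n b).mdifferentiableAt (he.mem_source _ (e.map_target hz))
  have hprd : MDifferentiableAt (𝓡 (2 * n)) (𝓡 n) pr (e.symm z) :=
    (hpr _).mdifferentiableAt (by simp)
  have h1 := he.coord.hasFDerivAt_comp_symm hz (hcd.comp _ hprd)
  have h2 : (Prod.fst : EuclideanSpace ℝ (Fin n) × EuclideanSpace ℝ (Fin n) → _) =ᶠ[𝓝 z]
      fun z ↦ chartAt (EuclideanSpace ℝ (Fin n)) b (pr (e.symm z)) := by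
    filter_upwards [e.open_target.mem_nhds hz] with y hy using (he.fst_eq_symm hy).symm
  have h3 := (h1.congr_of_eventuallyEq h2).unique hasFDerivAt_fst
  exact congrArg (fun T ↦ T w) h3

lemma mfderiv_eq_zero_iff (he : IsFibredCoord pr b e) (hpr : ContMDiff (𝓡 (2 * n)) (𝓡 n) ∞ pr)
    {x : M} (hx : x ∈ e.source) (v : TSpace (2 * n) x) :
    mfderiv (𝓡 (2 * n)) (𝓡 n) pr x v = 0 ↔
      mvfderiv (𝓡 (2 * n)) (fun y ↦ chartAt (EuclideanSpace ℝ (Fin n)) b (pr y)) x v = 0 := by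
  have hc := isSmoothCoord_chartAt n b
  have hcx := he.mem_source x hx
  have hprd : MDifferentiableAt (𝓡 (2 * n)) (𝓡 n) pr x := (hpr _).mdifferentiableAt (by simp)
  have h1 : mvfderiv (𝓡 (2 * n)) (fun y ↦ chartAt (EuclideanSpace ℝ (Fin n)) b (pr y)) x v
      = mfderiv (𝓡 n) 𝓘(ℝ, EuclideanSpace ℝ (Fin n)) (chartAt (EuclideanSpace ℝ (Fin n)) b) (pr x)
        (mfderiv (𝓡 (2 * n)) (𝓡 n) pr x v) :=
    congrArg (fun T ↦ T v) (mfderiv_comp x (hc.mdifferentiableAt hcx) hprd)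
  rw [h1]
  constructor
  · intro h
    rw [h]
    exact map_zero (mfderiv (𝓡 n) 𝓘(ℝ, EuclideanSpace ℝ (Fin n)) _ (pr x))
  · intro h
    rw [← hc.coordFrame_mfderiv hcx (mfderiv (𝓡 (2 * n)) (𝓡 n) pr x v), h]
    exact map_zero (mfderiv 𝓘(ℝ, EuclideanSpace ℝ (Fin n)) (𝓡 n) _ _)

lemma mfderiv_coordFrame_vertical (he : IsFibredCoord pr b e)
    (hpr : ContMDiff (𝓡 (2 * n)) (𝓡 n) ∞ pr)
    {z : EuclideanSpace ℝ (Fin n) × EuclideanSpace ℝ (Fin n)} (hz : z ∈ e.target)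
    (η : EuclideanSpace ℝ (Fin n)) :
    mfderiv (𝓡 (2 * n)) (𝓡 n) pr (e.symm z) (coordFrame (2 * n) e z (0, η)) = 0 :=
  (he.mfderiv_eq_zero_iff hpr (e.map_target hz) _).2 (he.mvfderiv_coordFrame hpr hz (0, η))

lemma exists_eq_coordFrame_of_vertical (he : IsFibredCoord pr b e)
    (hpr : ContMDiff (𝓡 (2 * n)) (𝓡 n) ∞ pr)
    {z : EuclideanSpace ℝ (Fin n) × EuclideanSpace ℝ (Fin n)} (hz : z ∈ e.target)
    {v : TSpace (2 * n) (e.symm z)} (hv : mfderiv (𝓡 (2 * n)) (𝓡 n) pr (e.symm z) v = 0) :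
    ∃ η, v = coordFrame (2 * n) e z (0, η) := by
  obtain ⟨w, rfl⟩ := he.coord.coordFrame_surjective hz v
  have h1 := (he.mfderiv_eq_zero_iff hpr (e.map_target hz) _).1 hv
  rw [he.mvfderiv_coordFrame hpr hz] at h1
  exact ⟨w.2, by rw [← h1]⟩

lemma isRegularPt (he : IsFibredCoord pr b e) (hpr : ContMDiff (𝓡 (2 * n)) (𝓡 n) ∞ pr)
    {x : M} (hx : x ∈ e.source) : IsRegularPt (m := 2 * n) (n := n) pr x := by
  have hc := isSmoothCoord_chartAt n b
  have hcx := he.mem_source x hx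
  have hprd : MDifferentiableAt (𝓡 (2 * n)) (𝓡 n) pr x := (hpr _).mdifferentiableAt (by simp)
  obtain ⟨z, hz, rfl⟩ : ∃ z ∈ e.target, e.symm z = x := ⟨e x, e.map_source hx, e.left_inv hx⟩
  intro u
  set w : EuclideanSpace ℝ (Fin n) := mfderiv (𝓡 n) 𝓘(ℝ, EuclideanSpace ℝ (Fin n))
    (chartAt (EuclideanSpace ℝ (Fin n)) b) (pr (e.symm z)) u with hw
  refine ⟨coordFrame (2 * n) e z (w, 0), ?_⟩
  have h1 := he.mvfderiv_coordFrame hpr hz (w, 0)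
  have h2 : mvfderiv (𝓡 (2 * n)) (fun y ↦ chartAt (EuclideanSpace ℝ (Fin n)) b (pr y)) (e.symm z)
        (coordFrame (2 * n) e z (w, 0))
      = mfderiv (𝓡 n) 𝓘(ℝ, EuclideanSpace ℝ (Fin n)) (chartAt (EuclideanSpace ℝ (Fin n)) b)
        (pr (e.symm z)) (mfderiv (𝓡 (2 * n)) (𝓡 n) pr (e.symm z)
          (coordFrame (2 * n) e z (w, 0))) :=
    congrArg (fun T ↦ T (coordFrame (2 * n) e z (w, 0)))
      (mfderiv_comp (e.symm z) (hc.mdifferentiableAt hcx) hprd)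
  have h3 := h2.symm.trans h1
  rw [← hc.coordFrame_mfderiv hcx u, ← hw,
    ← hc.coordFrame_mfderiv hcx (mfderiv (𝓡 (2 * n)) (𝓡 n) pr (e.symm z)
          (coordFrame (2 * n) e z (w, 0))), h3]

end IsFibredCoord

lemma isOpen_setOf_isRegularPt [IsManifold (𝓡 (2 * n)) ∞ M] [IsManifold (𝓡 n) ∞ B]
    (hpr : ContMDiff (𝓡 (2 * n)) (𝓡 n) ∞ pr) :
    IsOpen {x | IsRegularPt (m := 2 * n) (n := n) pr x} := by
  rw [isOpen_iff_mem_nhds]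
  intro x hx
  obtain ⟨e, he, hxe, -⟩ := exists_isFibredCoord hpr rfl hx isOpen_univ (mem_univ x)
  filter_upwards [e.open_source.mem_nhds hxe] with y hy using he.isRegularPt hpr hy

end

/-! ### Flat sections along fibres, and the form on nearby fibres -/

section
variable {n : ℕ} {M : Type*} [TopologicalSpace M]
  [ChartedSpace (EuclideanSpace ℝ (Fin (2 * n))) M]
  {B : Type*} [TopologicalSpace B] [ChartedSpace (EuclideanSpace ℝ (Fin n)) B]
  {L : M → Type*} [TopologicalSpace (TotalSpace ℂ L)]
  [∀ x, NormedAddCommGroup (L x)] [∀ x, InnerProductSpace ℂ (L x)]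
  [FiberBundle ℂ L]
  {Ω : Π x : M, TSpace (2 * n) x →L[ℝ] TSpace (2 * n) x →L[ℝ] ℝ}
  {nabla : CovariantDerivative (𝓡 (2 * n)) ℂ L} {pr : M → B} {b : B}
  {e : OpenPartialHomeomorph M (EuclideanSpace ℝ (Fin n) × EuclideanSpace ℝ (Fin n))}

/-- The unit section `σ / |σ|` is defined and covariantly constant along the fibres of `pr` at the
points of `S`. -/
def IsPhaseFlatOn (nabla : CovariantDerivative (𝓡 (2 * n)) ℂ L) (pr : M → B) (σ : Π x : M, L x)
    (S : Set M) : Prop :=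
  ∀ x ∈ S, σ x ≠ 0 ∧ ∀ v : TSpace (2 * n) x,
    mfderiv (𝓡 (2 * n)) (𝓡 n) pr x v = 0 → phaseForm nabla σ x v = 0

/-- Only the unit section matters for the holonomy. The weaker condition leaves the modulus free, so
that limits of phases can be glued by a partition of unity. -/
lemma IsBohrSommerfeldFibre.exists_isPhaseFlatOn
    (h : IsBohrSommerfeldFibre (m := 2 * n) (n := n) nabla pr b) :
    ∃ σ : Π x : M, L x, IsSmoothSection (m := 2 * n) σ ∧ IsPhaseFlatOn nabla pr σ (pr ⁻¹' {b}) := by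
  obtain ⟨σ, hσ, hf⟩ := h
  refine ⟨σ, hσ, fun x hx ↦ ⟨(hf x hx).1, fun v hv ↦ ?_⟩⟩
  rw [phaseForm_apply, (hf x hx).2 v hv]
  simp

/-- The restriction of the phase form to the fibres, in adapted coordinates. -/
noncomputable def fibrePhaseForm (nabla : CovariantDerivative (𝓡 (2 * n)) ℂ L) (σ : Π x : M, L x)
    (e : OpenPartialHomeomorph M (EuclideanSpace ℝ (Fin n) × EuclideanSpace ℝ (Fin n)))
    (z : EuclideanSpace ℝ (Fin n) × EuclideanSpace ℝ (Fin n)) : EuclideanSpace ℝ (Fin n) →L[ℝ] ℝ :=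
  (coordPhaseForm nabla σ e z).comp (ContinuousLinearMap.inr ℝ _ _)

variable [VectorBundle ℂ ℂ L] [VectorBundle ℝ ℂ L]
  [IsManifold (𝓡 (2 * n)) ∞ M] [ContMDiffVectorBundle ∞ ℂ L (𝓡 (2 * n))]

lemma IsPrequantization.contDiffOn_fibrePhaseForm [T2Space M] (h : IsPrequantization Ω nabla)
    (he : IsFibredCoord pr b e)
    {s : Π x : M, L x} (hs : IsSmoothSection (m := 2 * n) s) (hs0 : ∀ x ∈ e.source, s x ≠ 0) :
    ContDiffOn ℝ ∞ (fibrePhaseForm nabla s e) e.target := by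
  have h1 := h.contDiffOn_coordPhaseForm he.coord hs
  have h2 : ContDiffOn ℝ ∞ (coordPhaseForm nabla s e) e.target :=
    h1.mono fun z hz ↦ ⟨hz, hs0 _ (e.map_target hz)⟩
  exact h2.clm_comp contDiffOn_const

variable [IsManifold (𝓡 n) ∞ B]

/-- Along the fibres, the phase of a flat section relative to `s` is a solution of `dg = -i J g`, where
`J` is the phase form of `s`. -/
lemma IsPrequantization.hasFDerivAt_phase (h : IsPrequantization Ω nabla)
    (hpr : ContMDiff (𝓡 (2 * n)) (𝓡 n) ∞ pr) (he : IsFibredCoord pr b e)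
    {s τ : Π x : M, L x} (hs : IsSmoothSection (m := 2 * n) s) (hτ : IsSmoothSection (m := 2 * n) τ)
    {z : EuclideanSpace ℝ (Fin n) × EuclideanSpace ℝ (Fin n)} (hz : z ∈ e.target)
    (hsz : s (e.symm z) ≠ 0) (hf : IsPhaseFlatOn nabla pr τ {e.symm z}) :
    HasFDerivAt (fun y ↦ phase (inner ℂ (s (e.symm (z.1, y))) (τ (e.symm (z.1, y)))))
      ((fibrePhaseForm nabla s e z).smulRight
        (-Complex.I * phase (inner ℂ (s (e.symm z)) (τ (e.symm z))))) z.2 := by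
  have hfz := hf _ rfl
  have h1 := he.coord.hasFDerivAt_comp_symm hz (h.mdifferentiableAt_inner hs hτ (e.symm z))
  have h2 := h1.phase (inner_ne_zero_of_ne_zero hsz hfz.1)
    (θ := coordPhaseForm nabla τ e z - coordPhaseForm nabla s e z)
    (fun w ↦ (h.im_mvfderiv_inner_div hs hτ hsz hfz.1 (coordFrame (2 * n) e z w)).symm)
  have h3 : HasFDerivAt (fun y : EuclideanSpace ℝ (Fin n) ↦ (z.1, y))
      (ContinuousLinearMap.inr ℝ _ _) z.2 := hasFDerivAt_prodMk_right z.1 z.2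
  refine (HasFDerivAt.comp z.2 (f := fun y ↦ (z.1, y)) h2 h3).congr_fderiv ?_
  ext η
  have h4 : coordPhaseForm nabla τ e z (0, η) = 0 :=
    hfz.2 _ (he.mfderiv_coordFrame_vertical hpr hz η)
  simp [fibrePhaseForm, h4]

/-- If the phase form of `s` vanishes on the fibre over `b`, then its restriction to nearby fibres
has no zeros. -/
lemma IsPrequantization.eventually_fibrePhaseForm_ne_zero [T2Space M]
    (h : IsPrequantization Ω nabla) (hΩ : IsSymplecticForm Ω) (hpr : IsLagrangianFibration Ω pr)
    (he : IsFibredCoord pr b e)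
    {s : Π x : M, L x} (hs : IsSmoothSection (m := 2 * n) s) (hs0 : ∀ x ∈ e.source, s x ≠ 0)
    (hflat : ∀ x ∈ e.source, pr x = b → phaseForm nabla s x = 0)
    {x : M} (hx : x ∈ e.source) (hxb : pr x = b) :
    ∀ᶠ z in 𝓝 (e x), fibrePhaseForm nabla s e z = 0 → z.1 = (e x).1 := by
  have hz : e x ∈ e.target := e.map_source hx
  have hd : ContDiffAt ℝ ∞ (coordPhaseForm nabla s e) (e x) :=
    ((h.contDiffOn_coordPhaseForm he.coord hs).mono
      fun z hz ↦ ⟨hz, hs0 _ (e.map_target hz)⟩).contDiffAt (e.open_target.mem_nhds hz)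
  set a' := fderiv ℝ (coordPhaseForm nabla s e) (e x) with ha'
  have hstrict : HasStrictFDerivAt (coordPhaseForm nabla s e) a' (e x) :=
    hd.hasStrictFDerivAt (by simp)
  have hzero : ∀ᶠ y in 𝓝 (e x).2, coordPhaseForm nabla s e ((e x).1, y) = 0 := by
    have h1 : ∀ᶠ y in 𝓝 (e x).2, ((e x).1, y) ∈ e.target :=
      (Continuous.tendsto' (by fun_prop) _ _ rfl :
        Tendsto (fun y ↦ ((e x).1, y)) (𝓝 (e x).2) (𝓝 (e x))).eventually
        (e.open_target.mem_nhds hz)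
    filter_upwards [h1] with y hy
    have h2 : pr (e.symm ((e x).1, y)) = b := by
      rw [he.pr_symm hy, ← he.pr_symm hz, e.left_inv hx, hxb]
    rw [coordPhaseForm, hflat _ (e.map_target hy) h2]
    exact ContinuousLinearMap.zero_comp _
  -- The whole form vanishes along the slice, hence so do its derivatives in fibre directions. Only
  -- one of the two terms of the exterior derivative on `(w, 0), (0, η)` remains.
  have ha'0 : ∀ η, a' (0, η) = 0 := by
    intro η
    have h1 : HasFDerivAt (fun y ↦ coordPhaseForm nabla s e ((e x).1, y))
        (a'.comp (ContinuousLinearMap.inr ℝ _ _)) (e x).2 :=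
      HasFDerivAt.comp (e x).2 (f := fun y ↦ ((e x).1, y)) hstrict.hasFDerivAt
        (hasFDerivAt_prodMk_right (e x).1 (e x).2)
    have h2 := (h1.congr_of_eventuallyEq (f₁ := fun _ ↦ 0)
      (by filter_upwards [hzero] with y hy using hy.symm)).unique (hasFDerivAt_const _ _)
    exact congrArg (fun T ↦ T η) h2
  have hJ : HasStrictFDerivAt (fibrePhaseForm nabla s e)
      ((ContinuousLinearMap.precomp ℝ (ContinuousLinearMap.inr ℝ (EuclideanSpace ℝ (Fin n))
        (EuclideanSpace ℝ (Fin n)))).comp a') ((e x).1, (e x).2) :=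
    (ContinuousLinearMap.precomp ℝ (ContinuousLinearMap.inr ℝ (EuclideanSpace ℝ (Fin n))
        (EuclideanSpace ℝ (Fin n)))).hasStrictFDerivAt.comp _ hstrict
  refine eventually_fst_eq_of_eq_zero hJ ?_ ?_
  · filter_upwards [hzero] with y hy
    rw [fibrePhaseForm, hy, ContinuousLinearMap.zero_comp]
  · intro w hw
    have hreg := he.isRegularPt hpr.smooth (e.map_target hz)
    let D : EuclideanSpace ℝ (Fin n) × EuclideanSpace ℝ (Fin n) →L[ℝ]
      EuclideanSpace ℝ (Fin (2 * n)) := coordFrame (2 * n) e (e x)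
    let W : EuclideanSpace ℝ (Fin (2 * n)) →L[ℝ] EuclideanSpace ℝ (Fin (2 * n)) →L[ℝ] ℝ :=
      Ω (e.symm (e x))
    refine eq_zero_of_isotropic_pairing (W.bilinearComp D D)
      (fun v ↦ hΩ.alternating (e.symm (e x)) (coordFrame (2 * n) e (e x) v)) (fun v hv ↦ ?_)
      (fun η η' ↦ ?_) (fun η ↦ ?_)
    · have h1 := hΩ.nondegenerate _ (coordFrame (2 * n) e (e x) v) (fun u ↦ by
        obtain ⟨u, rfl⟩ := he.coord.coordFrame_surjective hz u
        exact hv u)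
      exact he.coord.coordFrame_injective hz (h1.trans (map_zero _).symm)
    · exact hpr.lagrangian _ hreg _ _ (he.mfderiv_coordFrame_vertical hpr.smooth hz η)
        (he.mfderiv_coordFrame_vertical hpr.smooth hz η')
    -- By the curvature condition, the derivative of the fibre form in direction `w`, evaluated at
    -- `η`, is `2π Ω((w, 0), (0, η))`.
    · have h1 := h.fderiv_coordPhaseForm he.coord hs hz (hs0 _ (e.map_target hz))
        hstrict.hasFDerivAt (w, 0) (0, η)
      have h2 : a' (w, 0) (0, η) = 0 := congrArg (fun T ↦ T η) hw
      rw [h2, ha'0, zero_apply, sub_zero] at h1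
      have h3 := h1.symm
      rw [mul_eq_zero] at h3
      exact h3.resolve_left (by positivity)

end

/-! ### Killing the connection form along a flat fibre -/

section
variable {m : ℕ} {M : Type*} [TopologicalSpace M] [ChartedSpace (EuclideanSpace ℝ (Fin m)) M]
  {V W : Type*} [NormedAddCommGroup V] [NormedSpace ℝ V] [NormedAddCommGroup W] [NormedSpace ℝ W]

lemma mvfderiv_comp_of_hasFDerivAt {Φ : V → W} {Φ' : V →L[ℝ] W} {f : M → V} {x : M}
    (hΦ : HasFDerivAt Φ Φ' (f x))
    (hf : MDifferentiableAt (𝓡 m) 𝓘(ℝ, V) f x) (v : TSpace m x) :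
    mvfderiv (𝓡 m) (fun y ↦ Φ (f y)) x v = Φ' (mvfderiv (𝓡 m) f x v) :=
  congrArg (fun A ↦ A v) (hΦ.hasMFDerivAt.comp x hf.hasMFDerivAt).mfderiv

/-- The product rule at a zero of the second factor. -/
lemma mvfderiv_clm_apply_of_eq_zero {A : M → V →L[ℝ] W} {f : M → V} {x : M}
    (hA : MDifferentiableAt (𝓡 m) 𝓘(ℝ, V →L[ℝ] W) A x)
    (hf : MDifferentiableAt (𝓡 m) 𝓘(ℝ, V) f x) (hfx : f x = 0) (v : TSpace m x) :
    mvfderiv (𝓡 m) (fun y ↦ A y (f y)) x v = A x (mvfderiv (𝓡 m) f x v) := by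
  have hp := hA.prodMk_space hf
  have h1 : HasFDerivAt (fun p : (V →L[ℝ] W) × V ↦ p.1 p.2)
      ((A x).comp (ContinuousLinearMap.snd ℝ _ _)) (A x, f x) := by
    refine (hasFDerivAt_fst.clm_apply hasFDerivAt_snd).congr_fderiv ?_
    ext p
    · simp [hfx]
    · simp
  have h2 := mvfderiv_comp_of_hasFDerivAt (f := fun y ↦ (A y, f y)) h1 hp v
  have h3 := mvfderiv_clm_comp (ContinuousLinearMap.snd ℝ (V →L[ℝ] W) V) hp v
  exact h2.trans (congrArg (A x) h3.symm)

end

/-- A chart of a manifold agrees near its centre with a globally defined smooth function, up to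
translation. -/
lemma exists_contMDiff_eventuallyEq_chartAt_sub {n : ℕ} {B : Type*} [TopologicalSpace B] [T2Space B]
    [ChartedSpace (EuclideanSpace ℝ (Fin n)) B] [IsManifold (𝓡 n) ∞ B] (b : B) :
    ∃ H : B → EuclideanSpace ℝ (Fin n), ContMDiff (𝓡 n) 𝓘(ℝ, EuclideanSpace ℝ (Fin n)) ∞ H ∧
      ∀ᶠ y in 𝓝 b, H y = chartAt (EuclideanSpace ℝ (Fin n)) b y
        - chartAt (EuclideanSpace ℝ (Fin n)) b b := by
  let f : SmoothBumpFunction (𝓡 n) b := Classical.arbitrary _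
  refine ⟨fun y ↦ f y • (chartAt (EuclideanSpace ℝ (Fin n)) b y
        - chartAt (EuclideanSpace ℝ (Fin n)) b b), f.contMDiff_smul
      ((isSmoothCoord_chartAt n b).contMDiffOn.sub contMDiffOn_const), ?_⟩
  filter_upwards [f.eventuallyEq_one] with y hy
  simp [hy]

section
variable {n : ℕ} {M : Type*} [TopologicalSpace M]
  [ChartedSpace (EuclideanSpace ℝ (Fin (2 * n))) M] [IsManifold (𝓡 (2 * n)) ∞ M]
  {B : Type*} [TopologicalSpace B] [ChartedSpace (EuclideanSpace ℝ (Fin n)) B]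
  {L : M → Type*} [TopologicalSpace (TotalSpace ℂ L)]
  [∀ x, NormedAddCommGroup (L x)] [∀ x, InnerProductSpace ℂ (L x)]
  [FiberBundle ℂ L] [VectorBundle ℂ ℂ L] [VectorBundle ℝ ℂ L]
  [ContMDiffVectorBundle ∞ ℂ L (𝓡 (2 * n))]
  {Ω : Π x : M, TSpace (2 * n) x →L[ℝ] TSpace (2 * n) x →L[ℝ] ℝ}
  {nabla : CovariantDerivative (𝓡 (2 * n)) ℂ L} {pr : M → B} {b : B}

lemma IsPrequantization.isOpen_ne_zero (h : IsPrequantization Ω nabla) {σ : Π x : M, L x}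
    (hσ : IsSmoothSection (m := 2 * n) σ) : IsOpen {x | σ x ≠ 0} := by
  have h1 := isOpen_ne_fun (h.contMDiff_norm_sq hσ).continuous
    (continuous_const (y := (0 : ℝ)))
  simpa using h1

variable [T2Space M] [T2Space B] [IsManifold (𝓡 n) ∞ B]

/-- If `σ` is flat along a subset `C` of a fibre then it can be modified off the fibre such that its
phase form vanishes on `C`, also in the directions transverse to the fibre. -/
lemma IsPrequantization.exists_phaseForm_eq_zero [SigmaCompactSpace M]
    (h : IsPrequantization Ω nabla) (hpr : ContMDiff (𝓡 (2 * n)) (𝓡 n) ∞ pr)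
    {C : Set M} (hC : IsClosed C) (hCb : ∀ x ∈ C, pr x = b)
    (hCreg : ∀ x ∈ C, IsRegularPt (m := 2 * n) (n := n) pr x)
    {σ : Π x : M, L x} (hσ : IsSmoothSection (m := 2 * n) σ) (hf : IsPhaseFlatOn nabla pr σ C) :
    ∃ s : Π x : M, L x, IsSmoothSection (m := 2 * n) s ∧
      ∀ x ∈ C, s x ≠ 0 ∧ phaseForm nabla s x = 0 := by
  classical
  set c := chartAt (EuclideanSpace ℝ (Fin n)) b with hc
  -- On `C` the form vanishes on vertical vectors, so it factors as `A ∘ d(c ∘ pr)`. This is an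
  -- affine condition on `A`, so local solutions glue by a partition of unity.
  let t : M → Set (EuclideanSpace ℝ (Fin n) →L[ℝ] ℝ) := fun x ↦
    {A | x ∈ C → ∀ v : TSpace (2 * n) x,
      phaseForm nabla σ x v = A (mvfderiv (𝓡 (2 * n)) (fun y ↦ c (pr y)) x v)}
  have ht : ∀ x, Convex ℝ (t x) := by
    intro x A hA A' hA' r r' hr hr' hrr hx v
    rw [add_apply, smul_apply, smul_apply, ← hA hx v, ← hA' hx v, ← add_smul, hrr, one_smul]
  obtain ⟨A, hA⟩ := exists_contMDiffMap_forall_mem_convex_of_local (𝓡 (2 * n)) (n := ⊤) ht (by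
    intro x
    by_cases hx : x ∈ C
    · obtain ⟨e, he, hxe, heU⟩ := exists_isFibredCoord hpr (hCb x hx) (hCreg x hx)
        (h.isOpen_ne_zero hσ) (hf x hx).1
      refine ⟨e.source, e.open_source.mem_nhds hxe, fun y ↦ (coordPhaseForm nabla σ e (e y)).comp
        (ContinuousLinearMap.inl ℝ _ _), ?_, ?_⟩
      · have h1 : ContDiffOn ℝ ∞ (coordPhaseForm nabla σ e) e.target :=
          (h.contDiffOn_coordPhaseForm he.coord hσ).mono
            fun z hz ↦ ⟨hz, heU (e.map_target hz)⟩
        have h2 : ContDiffOn ℝ ∞ (fun z ↦ (coordPhaseForm nabla σ e z).comp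
          (ContinuousLinearMap.inl ℝ _ _)) e.target := h1.clm_comp contDiffOn_const
        exact h2.contMDiffOn.comp he.coord.contMDiffOn fun y hy ↦ e.map_source hy
      · intro y hy hyC v
        obtain ⟨z, hz, rfl⟩ : ∃ z ∈ e.target, e.symm z = y := ⟨e y, e.map_source hy, e.left_inv hy⟩
        obtain ⟨w, rfl⟩ := he.coord.coordFrame_surjective hz v
        rw [he.mvfderiv_coordFrame hpr hz]
        simp only [e.right_inv hz]
        have h3 : coordPhaseForm nabla σ e z (0, w.2) = 0 :=
          (hf _ hyC).2 _ (he.mfderiv_coordFrame_vertical hpr hz w.2)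
        have h4 := map_add (coordPhaseForm nabla σ e z) (w.1, 0) (0, w.2)
        rw [h3, add_zero, Prod.mk_add_mk, add_zero, zero_add] at h4
        exact h4
    · exact ⟨Cᶜ, hC.isOpen_compl.mem_nhds hx, fun _ ↦ 0, contMDiffOn_const,
        fun y hy hyC ↦ (hy hyC).elim⟩)
  obtain ⟨H, hH, hHc⟩ := exists_contMDiff_eventuallyEq_chartAt_sub (n := n) b
  have hHpr : ContMDiff (𝓡 (2 * n)) 𝓘(ℝ, EuclideanSpace ℝ (Fin n)) ∞ (fun x ↦ H (pr x)) :=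
    hH.comp hpr
  have hA' : ContMDiff (𝓡 (2 * n)) 𝓘(ℝ, EuclideanSpace ℝ (Fin n) →L[ℝ] ℝ) ∞ A := A.contMDiff
  -- On `C`, `f` vanishes and `df = -A ∘ d(c ∘ pr)`, which is minus the form of `σ`. The new section
  -- `(1 + i f) σ` therefore has vanishing form there.
  let f : M → ℝ := fun x ↦ -(A x (H (pr x)))
  have hfs : ContMDiff (𝓡 (2 * n)) 𝓘(ℝ, ℝ) ∞ f := (hA'.clm_apply hHpr).neg
  have hfd : ∀ x, MDifferentiableAt (𝓡 (2 * n)) 𝓘(ℝ, ℝ) f x :=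
    fun x ↦ (hfs x).mdifferentiableAt (by simp)
  have hH0 : ∀ x ∈ C, H (pr x) = 0 := by
    intro x hx
    rw [hCb x hx, hHc.self_of_nhds, sub_self]
  refine ⟨fun x ↦ σ x + f x • (Complex.I • σ x), ?_, fun x hx ↦ ?_⟩
  · have h1 : IsSmoothSection (m := 2 * n) (fun x ↦ (1 + (f x : ℂ) * Complex.I) • σ x) :=
      hσ.smul ((contDiff_const.add
        (Complex.ofRealCLM.contDiff.mul contDiff_const)).contMDiff.comp hfs)
    convert h1 using 2 with x
    rw [add_smul, one_smul, mul_smul, Complex.coe_smul]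
  · have hfx : f x = 0 := by simp [f, hH0 x hx]
    refine ⟨by simpa [hfx] using (hf x hx).1, ?_⟩
    rw [phaseForm_add_smul_I nabla hσ (hfd x) hfx (hf x hx).1]
    ext v
    have hAd : MDifferentiableAt (𝓡 (2 * n)) 𝓘(ℝ, EuclideanSpace ℝ (Fin n) →L[ℝ] ℝ) A x :=
      (hA' x).mdifferentiableAt (by simp)
    have hHd : MDifferentiableAt (𝓡 (2 * n)) 𝓘(ℝ, EuclideanSpace ℝ (Fin n)) (fun x ↦ H (pr x)) x :=
      (hHpr x).mdifferentiableAt (by simp)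
    have hcd : MDifferentiableAt (𝓡 (2 * n)) 𝓘(ℝ, EuclideanSpace ℝ (Fin n)) (fun y ↦ c (pr y)) x :=
      ((isSmoothCoord_chartAt n b).mdifferentiableAt
        (by rw [hCb x hx]; exact mem_chart_source _ b)).comp x
        ((hpr x).mdifferentiableAt (by simp))
    have h1 : mvfderiv (𝓡 (2 * n)) (fun x ↦ H (pr x)) x v
        = mvfderiv (𝓡 (2 * n)) (fun y ↦ c (pr y)) x v := by
      have h2 : (fun x ↦ H (pr x)) =ᶠ[𝓝 x] fun x ↦ c (pr x) - c b := by
        have h3 : Tendsto pr (𝓝 x) (𝓝 b) := by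
          have := hpr.continuous.tendsto x
          rwa [hCb x hx] at this
        exact h3.eventually hHc
      have h4 := mvfderiv_comp_of_hasFDerivAt (f := fun y ↦ c (pr y))
        (Φ := fun u ↦ u - c b) ((hasFDerivAt_id (𝕜 := ℝ) (c (pr x))).sub_const (c b)) hcd v
      exact (congrArg (fun T : TSpace (2 * n) x →L[ℝ] EuclideanSpace ℝ (Fin n) ↦ T v)
        h2.mfderiv_eq).trans h4
    have h5 := mvfderiv_clm_apply_of_eq_zero hAd hHd (hH0 x hx) v
    rw [h1, ← hA x hx v] at h5
    have h6 := mvfderiv_clm_comp (-ContinuousLinearMap.id ℝ ℝ)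
      (f := fun x ↦ A x (H (pr x))) (hAd.clm_apply hHd) v
    have h7 : mvfderiv (𝓡 (2 * n)) f x v = - phaseForm nabla σ x v := by
      rw [← h5]
      exact h6
    rw [add_apply, h7, add_neg_cancel]
    rfl

end

/-! ### Phases of flat sections on nearby fibres -/

section
variable {n : ℕ} {M : Type*} [TopologicalSpace M]
  [ChartedSpace (EuclideanSpace ℝ (Fin (2 * n))) M] [IsManifold (𝓡 (2 * n)) ∞ M]
  {B : Type*} [TopologicalSpace B] [ChartedSpace (EuclideanSpace ℝ (Fin n)) B]
  [IsManifold (𝓡 n) ∞ B]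
  {L : M → Type*} [TopologicalSpace (TotalSpace ℂ L)]
  [∀ x, NormedAddCommGroup (L x)] [∀ x, InnerProductSpace ℂ (L x)]
  [FiberBundle ℂ L] [VectorBundle ℂ ℂ L] [VectorBundle ℝ ℂ L]
  [ContMDiffVectorBundle ∞ ℂ L (𝓡 (2 * n))]
  {Ω : Π x : M, TSpace (2 * n) x →L[ℝ] TSpace (2 * n) x →L[ℝ] ℝ}
  {nabla : CovariantDerivative (𝓡 (2 * n)) ℂ L} {pr : M → B} {b : B}
  {e : OpenPartialHomeomorph M (EuclideanSpace ℝ (Fin n) × EuclideanSpace ℝ (Fin n))}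

/-- This is the mean value inequality for `dG = -i J G`, where `|G| = 1`: a small fibre form forces
a small oscillation of the phase. -/
lemma IsPrequantization.norm_phase_sub_le (h : IsPrequantization Ω nabla)
    (hpr : ContMDiff (𝓡 (2 * n)) (𝓡 n) ∞ pr) (he : IsFibredCoord pr b e)
    {s τ : Π x : M, L x} (hs : IsSmoothSection (m := 2 * n) s) (hτ : IsSmoothSection (m := 2 * n) τ)
    {u : EuclideanSpace ℝ (Fin n)} {S : Set (EuclideanSpace ℝ (Fin n))} (hS : Convex ℝ S)
    (hse : ∀ y ∈ S, (u, y) ∈ e.target ∧ s (e.symm (u, y)) ≠ 0 ∧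
      IsPhaseFlatOn nabla pr τ {e.symm (u, y)})
    {δ : ℝ} (hδ : ∀ y ∈ S, ‖fibrePhaseForm nabla s e (u, y)‖ ≤ δ)
    {y y' : EuclideanSpace ℝ (Fin n)} (hy : y ∈ S) (hy' : y' ∈ S) :
    ‖phase (inner ℂ (s (e.symm (u, y'))) (τ (e.symm (u, y'))))
      - phase (inner ℂ (s (e.symm (u, y))) (τ (e.symm (u, y))))‖ ≤ δ * ‖y' - y‖ := by
  refine hS.norm_image_sub_le_of_norm_hasFDerivWithin_le
    (f := fun y ↦ phase (inner ℂ (s (e.symm (u, y))) (τ (e.symm (u, y)))))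
    (fun y hy ↦ (h.hasFDerivAt_phase hpr he hs hτ (hse y hy).1 (hse y hy).2.1
      (hse y hy).2.2).hasFDerivWithinAt) (fun y hy ↦ ?_) hy hy'
  rw [ContinuousLinearMap.norm_smulRight_apply, norm_mul, norm_neg, Complex.norm_I, one_mul,
    norm_phase (inner_ne_zero_of_ne_zero (hse y hy).2.1 ((hse y hy).2.2 _ rfl).1), mul_one]
  exact hδ y hy

/-- If the real part of the phase has a local maximum on a fibre at a point where the phase form does
not vanish on the fibre, then the phase is real there. -/
lemma IsPrequantization.im_eq_zero_of_isLocalMaxOn (h : IsPrequantization Ω nabla)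
    (hpr : ContMDiff (𝓡 (2 * n)) (𝓡 n) ∞ pr) (he : IsFibredCoord pr b e)
    {s τ : Π x : M, L x} (hs : IsSmoothSection (m := 2 * n) s) (hτ : IsSmoothSection (m := 2 * n) τ)
    {x : M} (hx : x ∈ e.source) (hsx : s x ≠ 0) (hf : IsPhaseFlatOn nabla pr τ (pr ⁻¹' {pr x}))
    (hJ : fibrePhaseForm nabla s e (e x) ≠ 0) {c : ℂ}
    (hmax : IsLocalMaxOn (fun y ↦ (c * phase (inner ℂ (s y) (τ y))).re) (pr ⁻¹' {pr x}) x) :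
    (c * phase (inner ℂ (s x) (τ x))).im = 0 := by
  obtain ⟨z, hz, rfl⟩ : ∃ z ∈ e.target, e.symm z = x := ⟨e x, e.map_source hx, e.left_inv hx⟩
  rw [e.right_inv hz] at hJ
  set G := phase (inner ℂ (s (e.symm z)) (τ (e.symm z)))
  have h1 := h.hasFDerivAt_phase hpr he hs hτ hz hsx fun y hy ↦ hf y (by rw [hy]; rfl)
  have h2 : HasFDerivAt
      (fun y ↦ (c * phase (inner ℂ (s (e.symm (z.1, y))) (τ (e.symm (z.1, y))))).re)
      (Complex.reCLM.comp (c • (fibrePhaseForm nabla s e z).smulRight (-Complex.I * G))) z.2 :=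
    Complex.reCLM.hasFDerivAt.comp z.2 (h1.const_mul c)
  have h3 : ∀ᶠ y in 𝓝 z.2, (z.1, y) ∈ e.target :=
    (Continuous.tendsto' (by fun_prop) _ _ rfl :
      Tendsto (fun y ↦ (z.1, y)) (𝓝 z.2) (𝓝 z)).eventually (e.open_target.mem_nhds hz)
  have h4 : IsLocalMax
      (fun y ↦ (c * phase (inner ℂ (s (e.symm (z.1, y))) (τ (e.symm (z.1, y))))).re) z.2 := by
    have h5 : Tendsto (fun y ↦ e.symm (z.1, y)) (𝓝 z.2) (𝓝[pr ⁻¹' {pr (e.symm z)}] (e.symm z)) := by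
      refine tendsto_nhdsWithin_iff.2 ⟨?_, ?_⟩
      · exact (e.continuousAt_symm hz).tendsto.comp (Continuous.tendsto' (by fun_prop) _ _ rfl)
      · filter_upwards [h3] with y hy
        rw [mem_preimage, mem_singleton_iff, he.pr_symm hy, he.pr_symm hz]
    exact h5.eventually hmax
  have h5 := h4.hasFDerivAt_eq_zero h2
  by_contra him
  apply hJ
  ext η
  -- The derivative of `Re (cG)` along the fibre is `J · Im (cG)`. At a maximum it is zero while `J`
  -- is not.
  have h6 : (c * ((fibrePhaseForm nabla s e z η : ℂ) * (-Complex.I * G))).re = 0 :=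
    congrArg (fun T ↦ T η) h5
  have h7 : c * ((fibrePhaseForm nabla s e z η : ℂ) * (-Complex.I * G))
      = (fibrePhaseForm nabla s e z η : ℂ) * (-Complex.I * (c * G)) := by ring
  rw [h7, Complex.re_ofReal_mul] at h6
  have h8 : (-Complex.I * (c * G)).re = (c * G).im := by simp
  rw [h8] at h6
  exact (mul_eq_zero.1 h6).resolve_right him

variable [T2Space M]

/-- Near a point at which the phase form of `s` vanishes along the fibre over `b`, the phases of
flat sections on nearby fibres oscillate little, and have no critical points. -/
lemma IsPrequantization.exists_nhds_phase (h : IsPrequantization Ω nabla)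
    (hΩ : IsSymplecticForm Ω) (hpr : IsLagrangianFibration Ω pr) {s : Π x : M, L x}
    (hs : IsSmoothSection (m := 2 * n) s) {x₀ : M} (hx₀ : pr x₀ = b)
    (hreg : IsRegularPt (m := 2 * n) (n := n) pr x₀) (hsx₀ : s x₀ ≠ 0)
    {O : Set M} (hO : IsOpen O) (hxO : x₀ ∈ O)
    (hflat : ∀ x ∈ O, pr x = b → phaseForm nabla s x = 0) :
    ∃ U ∈ 𝓝 x₀, (∀ x ∈ U, s x ≠ 0) ∧
      (∀ ε > 0, ∀ᶠ b' in 𝓝 b, ∀ τ : Π x : M, L x, IsSmoothSection (m := 2 * n) τ →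
        IsPhaseFlatOn nabla pr τ (pr ⁻¹' {b'}) → ∀ x ∈ U, ∀ x' ∈ U, pr x = b' → pr x' = b' →
        ‖phase (inner ℂ (s x') (τ x')) - phase (inner ℂ (s x) (τ x))‖ ≤ ε) ∧
      ∀ x ∈ U, pr x ≠ b → ∀ τ : Π x : M, L x, IsSmoothSection (m := 2 * n) τ →
        IsPhaseFlatOn nabla pr τ (pr ⁻¹' {pr x}) → ∀ c : ℂ,
        IsLocalMaxOn (fun y ↦ (c * phase (inner ℂ (s y) (τ y))).re) (pr ⁻¹' {pr x}) x →
        (c * phase (inner ℂ (s x) (τ x))).im = 0 := by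
  obtain ⟨e, he, hxe, heU⟩ := exists_isFibredCoord hpr.smooth hx₀ hreg
    (hO.inter (h.isOpen_ne_zero hs)) ⟨hxO, hsx₀⟩
  have hs0 : ∀ x ∈ e.source, s x ≠ 0 := fun x hx ↦ (heU hx).2
  have hz := e.map_source hxe
  have hev := h.eventually_fibrePhaseForm_ne_zero hΩ hpr he hs hs0
    (fun x hx ↦ hflat x (heU hx).1) hxe hx₀
  obtain ⟨r, hr, hrt⟩ := Metric.nhds_basis_closedBall.mem_iff.1 (e.open_target.mem_nhds hz)
  have hJ := (h.contDiffOn_fibrePhaseForm he hs hs0).continuousOn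
  set c := chartAt (EuclideanSpace ℝ (Fin n)) b with hc
  have hcb : c b = (e x₀).1 := by rw [he.fst_eq _ hxe, hx₀]
  have hmem : ∀ u ∈ Metric.closedBall (e x₀).1 r, ∀ y ∈ Metric.closedBall (e x₀).2 r,
      (u, y) ∈ e.target := fun u hu y hy ↦ hrt (by
    rw [← Prod.mk.eta (p := e x₀), ← closedBall_prod_same]
    exact ⟨hu, hy⟩)
  have hUn : e.source ∩ e ⁻¹' (Metric.ball (e x₀) r) ∈ 𝓝 x₀ :=
    inter_mem (e.open_source.mem_nhds hxe)
      ((e.continuousAt hxe).preimage_mem_nhds (Metric.ball_mem_nhds _ hr))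
  -- The last condition defining the neighbourhood excludes zeros of the fibre form off the fibre
  -- over `b`. The ball controls the oscillation.
  refine ⟨(e.source ∩ e ⁻¹' (Metric.ball (e x₀) r)) ∩ {x | fibrePhaseForm nabla s e (e x) = 0 →
    (e x).1 = (e x₀).1}, inter_mem hUn ((e.continuousAt hxe).eventually hev),
    fun x hx ↦ hs0 x hx.1.1, fun ε hε ↦ ?_, fun x hx hxb τ hτ hf c' hmax ↦ ?_⟩
  · have h1 : ∀ᶠ u in 𝓝 (e x₀).1, ∀ y ∈ Metric.closedBall (e x₀).2 r,
        ‖fibrePhaseForm nabla s e (u, y)‖ ≤ ε / (2 * r) := by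
      refine (isCompact_closedBall _ _).eventually_forall_of_forall_eventually fun y hy ↦ ?_
      have hzt := hmem _ (Metric.mem_closedBall_self hr.le) y hy
      have h2 : fibrePhaseForm nabla s e ((e x₀).1, y) = 0 := by
        have h3 : pr (e.symm ((e x₀).1, y)) = b := by
          rw [he.pr_symm hzt, ← he.pr_symm hz, e.left_inv hxe, hx₀]
        rw [fibrePhaseForm, coordPhaseForm, hflat _ (heU (e.map_target hzt)).1 h3]
        exact (congrArg (fun T ↦ ContinuousLinearMap.comp T _)
          (ContinuousLinearMap.zero_comp _)).trans (ContinuousLinearMap.zero_comp _)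
      have h4 := (hJ.continuousAt (e.open_target.mem_nhds hzt)).norm
      have h5 : ‖fibrePhaseForm nabla s e ((e x₀).1, y)‖ < ε / (2 * r) := by
        rw [h2, norm_zero]
        positivity
      exact (h4.eventually (gt_mem_nhds h5)).mono fun z hz ↦ hz.le
    have hcc : ContinuousAt c b := c.continuousAt (mem_chart_source _ b)
    rw [← hcb] at h1
    have h6 : ∀ᶠ b' in 𝓝 b, c b' ∈ Metric.closedBall (e x₀).1 r :=
      hcc.eventually (by rw [hcb]; exact Metric.closedBall_mem_nhds _ hr)
    filter_upwards [hcc.eventually h1, h6] with b' hb' hb'r τ hτ hf x hx x' hx' hxb hx'b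
    have h7 : ∀ x ∈ e.source ∩ e ⁻¹' (Metric.ball (e x₀) r), pr x = b' →
        ∃ y ∈ Metric.closedBall (e x₀).2 r, x = e.symm (c b', y) := by
      intro x hx hxb
      refine ⟨(e x).2, ?_, ?_⟩
      · exact (show dist (e x).2 (e x₀).2 ≤ dist (e x) (e x₀) from le_max_right _ _).trans (le_of_lt hx.2)
      · rw [← hxb, ← he.fst_eq x hx.1, Prod.mk.eta, e.left_inv hx.1]
    obtain ⟨y, hy, rfl⟩ := h7 x hx.1 hxb
    obtain ⟨y', hy', rfl⟩ := h7 x' hx'.1 hx'b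
    refine (h.norm_phase_sub_le hpr.smooth he hs hτ (convex_closedBall (e x₀).2 r)
      (fun y hy ↦ ⟨hmem _ hb'r y hy, hs0 _ (e.map_target (hmem _ hb'r y hy)), ?_⟩) hb' hy hy').trans
      ?_
    · rintro _ rfl
      refine hf _ ?_
      rw [mem_preimage, mem_singleton_iff, he.pr_symm (hmem _ hb'r y hy),
        ← he.pr_symm (hmem _ hb'r y' hy'), hx'b]
    · have h8 : ‖y' - y‖ ≤ 2 * r := by
        rw [← dist_eq_norm]
        have := dist_triangle_right y' y (e x₀).2
        rw [Metric.mem_closedBall] at hy hy'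
        linarith
      calc ε / (2 * r) * ‖y' - y‖ ≤ ε / (2 * r) * (2 * r) := by gcongr
        _ = ε := by field_simp
  · refine h.im_eq_zero_of_isLocalMaxOn hpr.smooth he hs hτ hx.1.1 (hs0 x hx.1.1) hf (fun h0 ↦ hxb ?_)
      hmax
    have h1 := hx.2 h0
    rw [he.fst_eq x hx.1.1, ← hcb] at h1
    exact c.injOn (he.mem_source x hx.1.1) (mem_chart_source _ b) h1

end

/-! ### Surjectivity onto the circle, and isolation of fibres with flat sections -/

/-- An explicit supply of distinct points of the unit circle for the pigeonhole argument. -/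
lemma phase_natCast_add_I_injective : Function.Injective fun k : ℕ ↦ phase ((k : ℂ) + Complex.I) := by
  intro k l hkl
  have hne : ∀ k : ℕ, (k : ℂ) + Complex.I ≠ 0 := fun k h ↦ by
    have := congrArg Complex.im h
    simp at this
  have hn : ∀ k : ℕ, ‖(k : ℂ) + Complex.I‖ ≠ 0 := fun k ↦ norm_ne_zero_iff.2 (hne k)
  simp only [phase] at hkl
  have h1 := congrArg Complex.im hkl
  have h2 := congrArg Complex.re hkl
  rw [Complex.div_ofReal_im, Complex.div_ofReal_im] at h1
  rw [Complex.div_ofReal_re, Complex.div_ofReal_re] at h2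
  simp only [Complex.add_im, Complex.natCast_im, Complex.I_im, zero_add, Complex.add_re,
    Complex.natCast_re, Complex.I_re, add_zero] at h1 h2
  have h3 : ‖(k : ℂ) + Complex.I‖ = ‖(l : ℂ) + Complex.I‖ := by
    rw [div_eq_div_iff (hn k) (hn l)] at h1
    linarith
  rw [h3, div_left_inj' (hn l)] at h2
  exact_mod_cast h2

/-- If a function `G` with values in the unit circle on a nonempty compact set `K` is such that all
rotates `c * G` are real where their real part is maximal, then `G` is onto the unit circle. -/
lemma exists_eq_of_im_eq_zero_of_isMaxOn {X : Type*} [TopologicalSpace X] {K : Set X} {G : X → ℂ}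
    (hK : IsCompact K) (hne : K.Nonempty) (hG : ContinuousOn G K) (hG1 : ∀ x ∈ K, ‖G x‖ = 1)
    (hmax : ∀ x ∈ K, ∀ c : ℂ, IsMaxOn (fun y ↦ (c * G y).re) K x → (c * G x).im = 0)
    {w : ℂ} (hw : ‖w‖ = 1) : ∃ x ∈ K, G x = w := by
  have hww : w * (starRingEnd ℂ) w = 1 := by
    rw [Complex.mul_conj, Complex.normSq_eq_norm_sq, hw]
    simp
  have hc1 : ‖(starRingEnd ℂ) w‖ = 1 := by rw [Complex.norm_conj, hw]
  have hcont : ∀ c : ℂ, ContinuousOn (fun y ↦ (c * G y).re) K :=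
    fun c ↦ Complex.continuous_re.comp_continuousOn (continuousOn_const.mul hG)
  have hre : ∀ z : ℂ, ‖z‖ = 1 → z.im = 0 → z = 1 ∨ z = -1 := by
    intro z hz hi
    have h1 : z = (z.re : ℂ) := Complex.ext rfl (by simpa using hi)
    rw [h1, Complex.norm_real, Real.norm_eq_abs] at hz
    rcases eq_or_eq_neg_of_abs_eq hz with h2 | h2
    · left; rw [h1, h2]; simp
    · right; rw [h1, h2]; simp
  set c := (starRingEnd ℂ) w
  obtain ⟨x, hx, hxmax⟩ := hK.exists_isMaxOn hne (hcont c)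
  have hn : ∀ y ∈ K, ‖c * G y‖ = 1 := fun y hy ↦ by rw [norm_mul, hc1, hG1 y hy, one_mul]
  rcases hre _ (hn x hx) (hmax x hx c hxmax) with h1 | h1
  · refine ⟨x, hx, ?_⟩
    calc G x = w * c * G x := by rw [hww, one_mul]
      _ = w := by rw [mul_assoc, h1, mul_one]
  · exfalso
    -- If the maximal real part is `-1`, then `c * G` is constant. Its rotation by `i` is then
    -- purely imaginary everywhere, in particular at its maximum, contrary to the hypothesis.
    have h2 : ∀ y ∈ K, c * G y = -1 := by
      intro y hy
      have h3 : (c * G y).re ≤ (c * G x).re := hxmax hy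
      rw [h1] at h3
      have h4 : (c * G y).re = -1 :=
        le_antisymm (by simpa using h3) (by
          have := Complex.abs_re_le_norm (c * G y)
          rw [hn y hy] at this
          exact (abs_le.1 this).1)
      have h5 := Complex.sq_norm (c * G y)
      rw [hn y hy, Complex.normSq_apply, h4] at h5
      have h6 : (c * G y).im = 0 := by nlinarith
      exact Complex.ext (by simpa using h4) (by simpa using h6)
    obtain ⟨y, hy, hymax⟩ := hK.exists_isMaxOn hne (hcont (Complex.I * c))
    have h3 := hmax y hy _ hymax
    rw [mul_assoc, h2 y hy] at h3
    simp at h3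

section
variable {n : ℕ} {M : Type*} [TopologicalSpace M] [T2Space M] [SecondCountableTopology M]
  [ChartedSpace (EuclideanSpace ℝ (Fin (2 * n))) M] [IsManifold (𝓡 (2 * n)) ∞ M]
  {B : Type*} [TopologicalSpace B] [T2Space B] [ChartedSpace (EuclideanSpace ℝ (Fin n)) B]
  [IsManifold (𝓡 n) ∞ B]
  {L : M → Type*} [TopologicalSpace (TotalSpace ℂ L)]
  [∀ x, NormedAddCommGroup (L x)] [∀ x, InnerProductSpace ℂ (L x)]
  [FiberBundle ℂ L] [VectorBundle ℂ ℂ L] [VectorBundle ℝ ℂ L]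
  [ContMDiffVectorBundle ∞ ℂ L (𝓡 (2 * n))]
  {Ω : Π x : M, TSpace (2 * n) x →L[ℝ] TSpace (2 * n) x →L[ℝ] ℝ}
  {nabla : CovariantDerivative (𝓡 (2 * n)) ℂ L} {pr : M → B} {b : B}

/-- If `L` has a flat section over a compact relatively open part `C` of a fibre, consisting of
regular points, then it has no flat section over the other fibres nearby. -/
lemma IsPrequantization.eventually_not_isPhaseFlatOn (h : IsPrequantization Ω nabla)
    (hΩ : IsSymplecticForm Ω) (hpr : IsLagrangianFibration Ω pr) {C O : Set M}
    (hC : IsCompact C) (hCne : C.Nonempty) (hO : IsOpen O) (hCO : C = pr ⁻¹' {b} ∩ O)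
    (hCreg : ∀ x ∈ C, IsRegularPt (m := 2 * n) (n := n) pr x)
    {σ : Π x : M, L x} (hσ : IsSmoothSection (m := 2 * n) σ) (hf : IsPhaseFlatOn nabla pr σ C) :
    ∀ᶠ b' in 𝓝[≠] b, ∀ τ : Π x : M, L x, IsSmoothSection (m := 2 * n) τ →
      ¬ IsPhaseFlatOn nabla pr τ (pr ⁻¹' {b'}) := by
  have : LocallyCompactSpace M :=
    ChartedSpace.locallyCompactSpace (EuclideanSpace ℝ (Fin (2 * n))) M
  have hCb : ∀ x ∈ C, pr x = b := fun x hx ↦ by rw [hCO] at hx; exact hx.1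
  have hCsub : C ⊆ O := by rw [hCO]; exact inter_subset_right
  obtain ⟨s, hs, hsC⟩ := h.exists_phaseForm_eq_zero hpr.smooth hC.isClosed hCb hCreg hσ hf
  have hflat : ∀ x ∈ O, pr x = b → phaseForm nabla s x = 0 :=
    fun x hx hxb ↦ (hsC x (by rw [hCO]; exact ⟨hxb, hx⟩)).2
  choose! U hU hUs hUosc hUmax using fun x (hx : x ∈ C) ↦
    h.exists_nhds_phase hΩ hpr hs (hCb x hx) (hCreg x hx) (hsC x hx).1 hO (hCsub hx) hflat
  obtain ⟨t, htC, htU⟩ := hC.elim_nhds_subcover (fun x ↦ interior (U x))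
    (fun x hx ↦ interior_mem_nhds.2 (hU x hx))
  have hVo : IsOpen ((⋃ x ∈ t, interior (U x)) ∩ O) :=
    (isOpen_biUnion fun x _ ↦ isOpen_interior).inter hO
  -- `C` need not be a whole fibre, so nearby fibres are cut off by a compact neighbourhood `K` of
  -- `C`.
  obtain ⟨K, hK, hCK, hKV⟩ := exists_compact_between hC hVo (subset_inter htU hCsub)
  have hKU : ∀ x ∈ K, ∃ i ∈ t, x ∈ U i := fun x hx ↦ by
    obtain ⟨i, hi, hxi⟩ := mem_iUnion₂.1 (hKV hx).1
    exact ⟨i, hi, interior_subset hxi⟩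
  obtain ⟨x₁, hx₁⟩ := hCne
  have hev1 : ∀ᶠ b' in 𝓝 b, b' ∈ pr '' interior K := by
    obtain ⟨e, he, hxe, -⟩ := exists_isFibredCoord hpr.smooth (hCb x₁ hx₁) (hCreg x₁ hx₁)
      isOpen_univ (mem_univ x₁)
    rw [← hCb x₁ hx₁, ← he.map_nhds hxe]
    exact image_mem_map (isOpen_interior.mem_nhds (hCK hx₁))
  -- The fibre over `b` meets `K` only in `C`, which lies in the interior. So nearby fibres miss the
  -- frontier of `K`, and a maximum on the part inside `K` is a local maximum on the fibre.
  have hev2 : ∀ᶠ b' in 𝓝 b, b' ∉ pr '' frontier K := by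
    have h1 : IsCompact (frontier K) :=
      hK.of_isClosed_subset isClosed_frontier hK.isClosed.frontier_subset
    refine (h1.image hpr.smooth.continuous).isClosed.isOpen_compl.mem_nhds ?_
    rintro ⟨x, hx, hxb⟩
    have h2 : x ∈ C := by
      rw [hCO]
      exact ⟨hxb, (hKV (hK.isClosed.frontier_subset hx)).2⟩
    exact hx.2 (hCK h2)
  let P : ℕ → ℂ := fun k ↦ phase ((k : ℂ) + Complex.I)
  have hP : ∀ k, ‖P k‖ = 1 := fun k ↦ norm_phase fun h ↦ by
    have := congrArg Complex.im h
    simp at this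
  -- There is one test point more than there are covering sets, and on each set the oscillation is
  -- at most half of any distance between two test points.
  have hev3 : ∀ᶠ b' in 𝓝 b, ∀ i ∈ t, ∀ k ∈ Finset.range (t.card + 1),
      ∀ l ∈ Finset.range (t.card + 1), k ≠ l → ∀ τ : Π x : M, L x,
      IsSmoothSection (m := 2 * n) τ → IsPhaseFlatOn nabla pr τ (pr ⁻¹' {b'}) → ∀ x ∈ U i,
      ∀ x' ∈ U i, pr x = b' → pr x' = b' →
      ‖phase (inner ℂ (s x') (τ x')) - phase (inner ℂ (s x) (τ x))‖ ≤ ‖P k - P l‖ / 2 := by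
    rw [Finset.eventually_all]
    intro i hi
    rw [Finset.eventually_all]
    intro k _
    rw [Finset.eventually_all]
    intro l _
    by_cases hkl : k = l
    · exact Eventually.of_forall fun _ h ↦ (h hkl).elim
    · have h1 : 0 < ‖P k - P l‖ :=
        norm_sub_pos_iff.2 fun h ↦ hkl (phase_natCast_add_I_injective h)
      exact (hUosc i (htC i hi) _ (half_pos h1)).mono fun b' h _ ↦ h
  filter_upwards [eventually_nhdsWithin_of_eventually_nhds hev1,
    eventually_nhdsWithin_of_eventually_nhds hev2,
    eventually_nhdsWithin_of_eventually_nhds hev3, self_mem_nhdsWithin] with b' h1 h2 h3 hb' τ hτ hτf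
  have hKs : ∀ x ∈ K, s x ≠ 0 := fun x hx ↦ by
    obtain ⟨i, hi, hxi⟩ := hKU x hx
    exact hUs i (htC i hi) x hxi
  have hinner : ∀ x ∈ K ∩ pr ⁻¹' {b'}, (inner ℂ (s x) (τ x) : ℂ) ≠ 0 :=
    fun x hx ↦ inner_ne_zero_of_ne_zero (hKs x hx.1) (hτf x hx.2).1
  have hsurj : ∀ w : ℂ, ‖w‖ = 1 → ∃ x ∈ K ∩ pr ⁻¹' {b'}, phase (inner ℂ (s x) (τ x)) = w := by
    intro w hw
    refine exists_eq_of_im_eq_zero_of_isMaxOn (G := fun x ↦ phase (inner ℂ (s x) (τ x)))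
      (hK.inter_right (isClosed_singleton.preimage hpr.smooth.continuous))
      ?_ (fun x hx ↦ ?_) (fun x hx ↦ norm_phase (hinner x hx)) (fun x hx c hmax ↦ ?_) hw
    · obtain ⟨x, hx, hxb⟩ := h1
      exact ⟨x, interior_subset hx, hxb⟩
    · exact (ContinuousAt.comp (f := fun x ↦ inner ℂ (s x) (τ x)) (continuousAt_phase (hinner x hx))
        ((h.metric_smooth s τ hs hτ).continuous.continuousAt)).continuousWithinAt
    · obtain ⟨i, hi, hxi⟩ := hKU x hx.1
      have hxb : pr x = b' := hx.2
      have hxK : K ∈ 𝓝 x := by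
        by_contra hxK
        exact h2 ⟨x, ⟨subset_closure hx.1, fun h ↦ hxK (mem_interior_iff_mem_nhds.1 h)⟩, hxb⟩
      refine hUmax i (htC i hi) x hxi (by rw [hxb]; exact hb') τ hτ (by rw [hxb]; exact hτf) c ?_
      rw [hxb]
      refine Filter.Eventually.mono (inter_mem_nhdsWithin (pr ⁻¹' {b'}) hxK) fun y hy ↦ ?_
      exact hmax ⟨hy.2, hy.1⟩
  -- All test values are attained, two of them in the same covering set, against the bound on the
  -- oscillation.
  choose! X hX hXP using fun k ↦ hsurj (P k) (hP k)
  choose I hI hXI using fun k ↦ hKU (X k) (hX k).1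
  obtain ⟨k, hk, l, hl, hkl, hIkl⟩ := Finset.exists_ne_map_eq_of_card_lt_of_maps_to
    (s := Finset.range (t.card + 1)) (t := t) (by simp) (f := I) (fun k _ ↦ hI k)
  have h4 := h3 (I k) (hI k) k hk l hl hkl τ hτ hτf (X l) (by rw [hIkl]; exact hXI l) (X k) (hXI k)
    (hX l).2 (hX k).2
  rw [hXP, hXP] at h4
  have h5 : 0 < ‖P k - P l‖ :=
    norm_sub_pos_iff.2 fun h ↦ hkl (phase_natCast_add_I_injective h)
  linarith

end

/-! ### Limits of flat sections along an ultrafilter of fibres -/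

lemma phase_of_norm_eq_one {w : ℂ} (hw : ‖w‖ = 1) : phase w = w := by
  simp [phase, hw]

lemma norm_mul_phase {w : ℂ} (hw : w ≠ 0) : (‖w‖ : ℂ) * phase w = w :=
  mul_div_cancel₀ _ (by exact_mod_cast norm_ne_zero_iff.2 hw)

/-- The nonzero complex numbers of a given phase form a convex set. -/
lemma phase_add_eq {v w : ℂ} (hv : v ≠ 0) (hw : w ≠ 0) (hvw : phase v = phase w) {a b : ℝ}
    (ha : 0 ≤ a) (hb : 0 ≤ b) (hab : a + b = 1) :
    (a : ℂ) * v + b * w ≠ 0 ∧ phase (a * v + b * w) = phase v := by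
  have hc : 0 < a * ‖v‖ + b * ‖w‖ := by
    have h1 := norm_pos_iff.2 hv
    have h2 := norm_pos_iff.2 hw
    rcases ha.eq_or_lt with rfl | ha
    · have : b = 1 := by linarith
      rw [this]
      linarith
    · have := mul_pos ha h1
      have := mul_nonneg hb h2.le
      linarith
  have h1 : (a : ℂ) * v + b * w = ((a * ‖v‖ + b * ‖w‖ : ℝ) : ℂ) * phase v := by
    conv_lhs => rw [← norm_mul_phase hv, ← norm_mul_phase hw, ← hvw]
    push_cast
    ring
  have h2 := norm_phase hv
  rw [h1, phase_real_mul hc, phase_of_norm_eq_one h2]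
  refine ⟨mul_ne_zero (by exact_mod_cast hc.ne') fun h ↦ ?_, rfl⟩
  rw [h, norm_zero] at h2
  exact zero_ne_one h2

section
variable {n : ℕ} {M : Type*} [TopologicalSpace M]
  [ChartedSpace (EuclideanSpace ℝ (Fin (2 * n))) M]
  {B : Type*}
  {L : M → Type*} [TopologicalSpace (TotalSpace ℂ L)]
  [∀ x, NormedAddCommGroup (L x)] [∀ x, InnerProductSpace ℂ (L x)]
  [FiberBundle ℂ L]
  {Ω : Π x : M, TSpace (2 * n) x →L[ℝ] TSpace (2 * n) x →L[ℝ] ℝ}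
  {nabla : CovariantDerivative (𝓡 (2 * n)) ℂ L} {pr : M → B} {b : B}
  {l : Filter B} {τ : B → Π x : M, L x}
  {e : OpenPartialHomeomorph M (EuclideanSpace ℝ (Fin n) × EuclideanSpace ℝ (Fin n))}

/-- `v ∈ L x` points in the limit direction of the values of the sections `τ b'`, taken over the fibres
over `b'`, as `b'` tends to `pr x` along `l`. -/
def IsPhaseLimit (m : ℕ) [ChartedSpace (EuclideanSpace ℝ (Fin m)) M] (pr : M → B) (l : Filter B)
    (τ : B → Π x : M, L x) (x : M) (v : L x) : Prop :=
  v ≠ 0 ∧ ∀ s : Π x : M, L x, IsSmoothSection (m := m) s → s x ≠ 0 →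
    Tendsto (fun x' ↦ phase (inner ℂ (s x') (τ (pr x') x'))) (𝓝 x ⊓ comap pr l)
      (𝓝 (phase (inner ℂ (s x) v)))

variable [VectorBundle ℂ ℂ L] [VectorBundle ℝ ℂ L] [IsManifold (𝓡 (2 * n)) ∞ M]
  [ContMDiffVectorBundle ∞ ℂ L (𝓡 (2 * n))] [T2Space M]

/-- Uniqueness of limits makes two phase limits have equal phase relative to `s`, so all of them lie
on one open ray. Convexity allows gluing local limits by a partition of unity. -/
lemma convex_setOf_isPhaseLimit {x : M} [(𝓝 x ⊓ comap pr l).NeBot] :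
    Convex ℝ {v : L x | IsPhaseLimit (2 * n) pr l τ x v} := by
  rintro v ⟨hv, hvl⟩ w ⟨hw, hwl⟩ a b ha hb hab
  have key : ∀ s : Π x : M, L x, IsSmoothSection (m := 2 * n) s → s x ≠ 0 →
      (inner ℂ (s x) (a • v + b • w) : ℂ) ≠ 0 ∧
      phase (inner ℂ (s x) (a • v + b • w)) = phase (inner ℂ (s x) v) := by
    intro s hs hsx
    have h1 := tendsto_nhds_unique (hvl s hs hsx) (hwl s hs hsx)
    have h2 : (inner ℂ (s x) (a • v + b • w) : ℂ)
        = a * inner ℂ (s x) v + b * inner ℂ (s x) w := by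
      rw [inner_add_right, ← Complex.coe_smul, ← Complex.coe_smul, inner_smul_right,
        inner_smul_right]
    rw [h2]
    exact phase_add_eq (inner_ne_zero_of_ne_zero hsx hv) (inner_ne_zero_of_ne_zero hsx hw) h1
      ha hb hab
  refine ⟨fun h0 ↦ ?_, fun s hs hsx ↦ ?_⟩
  · obtain ⟨s, hs, hsx⟩ := exists_isSmoothSection_ne_zero (m := 2 * n) (L := L) x
    have h1 := (key s hs hsx).1
    rw [h0, inner_zero_right] at h1
    exact h1 rfl
  · rw [(key s hs hsx).2]
    exact hvl s hs hsx

variable [TopologicalSpace B] [ChartedSpace (EuclideanSpace ℝ (Fin n)) B] [IsManifold (𝓡 n) ∞ B]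

/-- Flat sections over fibres converging to the fibre over `b` have, locally, a limit: it is given by a
solution `G` of `dG = -i J G`, and is smooth. -/
lemma IsPrequantization.exists_local_isPhaseLimit {U : Ultrafilter B}
    (h : IsPrequantization Ω nabla) (hpr : ContMDiff (𝓡 (2 * n)) (𝓡 n) ∞ pr)
    (hUb : (U : Filter B) ≤ 𝓝 b)
    (hτ : ∀ᶠ b' in U, IsSmoothSection (m := 2 * n) (τ b') ∧
      IsPhaseFlatOn nabla pr (τ b') (pr ⁻¹' {b'}))
    {x₀ : M} (hx₀ : pr x₀ = b) (hreg : IsRegularPt (m := 2 * n) (n := n) pr x₀)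
    {O : Set M} (hO : IsOpen O) (hxO : x₀ ∈ O) :
    ∃ e : OpenPartialHomeomorph M (EuclideanSpace ℝ (Fin n) × EuclideanSpace ℝ (Fin n)),
      IsFibredCoord pr b e ∧ x₀ ∈ e.source ∧ e.source ⊆ O ∧
      ∃ s : Π x : M, L x, IsSmoothSection (m := 2 * n) s ∧ (∀ x ∈ e.source, s x ≠ 0) ∧
      ∃ W ∈ 𝓝 x₀, W ⊆ e.source ∧ ∃ G : EuclideanSpace ℝ (Fin n) → ℂ,
        ContMDiffOn (𝓡 (2 * n)) 𝓘(ℝ, ℂ) ∞ (fun x ↦ G (e x).2) W ∧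
        ∀ x ∈ W, pr x = b → ‖G (e x).2‖ = 1 ∧
          HasFDerivAt G ((fibrePhaseForm nabla s e (e x)).smulRight (-Complex.I * G (e x).2))
            (e x).2 ∧
          IsPhaseLimit (2 * n) pr U τ x (G (e x).2 • s x) := by
  obtain ⟨s, hs, hsx₀⟩ := exists_isSmoothSection_ne_zero (m := 2 * n) (L := L) x₀
  obtain ⟨e, he, hxe, heU⟩ := exists_isFibredCoord hpr hx₀ hreg
    (hO.inter (h.isOpen_ne_zero hs)) ⟨hxO, hsx₀⟩
  have hs0 : ∀ x ∈ e.source, s x ≠ 0 := fun x hx ↦ (heU hx).2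
  have hz := e.map_source hxe
  obtain ⟨r, hr, hrt⟩ := Metric.nhds_basis_closedBall.mem_iff.1 (e.open_target.mem_nhds hz)
  have hJ := h.contDiffOn_fibrePhaseForm he hs hs0
  have hJr := hJ.mono hrt
  obtain ⟨K₁, hK₁⟩ := (isCompact_closedBall (e x₀) r).exists_bound_of_continuousOn hJr.continuousOn
  obtain ⟨K₂, hK₂⟩ := hJr.exists_lipschitzOnWith (by simp) (convex_closedBall _ _)
    (isCompact_closedBall _ _)
  set K : ℝ := max K₁ K₂
  set c := chartAt (EuclideanSpace ℝ (Fin n)) b with hc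
  have hcb : c b = (e x₀).1 := by rw [he.fst_eq _ hxe, hx₀]
  have hcc : ContinuousAt c b := c.continuousAt (mem_chart_source _ b)
  have hmem : ∀ u ∈ Metric.closedBall (e x₀).1 r, ∀ y ∈ Metric.ball (e x₀).2 r,
      (u, y) ∈ Metric.closedBall (e x₀) r := fun u hu y hy ↦ by
    rw [← Prod.mk.eta (p := e x₀), ← closedBall_prod_same]
    exact ⟨hu, Metric.ball_subset_closedBall hy⟩
  have hcbr : c b ∈ Metric.closedBall (e x₀).1 r := by
    rw [hcb]
    exact Metric.mem_closedBall_self hr.le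
  let g : B → EuclideanSpace ℝ (Fin n) → ℂ := fun b' y ↦
    phase (inner ℂ (s (e.symm (c b', y))) (τ b' (e.symm (c b', y))))
  have hev : ∀ᶠ b' in U, (IsSmoothSection (m := 2 * n) (τ b') ∧
      IsPhaseFlatOn nabla pr (τ b') (pr ⁻¹' {b'})) ∧ c b' ∈ Metric.closedBall (e x₀).1 r ∧
      b' ∈ c.source := by
    refine hτ.and (hUb ((hcc.eventually (by
      rw [hcb]; exact Metric.closedBall_mem_nhds _ hr)).and (chart_source_mem_nhds _ b)))
  have hg : ∀ᶠ b' in U, ∀ y ∈ Metric.ball (e x₀).2 r,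
      HasFDerivAt (g b') ((fibrePhaseForm nabla s e (c b', y)).smulRight (-Complex.I * g b' y)) y ∧
      ‖g b' y‖ = 1 ∧ ‖fibrePhaseForm nabla s e (c b', y)‖ ≤ K := by
    filter_upwards [hev] with b' hb' y hy
    have hzt := hmem _ hb'.2.1 y hy
    have hpb : pr (e.symm (c b', y)) = b' := by
      rw [he.pr_symm (hrt hzt), c.left_inv hb'.2.2]
    have hsz := hs0 _ (e.map_target (hrt hzt))
    refine ⟨h.hasFDerivAt_phase hpr he hs hb'.1.1 (hrt hzt) hsz ?_, ?_, ?_⟩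
    · rintro _ rfl
      exact hb'.1.2 _ hpb
    · exact norm_phase (inner_ne_zero_of_ne_zero hsz (hb'.1.2 _ hpb).1)
    · exact (hK₁ _ hzt).trans (le_max_left _ _)
  -- The unit circle is compact, so pointwise limits along an ultrafilter exist without passing to
  -- subsequences.
  have hGex : ∀ y ∈ Metric.ball (e x₀).2 r, ∃ w : ℂ, ‖w‖ = 1 ∧
      Tendsto (fun b' ↦ g b' y) U (𝓝 w) := by
    intro y hy
    have h1 : ∀ᶠ b' in U, g b' y ∈ Metric.sphere (0 : ℂ) 1 := by
      filter_upwards [hg] with b' hb'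
      simpa using (hb' y hy).2.1
    obtain ⟨w, hw, hUw⟩ := (isCompact_sphere (0 : ℂ) 1).ultrafilter_le_nhds'
      (U.map fun b' ↦ g b' y) h1
    exact ⟨w, by simpa using hw, hUw⟩
  choose! G hG1 hG using hGex
  have hderiv : ∀ y ∈ Metric.ball (e x₀).2 r, HasFDerivAt G
      ((fibrePhaseForm nabla s e (c b, y)).smulRight (-Complex.I * G y)) y := by
    intro y hy
    refine hasFDerivAt_of_tendsto_solutions (l := (U : Filter B)) (g := g)
      (J := fun b' y ↦ fibrePhaseForm nabla s e (c b', y))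
      (J₀ := fun y ↦ fibrePhaseForm nabla s e (c b, y)) (K := K)
      Metric.isOpen_ball (convex_ball _ _) ?_ ?_ hG ?_ hy
    · filter_upwards [hg] with b' hb' y hy
      exact ⟨(hb' y hy).1, (hb' y hy).2.1.le, (hb' y hy).2.2⟩
    · filter_upwards [hev] with b' hb' y hy y' hy'
      have h1 := hK₂.dist_le_mul _ (hmem _ hb'.2.1 y hy) _ (hmem _ hb'.2.1 y' hy')
      rw [dist_eq_norm, dist_eq_norm, Prod.mk_sub_mk, sub_self] at h1
      have h2 : ‖((0 : EuclideanSpace ℝ (Fin n)), y - y')‖ = ‖y - y'‖ := by simp [Prod.norm_def]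
      rw [h2] at h1
      refine h1.trans ?_
      gcongr
      exact le_max_right _ _
    · intro y hy
      have h1 : ContinuousAt (fibrePhaseForm nabla s e) (c b, y) :=
        hJ.continuousOn.continuousAt (e.open_target.mem_nhds (hrt (hmem _ hcbr y hy)))
      have h2 : Tendsto (fun b' ↦ (c b', y)) (U : Filter B) (𝓝 (c b, y)) :=
        (hcc.tendsto.mono_left hUb).prodMk_nhds tendsto_const_nhds
      exact h1.tendsto.comp h2
  have hGs : ContDiffOn ℝ ∞ G (Metric.ball (e x₀).2 r) := by
    refine contDiffOn_of_hasFDerivAt_smulRight Metric.isOpen_ball ?_ hderiv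
    exact hJ.comp (contDiff_prodMk_right (c b)).contDiffOn
      fun y hy ↦ hrt (hmem _ hcbr y hy)
  set W := e.source ∩ e ⁻¹' (Metric.ball (e x₀) r)
  have hW2 : ∀ x ∈ W, (e x).2 ∈ Metric.ball (e x₀).2 r := fun x hx ↦
    (show dist (e x).2 (e x₀).2 ≤ dist (e x) (e x₀) from le_max_right _ _).trans_lt hx.2
  have hWo : IsOpen W := e.isOpen_inter_preimage Metric.isOpen_ball
  refine ⟨e, he, hxe, fun x hx ↦ (heU hx).1, s, hs, hs0, W,
    hWo.mem_nhds ⟨hxe, Metric.mem_ball_self hr⟩, inter_subset_left, G, ?_, ?_⟩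
  · have h1 : ContMDiffOn (𝓡 (2 * n)) 𝓘(ℝ, EuclideanSpace ℝ (Fin n)) ∞ (fun x ↦ (e x).2) W :=
      contDiff_snd.contMDiff.comp_contMDiffOn (he.coord.contMDiffOn.mono inter_subset_left)
    exact hGs.contMDiffOn.comp h1 hW2
  · intro x hx hxb
    have hx2 := hW2 x hx
    have hex : e x = (c b, (e x).2) := by rw [← hxb, ← he.fst_eq x hx.1]
    have hGx := hG1 _ hx2
    have hsx := hs0 x hx.1
    have hGne : G (e x).2 ≠ 0 := fun h0 ↦ by rw [h0, norm_zero] at hGx; exact zero_ne_one hGx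
    refine ⟨hGx, by rw [hex]; exact hderiv _ hx2, smul_ne_zero hGne hsx, fun s' hs' hs'x ↦ ?_⟩
    have hW' : ∀ᶠ x' in 𝓝 x ⊓ comap pr U, x' ∈ W := mem_inf_of_left (hWo.mem_nhds hx)
    have hprU : Tendsto pr (𝓝 x ⊓ comap pr U) U := tendsto_comap.mono_left inf_le_right
    have hlim : Tendsto (fun x' ↦ phase (inner ℂ (s x') (τ (pr x') x'))) (𝓝 x ⊓ comap pr U)
        (𝓝 (G (e x).2)) := by
      -- The phase at `x'` is compared with the phase on the same fibre at the fibre coordinate of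
      -- `x`. The latter converges by the choice of `G`, and the difference is at most `K` times the
      -- difference of fibre coordinates.
      have h1 : Tendsto (fun x' ↦ g (pr x') (e x).2) (𝓝 x ⊓ comap pr U) (𝓝 (G (e x).2)) :=
        (hG _ hx2).comp hprU
      have h2 : Tendsto (fun x' ↦ K * ‖(e x').2 - (e x).2‖) (𝓝 x ⊓ comap pr U) (𝓝 0) := by
        have h3 : ContinuousAt (fun x' ↦ K * ‖(e x').2 - (e x).2‖) x := by
          have := e.continuousAt hx.1
          fun_prop
        have h4 := h3.tendsto.mono_left (inf_le_left (b := comap pr (U : Filter B)))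
        simpa using h4
      have h3 : Tendsto (fun x' ↦ phase (inner ℂ (s x') (τ (pr x') x')) - g (pr x') (e x).2)
          (𝓝 x ⊓ comap pr U) (𝓝 0) := by
        refine squeeze_zero_norm' ?_ h2
        filter_upwards [hW', hprU.eventually hev, hprU.eventually hg] with x' hx'W hx'e hx'g
        have h4 : e x' = (c (pr x'), (e x').2) := by rw [← he.fst_eq x' hx'W.1]
        have h5 : phase (inner ℂ (s x') (τ (pr x') x')) = g (pr x') (e x').2 := by
          simp only [g]
          rw [← h4, e.left_inv hx'W.1]
        rw [h5]
        refine (convex_ball (e x₀).2 r).norm_image_sub_le_of_norm_hasFDerivWithin_le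
          (fun y hy ↦ (hx'g y hy).1.hasFDerivWithinAt) (fun y hy ↦ ?_) hx2 (hW2 x' hx'W)
        rw [ContinuousLinearMap.norm_smulRight_apply, norm_mul, norm_neg, Complex.norm_I, one_mul,
          (hx'g y hy).2.1, mul_one]
        exact (hx'g y hy).2.2
      simpa using h3.add h1
    have hs's : ContinuousAt (fun x ↦ phase (inner ℂ (s' x) (s x))) x :=
      ContinuousAt.comp (f := fun x ↦ inner ℂ (s' x) (s x))
        (continuousAt_phase (inner_ne_zero_of_ne_zero hs'x hsx))
        (h.metric_smooth s' s hs' hs).continuous.continuousAt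
    -- Change of reference section: `⟨s', s⟩ ⟨s, τ⟩ = |s|² ⟨s', τ⟩`, and the positive factor does
    -- not affect the phase.
    have h6 := (hs's.tendsto.mono_left (inf_le_left (b := comap pr (U : Filter B)))).mul hlim
    rw [inner_smul_right, mul_comm, phase_mul, phase_of_norm_eq_one hGx]
    refine h6.congr' ?_
    filter_upwards [hW'] with x' hx'
    rw [← phase_mul, inner_mul_inner, ← Complex.ofReal_pow, phase_real_mul]
    exact pow_pos (norm_pos_iff.2 (hs0 x' hx'.1)) 2

end

/-! ### Gluing the local limits -/

section
variable {n : ℕ} {M : Type*} [TopologicalSpace M]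
  [ChartedSpace (EuclideanSpace ℝ (Fin (2 * n))) M] [IsManifold (𝓡 (2 * n)) ∞ M]
  {B : Type*} [TopologicalSpace B] [ChartedSpace (EuclideanSpace ℝ (Fin n)) B]
  [IsManifold (𝓡 n) ∞ B]
  {L : M → Type*} [TopologicalSpace (TotalSpace ℂ L)]
  [∀ x, NormedAddCommGroup (L x)] [∀ x, InnerProductSpace ℂ (L x)]
  [FiberBundle ℂ L] [VectorBundle ℂ ℂ L] [VectorBundle ℝ ℂ L]
  [ContMDiffVectorBundle ∞ ℂ L (𝓡 (2 * n))]
  {Ω : Π x : M, TSpace (2 * n) x →L[ℝ] TSpace (2 * n) x →L[ℝ] ℝ}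
  {nabla : CovariantDerivative (𝓡 (2 * n)) ℂ L} {pr : M → B} {b : B}
  {τ : B → Π x : M, L x}
  {e : OpenPartialHomeomorph M (EuclideanSpace ℝ (Fin n) × EuclideanSpace ℝ (Fin n))}

/-- A section is flat along the fibres where its phase relative to `s` solves `dG = -i J G`. -/
lemma IsPrequantization.isPhaseFlatOn_of_hasFDerivAt (h : IsPrequantization Ω nabla)
    (hpr : ContMDiff (𝓡 (2 * n)) (𝓡 n) ∞ pr) (he : IsFibredCoord pr b e)
    {s σ : Π x : M, L x} (hs : IsSmoothSection (m := 2 * n) s) (hσ : IsSmoothSection (m := 2 * n) σ)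
    {x : M} (hx : x ∈ e.source) (hsx : s x ≠ 0) (hσx : σ x ≠ 0)
    {G : EuclideanSpace ℝ (Fin n) → ℂ}
    (hG : HasFDerivAt G ((fibrePhaseForm nabla s e (e x)).smulRight (-Complex.I * G (e x).2))
      (e x).2)
    (hGx : ∀ᶠ y in 𝓝 (e x).2, phase (inner ℂ (s (e.symm ((e x).1, y)))
      (σ (e.symm ((e x).1, y)))) = G y) : IsPhaseFlatOn nabla pr σ {x} := by
  obtain ⟨z, hz, rfl⟩ : ∃ z ∈ e.target, e.symm z = x := ⟨e x, e.map_source hx, e.left_inv hx⟩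
  rw [e.right_inv hz] at hG hGx
  rintro _ rfl
  refine ⟨hσx, fun v hv ↦ ?_⟩
  obtain ⟨η, rfl⟩ := he.exists_eq_coordFrame_of_vertical hpr hz hv
  have hi := inner_ne_zero_of_ne_zero hsx hσx
  have h1 := he.coord.hasFDerivAt_comp_symm hz (h.mdifferentiableAt_inner hs hσ (e.symm z))
  have h2 := h1.phase hi (θ := coordPhaseForm nabla σ e z - coordPhaseForm nabla s e z)
    (fun w ↦ (h.im_mvfderiv_inner_div hs hσ hsx hσx (coordFrame (2 * n) e z w)).symm)
  have h3 := HasFDerivAt.comp z.2 (f := fun y ↦ (z.1, y)) h2 (hasFDerivAt_prodMk_right z.1 z.2)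
  have h4 := (hG.congr_of_eventuallyEq hGx).unique h3
  have h5 := congrArg (fun T ↦ T η) h4
  simp only [ContinuousLinearMap.smulRight_apply, ContinuousLinearMap.comp_apply,
    ContinuousLinearMap.inr_apply, sub_apply, ← hGx.self_of_nhds,
    fibrePhaseForm] at h5
  have hp : phase (inner ℂ (s (e.symm z)) (σ (e.symm z))) ≠ 0 := fun h0 ↦ by
    have := norm_phase hi
    rw [h0, norm_zero] at this
    exact zero_ne_one this
  rw [neg_mul, smul_neg, ← neg_smul] at h5
  have h6 := smul_left_injective ℝ (mul_ne_zero Complex.I_ne_zero hp) h5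
  have h7 : coordPhaseForm nabla σ e z (0, η) = 0 := by linarith
  exact h7

variable [T2Space M] [SigmaCompactSpace M]

/-- A limit of fibres over which `L` has flat sections has this property as well: more precisely, there
is a flat section over each relatively open and closed subset of its set of regular points. -/
lemma IsPrequantization.exists_isPhaseFlatOn_of_ultrafilter {U : Ultrafilter B}
    (h : IsPrequantization Ω nabla) (hpr : ContMDiff (𝓡 (2 * n)) (𝓡 n) ∞ pr)
    (hUb : (U : Filter B) ≤ 𝓝 b)
    (hU : ∀ᶠ b' in U, ∃ τ : Π x : M, L x, IsSmoothSection (m := 2 * n) τ ∧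
      IsPhaseFlatOn nabla pr τ (pr ⁻¹' {b'}))
    {C O : Set M} (hC : IsClosed C) (hO : IsOpen O) (hCO : C = pr ⁻¹' {b} ∩ O)
    (hCreg : ∀ x ∈ C, IsRegularPt (m := 2 * n) (n := n) pr x) :
    ∃ σ : Π x : M, L x, IsSmoothSection (m := 2 * n) σ ∧ IsPhaseFlatOn nabla pr σ C := by
  obtain ⟨τ, hτ⟩ : ∃ τ : B → Π x : M, L x, ∀ᶠ b' in U, IsSmoothSection (m := 2 * n) (τ b') ∧
      IsPhaseFlatOn nabla pr (τ b') (pr ⁻¹' {b'}) := by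
    choose! τ hτ using fun (b' : B) (hb' : ∃ τ : Π x : M, L x, IsSmoothSection (m := 2 * n) τ ∧
      IsPhaseFlatOn nabla pr τ (pr ⁻¹' {b'})) ↦ hb'
    exact ⟨τ, by filter_upwards [hU] with b' hb' using hτ b' hb'⟩
  have hCb : ∀ x ∈ C, pr x = b := fun x hx ↦ by rw [hCO] at hx; exact hx.1
  have hCsub : C ⊆ O := by rw [hCO]; exact inter_subset_right
  -- Since `pr` is open at regular points, every neighbourhood of `x` meets the fibres selected by
  -- `U`. So limits along this filter are unique.
  have hne : ∀ x ∈ C, (𝓝 x ⊓ comap pr (U : Filter B)).NeBot := by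
    intro x hx
    obtain ⟨e, he, hxe, -⟩ := exists_isFibredCoord hpr (hCb x hx) (hCreg x hx) isOpen_univ
      (mem_univ x)
    rw [← map_neBot_iff pr, Filter.push_pull, he.map_nhds hxe, hCb x hx, inf_eq_right.2 hUb]
    exact U.neBot
  choose! e he hxe heO s hs hs0 W hW hWe G hGs hG using fun (x : M) (hx : x ∈ C) ↦
    h.exists_local_isPhaseLimit hpr hUb hτ (hCb x hx) (hCreg x hx) hO (hCsub hx)
  let t : ∀ x, Set (L x) := fun x ↦ {v | x ∈ C → IsPhaseLimit (2 * n) pr U τ x v}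
  have ht : ∀ x, Convex ℝ (t x) := by
    intro x v hv w hw a b ha hb hab hx
    have := hne x hx
    exact convex_setOf_isPhaseLimit (hv hx) (hw hx) ha hb hab
  obtain ⟨σ, hσ⟩ := exists_contMDiffSection_forall_mem_convex_of_local (𝓡 (2 * n)) (n := ⊤) L t ht
    (by
      intro x
      by_cases hx : x ∈ C
      · exact ⟨W x, hW x hx, fun y ↦ G x (e x hx y).2 • s x y,
          (hs x hx).contMDiffOn_smul (hGs x hx),
          fun y hy hyC ↦ (hG x hx y hy (hCb y hyC)).2.2⟩
      · refine ⟨Cᶜ, hC.isOpen_compl.mem_nhds hx, fun _ ↦ 0, ?_, fun y hy hyC ↦ (hy hyC).elim⟩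
        exact (contMDiff_zeroSection ℝ L).contMDiffOn)
  have hσs : IsSmoothSection (m := 2 * n) (fun x ↦ σ x) := σ.contMDiff
  refine ⟨fun x ↦ σ x, hσs, fun x hx ↦ ?_⟩
  have hex := (he x hx)
  have hz := (e x hx).map_source (hxe x hx)
  refine h.isPhaseFlatOn_of_hasFDerivAt hpr (he x hx) (hs x hx) hσs (hxe x hx)
    (hs0 x hx x (hxe x hx)) (hσ x hx).1
    (hG x hx x (mem_of_mem_nhds (hW x hx)) (hCb x hx)).2.1 ?_ x rfl
  have h1 : Tendsto (fun y ↦ (e x hx).symm ((e x hx x).1, y)) (𝓝 (e x hx x).2) (𝓝 x) := by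
    have h2 : ContinuousAt (e x hx).symm (e x hx x) := (e x hx).continuousAt_symm hz
    have h3 := h2.tendsto
    rw [(e x hx).left_inv (hxe x hx)] at h3
    exact h3.comp (Continuous.tendsto' (by fun_prop) _ _ rfl)
  have h2 : ∀ᶠ y in 𝓝 (e x hx x).2, ((e x hx x).1, y) ∈ (e x hx).target :=
    (Continuous.tendsto' (by fun_prop) _ _ rfl :
      Tendsto (fun y ↦ ((e x hx x).1, y)) (𝓝 (e x hx x).2) (𝓝 (e x hx x))).eventually
        ((e x hx).open_target.mem_nhds hz)
  filter_upwards [h1.eventually (hW x hx), h2] with y hyW hyt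
  set x' := (e x hx).symm ((e x hx x).1, y) with hx'
  have hx'e : x' ∈ (e x hx).source := (e x hx).map_target hyt
  have hx'b : pr x' = b := by
    rw [hx', hex.pr_symm hyt, ← hex.pr_symm hz, (e x hx).left_inv (hxe x hx), hCb x hx]
  have hx'C : x' ∈ C := by
    rw [hCO]
    exact ⟨hx'b, heO x hx hx'e⟩
  have hey : (e x hx x').2 = y := by rw [hx', (e x hx).right_inv hyt]
  have h3 := hG x hx x' hyW hx'b
  rw [hey] at h3
  have hsx' := hs0 x hx x' hx'e
  have := hne x' hx'C
  -- At every nearby point `x'` of `C`, both `σ` and the local solution represent the same limit.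
  -- Hence the phase of `σ` relative to the local section is `G` along the fibre, and `σ` inherits
  -- the flatness equation.
  have h4 := tendsto_nhds_unique ((hσ x' hx'C).2 _ (hs x hx) hsx') (h3.2.2.2 _ (hs x hx) hsx')
  have h5 : phase (((‖s x x'‖ ^ 2 : ℝ) : ℂ) * G x y) = G x y := by
    rw [phase_real_mul (pow_pos (norm_pos_iff.2 hsx') 2), phase_of_norm_eq_one h3.1]
  rw [Complex.ofReal_pow] at h5
  rw [h4, inner_smul_right, inner_self_eq_norm_sq_to_K, mul_comm]
  exact h5

end

/-! ### The standard potential and rotations of coordinate planes -/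

section
variable {n : ℕ}

/-- The potential `π ∑ (p_i dq_i - q_i dp_i)` of `2π ∑ dp_i ∧ dq_i`. -/
noncomputable def standardPotential (n : ℕ) : ((Fin n → ℝ) × (Fin n → ℝ)) →L[ℝ]
    ((Fin n → ℝ) × (Fin n → ℝ)) →L[ℝ] ℝ :=
  Real.pi • ∑ i, (((ContinuousLinearMap.proj i).comp (ContinuousLinearMap.snd ℝ _ _)).smulRight
      ((ContinuousLinearMap.proj (R := ℝ) (φ := fun _ : Fin n ↦ ℝ) i).comp
        (ContinuousLinearMap.fst ℝ _ (Fin n → ℝ))) -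
    ((ContinuousLinearMap.proj i).comp (ContinuousLinearMap.fst ℝ _ _)).smulRight
      ((ContinuousLinearMap.proj (R := ℝ) (φ := fun _ : Fin n ↦ ℝ) i).comp
        (ContinuousLinearMap.snd ℝ (Fin n → ℝ) _)))

lemma standardPotential_apply (z w : (Fin n → ℝ) × (Fin n → ℝ)) :
    standardPotential n z w = Real.pi * ∑ i, (z.2 i * w.1 i - z.1 i * w.2 i) := by
  simp only [standardPotential, smul_apply, sum_apply, sub_apply,
    ContinuousLinearMap.smulRight_apply, ContinuousLinearMap.comp_apply,
    ContinuousLinearMap.proj_apply, ContinuousLinearMap.coe_fst', ContinuousLinearMap.coe_snd',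
    smul_eq_mul]

lemma standardPotential_single (z : (Fin n → ℝ) × (Fin n → ℝ)) (i : Fin n) (α β : ℝ) :
    standardPotential n z (Pi.single i α, Pi.single i β)
      = Real.pi * (z.2 i * α - z.1 i * β) := by
  rw [standardPotential_apply]
  simp [Pi.single_apply, Finset.sum_sub_distrib]

/-- For a one-form with linear coefficients this antisymmetrization is the exterior derivative. -/
lemma standardPotential_sub_swap (v w : (Fin n → ℝ) × (Fin n → ℝ)) :
    standardPotential n v w - standardPotential n w v
      = 2 * Real.pi * ∑ i, (v.2 i * w.1 i - w.2 i * v.1 i) := by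
  rw [standardPotential_apply, standardPotential_apply, ← mul_sub, ← Finset.sum_sub_distrib,
    mul_comm 2 Real.pi, mul_assoc, Finset.mul_sum _ _ (2 : ℝ)]
  congr 1
  exact Finset.sum_congr rfl fun i _ ↦ by ring

/-- The rotation of the `i`-th coordinate plane by the angle `θ`. -/
noncomputable def planeRotation (i : Fin n) (z : (Fin n → ℝ) × (Fin n → ℝ)) (θ : ℝ) :
    (Fin n → ℝ) × (Fin n → ℝ) :=
  z + ((Real.cos θ - 1) • (Pi.single i (z.1 i), Pi.single i (z.2 i))
    + Real.sin θ • (Pi.single i (-z.2 i), Pi.single i (z.1 i)))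

/-- The velocity of `planeRotation`. -/
noncomputable def planeRotationVelocity (i : Fin n) (z : (Fin n → ℝ) × (Fin n → ℝ)) (θ : ℝ) :
    (Fin n → ℝ) × (Fin n → ℝ) :=
  (-Real.sin θ) • (Pi.single i (z.1 i), Pi.single i (z.2 i))
    + Real.cos θ • (Pi.single i (-z.2 i), Pi.single i (z.1 i))

lemma hasDerivAt_planeRotation (i : Fin n) (z : (Fin n → ℝ) × (Fin n → ℝ)) (θ : ℝ) :
    HasDerivAt (planeRotation i z) (planeRotationVelocity i z θ) θ :=
  ((((Real.hasDerivAt_cos θ).sub_const 1).smul_const _).add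
    ((Real.hasDerivAt_sin θ).smul_const _)).const_add z

lemma planeRotation_zero (i : Fin n) (z : (Fin n → ℝ) × (Fin n → ℝ)) :
    planeRotation i z 0 = z := by
  simp [planeRotation]

lemma planeRotation_two_pi (i : Fin n) (z : (Fin n → ℝ) × (Fin n → ℝ)) :
    planeRotation i z (2 * Real.pi) = z := by
  simp [planeRotation]

lemma planeRotation_fst (i j : Fin n) (z : (Fin n → ℝ) × (Fin n → ℝ)) (θ : ℝ) :
    (planeRotation i z θ).1 j =
      if j = i then z.1 i * Real.cos θ - z.2 i * Real.sin θ else z.1 j := by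
  by_cases h : j = i
  · subst h
    simp [planeRotation]
    ring
  · simp [planeRotation, h]

lemma planeRotation_snd (i j : Fin n) (z : (Fin n → ℝ) × (Fin n → ℝ)) (θ : ℝ) :
    (planeRotation i z θ).2 j =
      if j = i then z.1 i * Real.sin θ + z.2 i * Real.cos θ else z.2 j := by
  by_cases h : j = i
  · subst h
    simp [planeRotation]
    ring
  · simp [planeRotation, h]

/-- The value does not depend on the angle, so the potential integrates over a full turn to `-2π²`
times the squared radius. This is the holonomy exponent of the orbit. -/
lemma standardPotential_planeRotation (i : Fin n) (z : (Fin n → ℝ) × (Fin n → ℝ)) (θ : ℝ) :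
    standardPotential n (planeRotation i z θ) (planeRotationVelocity i z θ)
      = -(Real.pi * (z.1 i ^ 2 + z.2 i ^ 2)) := by
  rw [planeRotationVelocity, map_add, map_smul, map_smul, standardPotential_single,
    standardPotential_single, planeRotation_fst, planeRotation_snd, if_pos rfl, if_pos rfl,
    smul_eq_mul, smul_eq_mul]
  linear_combination (-(Real.pi * (z.1 i ^ 2 + z.2 i ^ 2))) * Real.sin_sq_add_cos_sq θ

/-- In the sup norm a rotation can enlarge a coordinate, but at most to the sum of the two rotated
ones. This accounts for the factor `2`. -/
lemma planeRotation_mem_ball {i : Fin n} {z z₀ : (Fin n → ℝ) × (Fin n → ℝ)} {r : ℝ}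
    (h1 : z₀.1 i = 0) (h2 : z₀.2 i = 0) (hz : z ∈ Metric.ball z₀ (r / 2)) (θ : ℝ) :
    planeRotation i z θ ∈ Metric.ball z₀ r := by
  have hr2 : 0 < r / 2 := dist_nonneg.trans_lt hz
  have hr : 0 < r := by linarith
  rw [mem_ball_iff_norm, Prod.norm_def, max_lt_iff, pi_norm_lt_iff hr2, pi_norm_lt_iff hr2] at hz
  have hq := hz.1 i
  have hp := hz.2 i
  simp only [Prod.fst_sub, Prod.snd_sub, Pi.sub_apply, h1, h2, sub_zero, Real.norm_eq_abs] at hq hp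
  have key : ∀ α β c s : ℝ, |α| < r / 2 → |β| < r / 2 → |c| ≤ 1 → |s| ≤ 1 → |α * c + β * s| < r := by
    intro α β c s hα hβ hc hs
    calc |α * c + β * s| ≤ |α * c| + |β * s| := abs_add_le _ _
      _ = |α| * |c| + |β| * |s| := by rw [abs_mul, abs_mul]
      _ ≤ |α| * 1 + |β| * 1 := by gcongr
      _ < r := by linarith
  rw [mem_ball_iff_norm, Prod.norm_def, max_lt_iff, pi_norm_lt_iff hr, pi_norm_lt_iff hr]
  constructor
  · intro j
    rw [Prod.fst_sub, Pi.sub_apply, planeRotation_fst]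
    split_ifs with hj
    · subst hj
      rw [h1, sub_zero, sub_eq_add_neg, ← neg_mul]
      exact key _ _ _ _ hq (by rwa [abs_neg]) (Real.abs_cos_le_one θ) (Real.abs_sin_le_one θ)
    · exact (hz.1 j).trans (by linarith)
  · intro j
    rw [Prod.snd_sub, Pi.sub_apply, planeRotation_snd]
    split_ifs with hj
    · subst hj
      rw [h2, sub_zero]
      exact key _ _ _ _ hq hp (Real.abs_sin_le_one θ) (Real.abs_cos_le_one θ)
    · exact (hz.2 j).trans (by linarith)

end

/-! ### Holonomy along small circles -/

section
variable {m n : ℕ} {M : Type*} [TopologicalSpace M] [T2Space M]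
  [ChartedSpace (EuclideanSpace ℝ (Fin m)) M] [IsManifold (𝓡 m) ∞ M]
  {L : M → Type*} [TopologicalSpace (TotalSpace ℂ L)]
  [∀ x, NormedAddCommGroup (L x)] [∀ x, InnerProductSpace ℂ (L x)]
  [FiberBundle ℂ L] [VectorBundle ℂ ℂ L] [VectorBundle ℝ ℂ L]
  [ContMDiffVectorBundle ∞ ℂ L (𝓡 m)]
  {Ω : Π x : M, TSpace m x →L[ℝ] TSpace m x →L[ℝ] ℝ}
  {nabla : CovariantDerivative (𝓡 m) ℂ L}
  {e : OpenPartialHomeomorph M ((Fin n → ℝ) × (Fin n → ℝ))}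

/-- In Darboux coordinates the phase form differs from the standard potential by an exact form. -/
lemma IsPrequantization.exists_hasFDerivAt_coordPhaseForm_sub (h : IsPrequantization Ω nabla)
    (he : IsSmoothCoord m e)
    (hΩ : ∀ z ∈ e.target, ∀ v w, Ω (e.symm z) (coordFrame m e z v) (coordFrame m e z w)
      = ∑ i, (v.2 i * w.1 i - w.2 i * v.1 i))
    {s : Π x : M, L x} (hs : IsSmoothSection (m := m) s) (hs0 : ∀ x ∈ e.source, s x ≠ 0)
    {S : Set ((Fin n → ℝ) × (Fin n → ℝ))} (hS : IsOpen S) (hSc : Convex ℝ S) (hSe : S ⊆ e.target) :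
    ∃ f : (Fin n → ℝ) × (Fin n → ℝ) → ℝ, ∀ z ∈ S,
      HasFDerivAt f (coordPhaseForm nabla s e z - standardPotential n z) z := by
  have hd : ∀ z ∈ S, DifferentiableAt ℝ (coordPhaseForm nabla s e) z := fun z hz ↦
    (((h.contDiffOn_coordPhaseForm he hs).mono
      fun z hz ↦ ⟨hz, hs0 _ (e.map_target hz)⟩).contDiffAt
        (e.open_target.mem_nhds (hSe hz))).differentiableAt (by simp)
  -- Poincaré lemma: both forms have exterior derivative `2π Ω`, so their difference is closed on a
  -- convex set.
  refine hSc.exists_forall_hasFDerivAt_of_fderiv_symmetric hS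
    (fun z hz ↦ ((hd z hz).sub
      (standardPotential n).differentiableAt).differentiableWithinAt) fun z hz v w ↦ ?_
  have h1 := (hd z hz).hasFDerivAt
  have h2 := h.fderiv_coordPhaseForm he hs (hSe hz) (hs0 _ (e.map_target (hSe hz))) h1 v w
  rw [hΩ z (hSe hz), ← standardPotential_sub_swap] at h2
  rw [(h1.fun_sub (standardPotential n).hasFDerivAt).fderiv]
  simp only [sub_apply]
  linarith

/-- A flat section along an orbit of the rotation of a coordinate plane in Darboux coordinates, sufficiently
close to the fixed points, exists only if the orbit is constant. -/
lemma IsPrequantization.eq_zero_of_flat_on_orbit (h : IsPrequantization Ω nabla)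
    (he : IsSmoothCoord m e)
    (hΩ : ∀ z ∈ e.target, ∀ v w, Ω (e.symm z) (coordFrame m e z v) (coordFrame m e z w)
      = ∑ i, (v.2 i * w.1 i - w.2 i * v.1 i))
    {s τ : Π x : M, L x} (hs : IsSmoothSection (m := m) s) (hs0 : ∀ x ∈ e.source, s x ≠ 0)
    (hτ : IsSmoothSection (m := m) τ)
    {z₀ : (Fin n → ℝ) × (Fin n → ℝ)} {r : ℝ} (hr : r ≤ 1 / 2) (hrt : Metric.ball z₀ r ⊆ e.target)
    {i : Fin n} (h1 : z₀.1 i = 0) (h2 : z₀.2 i = 0) {z : (Fin n → ℝ) × (Fin n → ℝ)}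
    (hz : z ∈ Metric.ball z₀ (r / 2))
    (hf : ∀ θ, τ (e.symm (planeRotation i z θ)) ≠ 0 ∧
      phaseForm nabla τ (e.symm (planeRotation i z θ))
        (coordFrame m e (planeRotation i z θ) (planeRotationVelocity i z θ)) = 0) :
    z.1 i = 0 ∧ z.2 i = 0 := by
  obtain ⟨f, hfd⟩ := h.exists_hasFDerivAt_coordPhaseForm_sub he hΩ hs hs0 Metric.isOpen_ball
    (convex_ball z₀ r) hrt
  set ρ : ℝ := z.1 i ^ 2 + z.2 i ^ 2 with hρ
  let F : ℝ → ℂ := fun θ ↦ inner ℂ (s (e.symm (planeRotation i z θ)))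
    (τ (e.symm (planeRotation i z θ)))
  have hmem := planeRotation_mem_ball h1 h2 hz
  have hF0 : ∀ θ, F θ ≠ 0 := fun θ ↦
    inner_ne_zero_of_ne_zero (hs0 _ (e.map_target (hrt (hmem θ)))) (hf θ).1
  have hphase : ∀ θ, HasDerivAt (fun θ ↦ phase (F θ))
      ((-coordPhaseForm nabla s e (planeRotation i z θ) (planeRotationVelocity i z θ) : ℝ)
        * (Complex.I * phase (F θ))) θ := by
    intro θ
    have hzt := hrt (hmem θ)
    have hsz := hs0 _ (e.map_target hzt)
    have h3 := (he.hasFDerivAt_comp_symm hzt (h.mdifferentiableAt_inner hs hτ _)).phase (hF0 θ)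
      (θ := coordPhaseForm nabla τ e (planeRotation i z θ)
        - coordPhaseForm nabla s e (planeRotation i z θ))
      (fun w ↦ (h.im_mvfderiv_inner_div hs hτ hsz (hf θ).1 (coordFrame m e _ w)).symm)
    have h4 := h3.comp_hasDerivAt θ (hasDerivAt_planeRotation i z θ)
    have h5 : coordPhaseForm nabla τ e (planeRotation i z θ) (planeRotationVelocity i z θ) = 0 :=
      (hf θ).2
    refine h4.congr_deriv ?_
    rw [ContinuousLinearMap.smulRight_apply, sub_apply, h5, zero_sub, Complex.real_smul]
  have hfθ : ∀ θ, HasDerivAt (fun θ ↦ f (planeRotation i z θ))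
      (coordPhaseForm nabla s e (planeRotation i z θ) (planeRotationVelocity i z θ)
        + Real.pi * ρ) θ := by
    intro θ
    have h3 := (hfd _ (hmem θ)).comp_hasDerivAt θ (hasDerivAt_planeRotation i z θ)
    refine h3.congr_deriv ?_
    rw [sub_apply, standardPotential_planeRotation, sub_neg_eq_add]
  -- `E` is an integrating factor: along the orbit it satisfies the equation inverse to that of
  -- `phase (F θ)`, so the product of the two is constant.
  let E : ℝ → ℂ := fun θ ↦ Complex.exp (Complex.I *
    ((f (planeRotation i z θ) - Real.pi * ρ * θ : ℝ) : ℂ))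
  have hE : ∀ θ, HasDerivAt E (E θ * (Complex.I *
      (coordPhaseForm nabla s e (planeRotation i z θ) (planeRotationVelocity i z θ) : ℝ))) θ := by
    intro θ
    have h3 : HasDerivAt (fun θ ↦ f (planeRotation i z θ) - Real.pi * ρ * θ)
        (coordPhaseForm nabla s e (planeRotation i z θ) (planeRotationVelocity i z θ)) θ := by
      refine ((hfθ θ).sub ((hasDerivAt_id θ).const_mul (Real.pi * ρ))).congr_deriv ?_
      ring
    exact (h3.ofReal_comp.const_mul Complex.I).cexp
  have hconst : ∀ θ, HasDerivAt (fun θ ↦ phase (F θ) * E θ) 0 θ := by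
    intro θ
    refine ((hphase θ).mul (hE θ)).congr_deriv ?_
    push_cast
    ring
  have h3 := is_const_of_deriv_eq_zero (fun θ ↦ (hconst θ).differentiableAt)
    (fun θ ↦ (hconst θ).deriv) 0 (2 * Real.pi)
  have hFF : F (2 * Real.pi) = F 0 :=
    congrArg (fun y ↦ (inner ℂ (s (e.symm y)) (τ (e.symm y)) : ℂ))
      ((planeRotation_two_pi i z).trans (planeRotation_zero i z).symm)
  have hp : phase (F 0) ≠ 0 := fun h0 ↦ by
    have := norm_phase (hF0 0)
    rw [h0, norm_zero] at this
    exact zero_ne_one this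
  rw [hFF] at h3
  -- After a full turn the phase and `f` return to their initial values, which leaves `exp (-2π² ρ
  -- i) = 1`. So `π ρ` is an integer.
  have h4 := mul_left_cancel₀ hp h3
  simp only [E, planeRotation_zero, planeRotation_two_pi] at h4
  obtain ⟨k, hk⟩ := Complex.exp_eq_exp_iff_exists_int.1 h4
  have h5 := congrArg Complex.im hk
  simp only [mul_zero, sub_zero, Complex.mul_im, Complex.I_re, Complex.I_im, Complex.ofReal_im,
    Complex.ofReal_re, Complex.add_im, zero_mul, one_mul, zero_add, Complex.mul_re,
    Complex.intCast_im, Complex.intCast_re, Complex.re_ofNat, Complex.im_ofNat, mul_one,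
    add_zero] at h5
  have hpi := Real.pi_pos
  have h6 : Real.pi * ρ = k := by
    have h7 : 2 * Real.pi * (Real.pi * ρ - k) = 0 := by linarith
    have := (mul_eq_zero.1 h7).resolve_left (by positivity)
    linarith
  have hr2 : 0 < r / 2 := dist_nonneg.trans_lt hz
  rw [mem_ball_iff_norm, Prod.norm_def, max_lt_iff, pi_norm_lt_iff hr2, pi_norm_lt_iff hr2] at hz
  have hq := hz.1 i
  have hp := hz.2 i
  simp only [Prod.fst_sub, Prod.snd_sub, Pi.sub_apply, h1, h2, sub_zero, Real.norm_eq_abs] at hq hp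
  -- Both coordinates are less than `r / 2 ≤ 1 / 4` in absolute value, so `ρ ≤ 1 / 8` and `π ρ < 1`.
  -- The integer is therefore `0`.
  have hq2 : z.1 i ^ 2 ≤ (1 / 4) ^ 2 := sq_le_sq' (by linarith [(abs_lt.1 hq).1])
    (by linarith [(abs_lt.1 hq).2])
  have hp2 : z.2 i ^ 2 ≤ (1 / 4) ^ 2 := sq_le_sq' (by linarith [(abs_lt.1 hp).1])
    (by linarith [(abs_lt.1 hp).2])
  have hρ0 : 0 ≤ ρ := by positivity
  have h8 : Real.pi * ρ < 1 := by
    have : ρ ≤ 1 / 8 := by linarith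
    have h9 := Real.pi_lt_four
    nlinarith
  have h9 : (k : ℝ) < 1 := by linarith
  have h10 : (0 : ℝ) ≤ k := by rw [← h6]; positivity
  have h11 : k = 0 := by
    have a1 : k < 1 := by exact_mod_cast h9
    have a2 : 0 ≤ k := by exact_mod_cast h10
    omega
  rw [h11, Int.cast_zero, mul_eq_zero] at h6
  have h12 := h6.resolve_left hpi.ne'
  have hq0 := sq_nonneg (z.1 i)
  have hp0 := sq_nonneg (z.2 i)
  exact ⟨pow_eq_zero_iff two_ne_zero |>.1 (by linarith),
    pow_eq_zero_iff two_ne_zero |>.1 (by linarith)⟩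

end

/-! ### Elliptic critical points -/

section
variable {m n : ℕ} {M : Type*} [TopologicalSpace M]
  [ChartedSpace (EuclideanSpace ℝ (Fin m)) M]
  {B : Type*} [TopologicalSpace B] [ChartedSpace (EuclideanSpace ℝ (Fin n)) B]
  {pr : M → B} {V W : Type*} [NormedAddCommGroup V] [NormedSpace ℝ V] [NormedAddCommGroup W]
  [NormedSpace ℝ W] {e : OpenPartialHomeomorph M V} {c : OpenPartialHomeomorph B W}

/-- Regularity of a point, read in coordinates. -/
lemma IsSmoothCoord.isRegularPt_iff (he : IsSmoothCoord m e) (hc : IsSmoothCoord n c) {z : V}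
    (hz : z ∈ e.target) (hpr : MDifferentiableAt (𝓡 m) (𝓡 n) pr (e.symm z))
    (hzc : pr (e.symm z) ∈ c.source) {T : V →L[ℝ] W}
    (hT : HasFDerivAt (fun z ↦ c (pr (e.symm z))) T z) :
    IsRegularPt (m := m) (n := n) pr (e.symm z) ↔ Function.Surjective T := by
  have h1 : ∀ w, T w = mfderiv (𝓡 n) 𝓘(ℝ, W) c (pr (e.symm z))
      (mfderiv (𝓡 m) (𝓡 n) pr (e.symm z) (coordFrame m e z w)) := by
    intro w
    have h2 := he.hasFDerivAt_comp_symm hz ((hc.mdifferentiableAt hzc).comp _ hpr)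
    have h3 : mvfderiv (𝓡 m) (c ∘ pr) (e.symm z) (coordFrame m e z w)
      = mfderiv (𝓡 n) 𝓘(ℝ, W) c (pr (e.symm z))
        (mfderiv (𝓡 m) (𝓡 n) pr (e.symm z) (coordFrame m e z w)) :=
      congrArg (fun T ↦ T (coordFrame m e z w))
        (mfderiv_comp (e.symm z) (hc.mdifferentiableAt hzc) hpr)
    exact (congrArg (fun T ↦ T w) (hT.unique h2)).trans h3
  constructor
  · intro h u
    obtain ⟨v, hv⟩ := h (mfderiv 𝓘(ℝ, W) (𝓡 n) c.symm (c (pr (e.symm z))) u)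
    obtain ⟨w, rfl⟩ := he.coordFrame_surjective hz v
    refine ⟨w, ?_⟩
    rw [h1, hv]
    exact hc.mfderiv_mfderiv_symm hzc u
  · intro h u
    obtain ⟨w, hw⟩ := h (mfderiv (𝓡 n) 𝓘(ℝ, W) c (pr (e.symm z)) u)
    refine ⟨coordFrame m e z w, ?_⟩
    rw [← hc.coordFrame_mfderiv hzc u, ← hw, h1, hc.coordFrame_mfderiv hzc]

end

section
variable {n : ℕ} {M : Type*} [TopologicalSpace M]
  [ChartedSpace (EuclideanSpace ℝ (Fin (2 * n))) M]
  {B : Type*} [TopologicalSpace B] [ChartedSpace (EuclideanSpace ℝ (Fin n)) B]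
  {Ω : Π x : M, TSpace (2 * n) x →L[ℝ] TSpace (2 * n) x →L[ℝ] ℝ}
  {pr : M → B} {K : Finset (Fin n)}
  {e : OpenPartialHomeomorph M ((Fin n → ℝ) × (Fin n → ℝ))}
  {ψ : OpenPartialHomeomorph B (EuclideanSpace ℝ (Fin n))}

/-- Darboux coordinates `e` on `M` and coordinates `ψ` on the base in which `pr` has elliptic
components for the indices in `K`. -/
structure IsToricCoord (Ω : Π x : M, TSpace (2 * n) x →L[ℝ] TSpace (2 * n) x →L[ℝ] ℝ) (pr : M → B)
    (K : Finset (Fin n)) (e : OpenPartialHomeomorph M ((Fin n → ℝ) × (Fin n → ℝ)))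
    (ψ : OpenPartialHomeomorph B (EuclideanSpace ℝ (Fin n))) : Prop where
  coord : IsSmoothCoord (2 * n) e
  base_coord : IsSmoothCoord n ψ
  mem_source : ∀ y ∈ e.source, pr y ∈ ψ.source
  eq_of_notMem : ∀ y ∈ e.source, ∀ i ∉ K, ψ (pr y) i = (e y).2 i
  eq_of_mem : ∀ y ∈ e.source, ∀ i ∈ K, ψ (pr y) i = ((e y).1 i ^ 2 + (e y).2 i ^ 2) / 2
  form_eq : ∀ z ∈ e.target, ∀ v w, Ω (e.symm z) (coordFrame (2 * n) e z v)
    (coordFrame (2 * n) e z w) = ∑ i, (v.2 i * w.1 i - w.2 i * v.1 i)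

/-- A vector annihilated by all `dq_i` and `dp_i` is in the radical of `Ω`. So nondegeneracy makes
the functions `q, p` coordinates by the inverse function theorem. -/
lemma IsToricAt.exists_isToricCoord [IsManifold (𝓡 (2 * n)) ∞ M] {x : M}
    (h : IsToricAt Ω pr x)
    (hnd : ∀ v : TSpace (2 * n) x, (∀ w : TSpace (2 * n) x, Ω x v w = 0) → v = 0)
    {O : Set M} (hO : IsOpen O) (hxO : x ∈ O) :
    ∃ (K : Finset (Fin n)) (e : OpenPartialHomeomorph M ((Fin n → ℝ) × (Fin n → ℝ)))
      (ψ : OpenPartialHomeomorph B (EuclideanSpace ℝ (Fin n))), IsToricCoord Ω pr K e ψ ∧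
      x ∈ e.source ∧ e.source ⊆ O ∧ ∀ i ∈ K, (e x).1 i = 0 ∧ (e x).2 i = 0 := by
  obtain ⟨U, q, p, K, ψ, hU, hxU, hq, hp, hΩ, hψ, hψs, hK, hK', hKx⟩ := h
  let g : M → (Fin n → ℝ) × (Fin n → ℝ) := fun y ↦ (fun i ↦ q i y, fun i ↦ p i y)
  have hg : ContMDiffOn (𝓡 (2 * n)) 𝓘(ℝ, (Fin n → ℝ) × (Fin n → ℝ)) ∞ g (U ∩ O) :=
    (contMDiffOn_pi_space.2 fun i ↦ (hq i).mono inter_subset_left).prodMk_space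
      (contMDiffOn_pi_space.2 fun i ↦ (hp i).mono inter_subset_left)
  have hgd : ∀ y ∈ U ∩ O, ∀ v : TSpace (2 * n) y, ∀ i,
      mvfderiv (𝓡 (2 * n)) (q i) y v = (mvfderiv (𝓡 (2 * n)) g y v).1 i ∧
      mvfderiv (𝓡 (2 * n)) (p i) y v = (mvfderiv (𝓡 (2 * n)) g y v).2 i := by
    intro y hy v i
    have hd := (hg.contMDiffAt ((hU.inter hO).mem_nhds hy)).mdifferentiableAt (by simp)
    exact ⟨mvfderiv_clm_comp ((ContinuousLinearMap.proj (R := ℝ) (φ := fun _ : Fin n ↦ ℝ) i).comp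
        (ContinuousLinearMap.fst ℝ _ (Fin n → ℝ))) hd v,
      mvfderiv_clm_comp ((ContinuousLinearMap.proj (R := ℝ) (φ := fun _ : Fin n ↦ ℝ) i).comp
        (ContinuousLinearMap.snd ℝ (Fin n → ℝ) _)) hd v⟩
  obtain ⟨e, he, hxe, heU, heg⟩ := exists_isSmoothCoord (m := 2 * n) (x := x)
    (by simp [two_mul]) (hU.inter hO) hg ⟨hxU, hxO⟩ (by
      intro v hv
      refine hnd v fun w ↦ ?_
      rw [hΩ x hxU]
      refine Finset.sum_eq_zero fun i _ ↦ ?_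
      rw [(hgd x ⟨hxU, hxO⟩ v i).1, (hgd x ⟨hxU, hxO⟩ v i).2, hv]
      simp)
  refine ⟨K, e, ψ, ⟨he, ⟨contMDiffOn_of_mem_maximalAtlas hψ, contMDiffOn_symm_of_mem_maximalAtlas hψ⟩,
    fun y hy ↦ hψs y (heU hy).1, fun y hy i hi ↦ ?_, fun y hy i hi ↦ ?_, fun z hz v w ↦ ?_⟩, hxe,
    fun y hy ↦ (heU hy).2, fun i hi ↦ ?_⟩
  · rw [hK y (heU hy).1 i hi, heg y hy]
  · rw [hK' y (heU hy).1 i hi, heg y hy]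
  · have hzU := heU (e.map_target hz)
    have hD : ∀ v, mvfderiv (𝓡 (2 * n)) g (e.symm z) (coordFrame (2 * n) e z v) = v := by
      intro v
      have hd := (hg.contMDiffAt ((hU.inter hO).mem_nhds hzU)).mdifferentiableAt (by simp)
      have h1 := he.hasFDerivAt_comp_symm hz hd
      have h2 : (fun z ↦ z) =ᶠ[𝓝 z] fun z ↦ g (e.symm z) := by
        filter_upwards [e.open_target.mem_nhds hz] with y hy
        rw [← heg _ (e.map_target hy), e.right_inv hy]
      exact congrArg (fun T ↦ T v) ((h1.congr_of_eventuallyEq h2).unique (hasFDerivAt_id z))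
    rw [hΩ _ hzU.1]
    refine Finset.sum_congr rfl fun i _ ↦ ?_
    rw [(hgd _ hzU _ i).1, (hgd _ hzU _ i).2, (hgd _ hzU _ i).1, (hgd _ hzU _ i).2, hD, hD]
  · rw [heg x hxe]
    exact hKx i hi

namespace IsToricCoord

lemma hasFDerivAt_base_coord (h : IsToricCoord Ω pr K e ψ)
    (hpr : ContMDiff (𝓡 (2 * n)) (𝓡 n) ∞ pr)
    {z : (Fin n → ℝ) × (Fin n → ℝ)} (hz : z ∈ e.target) :
    ∃ T : (Fin n → ℝ) × (Fin n → ℝ) →L[ℝ] EuclideanSpace ℝ (Fin n),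
      HasFDerivAt (fun z ↦ ψ (pr (e.symm z))) T z ∧
      (IsRegularPt (m := 2 * n) (n := n) pr (e.symm z) ↔ Function.Surjective T) := by
  have hprd : MDifferentiableAt (𝓡 (2 * n)) (𝓡 n) pr (e.symm z) :=
    (hpr _).mdifferentiableAt (by simp)
  have hzc := h.mem_source _ (e.map_target hz)
  have hT := h.coord.hasFDerivAt_comp_symm hz
    ((h.base_coord.mdifferentiableAt hzc).comp _ hprd)
  exact ⟨_, hT, h.coord.isRegularPt_iff h.base_coord hz hprd hzc hT⟩

/-- The `i`-th component `(q_i² + p_i²) / 2` has zero differential at such points. -/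
lemma not_isRegularPt (h : IsToricCoord Ω pr K e ψ) (hpr : ContMDiff (𝓡 (2 * n)) (𝓡 n) ∞ pr)
    {z : (Fin n → ℝ) × (Fin n → ℝ)} (hz : z ∈ e.target) {i : Fin n} (hi : i ∈ K)
    (h1 : z.1 i = 0) (h2 : z.2 i = 0) : ¬ IsRegularPt (m := 2 * n) (n := n) pr (e.symm z) := by
  obtain ⟨T, hT, hreg⟩ := h.hasFDerivAt_base_coord hpr hz
  rw [hreg]
  intro hs
  obtain ⟨w, hw⟩ := hs (EuclideanSpace.single i 1)
  have h3 : HasFDerivAt (fun z ↦ ψ (pr (e.symm z)) i) ((EuclideanSpace.proj i).comp T) z :=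
    (EuclideanSpace.proj (𝕜 := ℝ) i).hasFDerivAt.comp z hT
  have h4 : (fun z : (Fin n → ℝ) × (Fin n → ℝ) ↦ (z.1 i ^ 2 + z.2 i ^ 2) / 2) =ᶠ[𝓝 z]
      fun z ↦ ψ (pr (e.symm z)) i := by
    filter_upwards [e.open_target.mem_nhds hz] with y hy
    rw [h.eq_of_mem _ (e.map_target hy) i hi, e.right_inv hy]
  have h5 := ((ContinuousLinearMap.proj (R := ℝ) (φ := fun _ : Fin n ↦ ℝ) i).comp
        (ContinuousLinearMap.fst ℝ _ (Fin n → ℝ))).hasFDerivAt (x := z)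
  have h6 := ((ContinuousLinearMap.proj (R := ℝ) (φ := fun _ : Fin n ↦ ℝ) i).comp
        (ContinuousLinearMap.snd ℝ (Fin n → ℝ) _)).hasFDerivAt (x := z)
  have h7 : HasFDerivAt (fun z : (Fin n → ℝ) × (Fin n → ℝ) ↦ (z.1 i ^ 2 + z.2 i ^ 2) / 2)
      (0 : (Fin n → ℝ) × (Fin n → ℝ) →L[ℝ] ℝ) z := by
    refine (((h5.pow 2).add (h6.pow 2)).mul_const (2⁻¹ : ℝ)).congr_fderiv ?_
    simp [h1, h2]
  have h8 := congrArg (fun T ↦ T w) ((h3.congr_of_eventuallyEq h4).unique h7)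
  simp [hw] at h8

lemma isRegularPt_of_eq_empty (h : IsToricCoord Ω pr ∅ e ψ)
    (hpr : ContMDiff (𝓡 (2 * n)) (𝓡 n) ∞ pr)
    {z : (Fin n → ℝ) × (Fin n → ℝ)} (hz : z ∈ e.target) :
    IsRegularPt (m := 2 * n) (n := n) pr (e.symm z) := by
  obtain ⟨T, hT, hreg⟩ := h.hasFDerivAt_base_coord hpr hz
  rw [hreg]
  intro u
  refine ⟨(0, fun i ↦ u i), ?_⟩
  ext i
  have h3 : HasFDerivAt (fun z ↦ ψ (pr (e.symm z)) i) ((EuclideanSpace.proj i).comp T) z :=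
    (EuclideanSpace.proj (𝕜 := ℝ) i).hasFDerivAt.comp z hT
  have h4 : (fun z : (Fin n → ℝ) × (Fin n → ℝ) ↦ z.2 i) =ᶠ[𝓝 z]
      fun z ↦ ψ (pr (e.symm z)) i := by
    filter_upwards [e.open_target.mem_nhds hz] with y hy
    rw [h.eq_of_notMem _ (e.map_target hy) i (Finset.notMem_empty i), e.right_inv hy]
  have h6 := ((ContinuousLinearMap.proj (R := ℝ) (φ := fun _ : Fin n ↦ ℝ) i).comp
        (ContinuousLinearMap.snd ℝ (Fin n → ℝ) _)).hasFDerivAt (x := z)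
  exact congrArg (fun T ↦ T (0, fun i ↦ u i)) ((h3.congr_of_eventuallyEq h4).unique h6)

lemma pr_planeRotation (h : IsToricCoord Ω pr K e ψ) {i : Fin n} (hi : i ∈ K)
    {z : (Fin n → ℝ) × (Fin n → ℝ)} (hz : ∀ θ, planeRotation i z θ ∈ e.target) (θ : ℝ) :
    pr (e.symm (planeRotation i z θ)) = pr (e.symm z) := by
  have hz0 := hz 0
  rw [planeRotation_zero] at hz0
  have h1 := e.map_target (hz θ)
  have h2 := e.map_target hz0
  refine ψ.injOn (h.mem_source _ h1) (h.mem_source _ h2) ?_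
  ext j
  by_cases hj : j ∈ K
  · rw [h.eq_of_mem _ h1 j hj, h.eq_of_mem _ h2 j hj, e.right_inv (hz θ), e.right_inv hz0,
      planeRotation_fst, planeRotation_snd]
    split_ifs with hij
    · subst hij
      linear_combination (z.1 j ^ 2 + z.2 j ^ 2) / 2 * Real.sin_sq_add_cos_sq θ
    · rfl
  · rw [h.eq_of_notMem _ h1 j hj, h.eq_of_notMem _ h2 j hj, e.right_inv (hz θ), e.right_inv hz0,
      planeRotation_snd, if_neg (by rintro rfl; exact hj hi)]

/-- The map `pr` is constant along the orbit, so differentiating in the angle shows that the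
velocity is tangent to the fibre. Flatness along the fibre thus applies to the orbit. -/
lemma mfderiv_planeRotationVelocity (h : IsToricCoord Ω pr K e ψ)
    (hpr : ContMDiff (𝓡 (2 * n)) (𝓡 n) ∞ pr) {i : Fin n} (hi : i ∈ K)
    {z : (Fin n → ℝ) × (Fin n → ℝ)} (hz : ∀ θ, planeRotation i z θ ∈ e.target) (θ : ℝ) :
    mfderiv (𝓡 (2 * n)) (𝓡 n) pr (e.symm (planeRotation i z θ))
      (coordFrame (2 * n) e (planeRotation i z θ) (planeRotationVelocity i z θ)) = 0 := by
  have hprd : MDifferentiableAt (𝓡 (2 * n)) (𝓡 n) pr (e.symm (planeRotation i z θ)) :=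
    (hpr _).mdifferentiableAt (by simp)
  have h1 := (hprd.hasMFDerivAt.comp _
    (h.coord.mdifferentiableAt_symm (hz θ)).hasMFDerivAt).comp θ
      (hasDerivAt_planeRotation i z θ).hasFDerivAt.hasMFDerivAt
  have h2 : (fun _ : ℝ ↦ pr (e.symm z)) = (pr ∘ e.symm) ∘ planeRotation i z := by
    funext θ
    exact (h.pr_planeRotation hi hz θ).symm
  rw [← h2] at h1
  have h3 := hasMFDerivAt_unique h1 (hasMFDerivAt_const (pr (e.symm z)) θ)
  have h4 := congrArg (fun T ↦ T (1 : ℝ)) h3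
  have h5 : (ContinuousLinearMap.toSpanSingleton ℝ (planeRotationVelocity i z θ)) (1 : ℝ)
      = planeRotationVelocity i z θ := by simp
  exact (congrArg (fun w ↦ mfderiv (𝓡 (2 * n)) (𝓡 n) pr (e.symm (planeRotation i z θ))
      (coordFrame (2 * n) e (planeRotation i z θ) w)) h5.symm).trans h4

end IsToricCoord

variable {L : M → Type*} [TopologicalSpace (TotalSpace ℂ L)]
  [∀ x, NormedAddCommGroup (L x)] [∀ x, InnerProductSpace ℂ (L x)]
  [FiberBundle ℂ L] [VectorBundle ℂ ℂ L] [VectorBundle ℝ ℂ L] [T2Space M]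
  [IsManifold (𝓡 (2 * n)) ∞ M] [ContMDiffVectorBundle ∞ ℂ L (𝓡 (2 * n))]
  {nabla : CovariantDerivative (𝓡 (2 * n)) ℂ L}

/-- Near a critical point of toric type, the fibre through this point consists of critical points, and
no regular fibre admits a flat section. -/
lemma IsPrequantization.exists_nhds_of_isToricAt (h : IsPrequantization Ω nabla)
    (hΩ : IsSymplecticForm Ω) (hpr : ContMDiff (𝓡 (2 * n)) (𝓡 n) ∞ pr) {x₀ : M}
    (hx₀ : ¬ IsRegularPt (m := 2 * n) (n := n) pr x₀) (ht : IsToricAt Ω pr x₀) :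
    ∃ W ∈ 𝓝 x₀, ∀ x ∈ W, IsRegularPt (m := 2 * n) (n := n) pr x → pr x ≠ pr x₀ ∧
      ∀ τ : Π x : M, L x, IsSmoothSection (m := 2 * n) τ →
        ¬ IsPhaseFlatOn nabla pr τ (pr ⁻¹' {pr x}) := by
  obtain ⟨s, hs, hsx₀⟩ := exists_isSmoothSection_ne_zero (m := 2 * n) (L := L) x₀
  obtain ⟨K, e, ψ, he, hxe, heO, hK⟩ := ht.exists_isToricCoord (hΩ.nondegenerate x₀)
    (h.isOpen_ne_zero hs) hsx₀
  have hz₀ := e.map_source hxe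
  obtain ⟨i, hi⟩ : K.Nonempty := by
    rw [Finset.nonempty_iff_ne_empty]
    rintro rfl
    have h1 := he.isRegularPt_of_eq_empty hpr hz₀
    rw [e.left_inv hxe] at h1
    exact hx₀ h1
  obtain ⟨r, hr, hrt⟩ := Metric.nhds_basis_ball.mem_iff.1 (e.open_target.mem_nhds hz₀)
  -- The bound `1 / 2` keeps the circles small enough for the holonomy argument.
  set r' := min r (1 / 2)
  have hr' : 0 < r' := lt_min hr (by norm_num)
  have hrt' : Metric.ball (e x₀) r' ⊆ e.target :=
    (Metric.ball_subset_ball (min_le_left _ _)).trans hrt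
  refine ⟨e.source ∩ e ⁻¹' (Metric.ball (e x₀) (r' / 2)), inter_mem (e.open_source.mem_nhds hxe)
      ((e.continuousAt hxe).preimage_mem_nhds (Metric.ball_mem_nhds _ (half_pos hr'))), ?_⟩
  rintro x ⟨hx, hxr⟩ hreg
  have hz := e.map_source hx
  have hcrit : ¬ ((e x).1 i = 0 ∧ (e x).2 i = 0) := fun h0 ↦ by
    have h1 := he.not_isRegularPt hpr hz hi h0.1 h0.2
    rw [e.left_inv hx] at h1
    exact h1 hreg
  constructor
  -- On the fibre through `x₀` the elliptic component is `0`, which forces `q_i = p_i = 0`, that is,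
  -- a critical point.
  · intro hxx₀
    have h1 := he.eq_of_mem x hx i hi
    have h2 := he.eq_of_mem x₀ hxe i hi
    rw [hxx₀, h2, (hK i hi).1, (hK i hi).2] at h1
    have hq := sq_nonneg ((e x).1 i)
    have hp := sq_nonneg ((e x).2 i)
    exact hcrit ⟨pow_eq_zero_iff two_ne_zero |>.1 (by linarith),
      pow_eq_zero_iff two_ne_zero |>.1 (by linarith)⟩
  · intro τ hτ hf
    have hrot : ∀ θ, planeRotation i (e x) θ ∈ e.target :=
      fun θ ↦ hrt' (planeRotation_mem_ball (hK i hi).1 (hK i hi).2 hxr θ)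
    refine hcrit (h.eq_zero_of_flat_on_orbit he.coord he.form_eq hs (fun x hx ↦ heO hx) hτ
      (min_le_right _ _) hrt' (hK i hi).1 (hK i hi).2 hxr fun θ ↦ ?_)
    have h1 := hf (e.symm (planeRotation i (e x) θ)) (by
      rw [mem_preimage, mem_singleton_iff, he.pr_planeRotation hi hrot, e.left_inv hx])
    exact ⟨h1.1, h1.2 _ (he.mfderiv_planeRotationVelocity hpr hi hrot θ)⟩

end

/-! ### Discreteness and finiteness -/

section
variable {n : ℕ} {M : Type*} [TopologicalSpace M] [T2Space M] [SecondCountableTopology M]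
  [ChartedSpace (EuclideanSpace ℝ (Fin (2 * n))) M] [IsManifold (𝓡 (2 * n)) ∞ M]
  {B : Type*} [TopologicalSpace B] [T2Space B] [ChartedSpace (EuclideanSpace ℝ (Fin n)) B]
  [IsManifold (𝓡 n) ∞ B]
  {L : M → Type*} [TopologicalSpace (TotalSpace ℂ L)]
  [∀ x, NormedAddCommGroup (L x)] [∀ x, InnerProductSpace ℂ (L x)]
  [FiberBundle ℂ L] [VectorBundle ℂ ℂ L] [VectorBundle ℝ ℂ L]
  [ContMDiffVectorBundle ∞ ℂ L (𝓡 (2 * n))]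
  {Ω : Π x : M, TSpace (2 * n) x →L[ℝ] TSpace (2 * n) x →L[ℝ] ℝ}
  {nabla : CovariantDerivative (𝓡 (2 * n)) ℂ L} {pr : M → B}

lemma IsPrequantization.isDiscrete_smoothBohrSommerfeld (h : IsPrequantization Ω nabla)
    (hΩ : IsSymplecticForm Ω) (hpr : IsLagrangianFibration Ω pr) :
    IsDiscrete (smoothBohrSommerfeld (n := n) nabla pr) := by
  refine ⟨discreteTopology_subtype_iff.2 fun b hb ↦ ?_⟩
  obtain ⟨⟨x, hx⟩, hreg, hBS⟩ := hb
  obtain ⟨σ, hσ, hf⟩ := hBS.exists_isPhaseFlatOn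
  have h1 := h.eventually_not_isPhaseFlatOn hΩ hpr (O := univ) (hpr.compact_fibre b) ⟨x, hx⟩
    isOpen_univ (inter_univ _).symm hreg hσ hf
  rw [← disjoint_iff, disjoint_principal_right]
  filter_upwards [h1] with b' hb' hb'S
  obtain ⟨τ, hτ, hτf⟩ := hb'S.2.2.exists_isPhaseFlatOn
  exact hb' τ hτ hτf

lemma IsPrequantization.finite_smoothBohrSommerfeld [CompactSpace M] (h : IsPrequantization Ω nabla)
    (hΩ : IsSymplecticForm Ω) (hpr : IsLagrangianFibration Ω pr)
    (htoric : ∀ x : M, ¬ IsRegularPt (m := 2 * n) (n := n) pr x → IsToricAt Ω pr x) :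
    (smoothBohrSommerfeld (n := n) nabla pr).Finite := by
  by_contra hinf
  obtain ⟨b, -, hb⟩ := Set.Infinite.exists_accPt_of_subset_isCompact hinf
    (isCompact_range hpr.smooth.continuous) (fun b' hb' ↦ hb'.1)
  have : (𝓝[≠] b ⊓ 𝓟 (smoothBohrSommerfeld (n := n) nabla pr)).NeBot := hb
  let U := Ultrafilter.of (𝓝[≠] b ⊓ 𝓟 (smoothBohrSommerfeld (n := n) nabla pr))
  have hU : (U : Filter B) ≤ _ := Ultrafilter.of_le _
  have hUb : (U : Filter B) ≤ 𝓝[≠] b := hU.trans inf_le_left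
  have hUS : ∀ᶠ b' in U, b' ∈ smoothBohrSommerfeld (n := n) nabla pr :=
    hU.trans inf_le_right (mem_principal_self _)
  have hUτ : ∀ᶠ b' in U, ∃ τ : Π x : M, L x, IsSmoothSection (m := 2 * n) τ ∧
      IsPhaseFlatOn nabla pr τ (pr ⁻¹' {b'}) :=
    hUS.mono fun b' hb' ↦ hb'.2.2.exists_isPhaseFlatOn
  set C := pr ⁻¹' {b} ∩ {x | IsRegularPt (m := 2 * n) (n := n) pr x} with hC
  have hfib : IsClosed (pr ⁻¹' {b}) := isClosed_singleton.preimage hpr.smooth.continuous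
  -- Near a critical point of its fibre the regular points lie on other fibres, so critical points
  -- are not limits of `C`.
  have hCc : IsClosed C := by
    rw [← isOpen_compl_iff, isOpen_iff_mem_nhds]
    intro x hx
    by_cases hxb : pr x = b
    · have hcrit : ¬ IsRegularPt (m := 2 * n) (n := n) pr x := fun h ↦ hx ⟨hxb, h⟩
      obtain ⟨W, hW, hWx⟩ := h.exists_nhds_of_isToricAt hΩ hpr.smooth hcrit (htoric x hcrit)
      filter_upwards [hW] with y hy hyC
      exact (hWx y hy hyC.2).1 (hyC.1.trans hxb.symm)
    · filter_upwards [hfib.isOpen_compl.mem_nhds hxb] with y hy hyC using hy hyC.1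
  have hO := isOpen_setOf_isRegularPt (n := n) hpr.smooth
  rcases C.eq_empty_or_nonempty with hCe | hCne
  · have : Nonempty M := hUS.exists.elim fun _ hb' ↦ range_nonempty_iff_nonempty.1 ⟨_, hb'.1⟩
    -- By compactness, points chosen on the Bohr–Sommerfeld fibres converge along `U` to a point
    -- over `b`, which is critical because `C` is empty. The chosen points are regular, so the
    -- absence of flat sections near a critical point is violated.
    choose! X hX using fun (b' : B) (hb' : b' ∈ range pr) ↦ hb'
    obtain ⟨x, -, hx⟩ := isCompact_univ.ultrafilter_le_nhds' (U.map X) univ_mem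
    have hXx : Tendsto X U (𝓝 x) := hx
    have h1 : Tendsto (fun b' ↦ pr (X b')) U (𝓝 (pr x)) :=
      (hpr.smooth.continuous.tendsto x).comp hXx
    have h2 : Tendsto (fun b' ↦ pr (X b')) U (𝓝 b) := by
      refine Tendsto.congr' ?_ (hUb.trans nhdsWithin_le_nhds : Tendsto id (U : Filter B) (𝓝 b))
      filter_upwards [hUS] with b' hb' using (hX b' hb'.1).symm
    have hxb := tendsto_nhds_unique h1 h2
    have hcrit : ¬ IsRegularPt (m := 2 * n) (n := n) pr x := fun h ↦ by
      have h3 : x ∈ C := ⟨hxb, h⟩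
      rw [hCe] at h3
      exact h3
    obtain ⟨W, hW, hWx⟩ := h.exists_nhds_of_isToricAt hΩ hpr.smooth hcrit (htoric x hcrit)
    obtain ⟨b', hb'W, hb'S, τ, hτ, hτf⟩ := ((hXx.eventually hW).and (hUS.and hUτ)).exists
    have h3 := hX b' hb'S.1
    refine (hWx _ hb'W (hb'S.2.1 _ h3)).2 τ hτ ?_
    rw [h3]
    exact hτf
  -- The limit section is flat over the compact set `C`, so fibres close to, but different from,
  -- that over `b` carry no flat section, whereas those selected by `U` do.
  · obtain ⟨σ, hσ, hf⟩ := h.exists_isPhaseFlatOn_of_ultrafilter hpr.smooth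
      (hUb.trans nhdsWithin_le_nhds) hUτ hCc hO hC fun x hx ↦ hx.2
    have h1 := h.eventually_not_isPhaseFlatOn hΩ hpr hCc.isCompact hCne hO hC (fun x hx ↦ hx.2) hσ hf
    obtain ⟨b', hb', τ, hτ, hτf⟩ := ((h1.filter_mono hUb).and hUτ).exists
    exact hb' τ hτ hτf

end

theorem theorem2 {n : ℕ}
    {M : Type*} [TopologicalSpace M] [T2Space M] [SecondCountableTopology M]
    [ChartedSpace (EuclideanSpace ℝ (Fin (2 * n))) M] [IsManifold (𝓡 (2 * n)) ∞ M]
    {B : Type*} [TopologicalSpace B] [T2Space B] [SecondCountableTopology B]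
    [ChartedSpace (EuclideanSpace ℝ (Fin n)) B] [IsManifold (𝓡 n) ∞ B]
    {L : M → Type*} [TopologicalSpace (TotalSpace ℂ L)]
    [∀ x, NormedAddCommGroup (L x)] [∀ x, InnerProductSpace ℂ (L x)]
    [FiberBundle ℂ L] [VectorBundle ℂ ℂ L]
    [VectorBundle ℝ ℂ L] [ContMDiffVectorBundle ∞ ℂ L (𝓡 (2 * n))]
    (Ω : Π x : M, TSpace (2 * n) x →L[ℝ] TSpace (2 * n) x →L[ℝ] ℝ)
    (hΩ : IsSymplecticForm Ω)
    (nabla : CovariantDerivative (𝓡 (2 * n)) ℂ L) (hnabla : IsPrequantization Ω nabla)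
    (pr : M → B) (hpr : IsLagrangianFibration Ω pr) :
    IsDiscrete (smoothBohrSommerfeld (n := n) nabla pr) ∧
    (CompactSpace M → (∀ x : M, ¬ IsRegularPt (m := 2 * n) (n := n) pr x → IsToricAt Ω pr x) →
      (smoothBohrSommerfeld (n := n) nabla pr).Finite) := by
  exact ⟨hnabla.isDiscrete_smoothBohrSommerfeld hΩ hpr, fun _ htoric ↦
    hnabla.finite_smoothBohrSommerfeld hΩ hpr htoric⟩
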